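/- Let $p$ be a prime and let $\mathcal K$ be a simplicial complex on $[m]=\{1,\dots,m\}$ containing all the one-element subsets $\{i\}$ (and $\varnothing$). Let $$\mathbb Z_p^{\mathcal K}=F(a_1,\dots,a_m)\big/\bigl(a_i^p=1,\ a_ia_j=a_ja_i\text{ for }\{i,j\}\in\mathcal K\bigr)$$ be the graph product of cyclic groups of order $p$. A $p$-central series on a group $G$ is a sequence of subgroups $G=\Gamma_1\supseteq\Gamma_2\supseteq\cdots$ such that $(\Gamma_k,\Gamma_l)\subseteq\Gamma_{k+l}$ for all $k,l$, and $g^p\in\Gamma_{pk}$ whenever $g\in\Gamma_k$. The lower $p$-central series $\gamma^{[p]}(G)$ is the fastest descending one: $\gamma^{[p]}_k(G)\subseteq\Gamma_k$ for every $p$-central series $\Gamma$ and every $k$. The group $\operatorname{gr}_\bullet\gamma^{[p]}(G)=\bigoplus_{k\ge1}\gamma^{[p]}_k(G)/\gamma^{[p]}_{k+1}(G)$ is a Lie algebra over $\mathbb Z_p$ with bracket given on homogeneous elements by $[\overline g,\overline h]=\overline{(g,h)}$, where $(g,h)=g^{-1}h^{-1}gh$. A $p$-Lie algebra (restricted Lie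 algebra) over $\mathbb Z_p$ is a Lie algebra over $\mathbb Z_p$ with an operation $x\mapsto x^{[p]}$ such that $[x,y^{[p]}]=[\dots[[x,y],y],\dots,y]$ ($p$ brackets), $(\alpha x)^{[p]}=\alpha^px^{[p]}$ and $(x+y)^{[p]}=x^{[p]}+y^{[p]}+\sum_{i=1}^{p-1}s_i(x,y)$, where $[\dots[[x,\lambda x+y],\lambda x+y],\dots,\lambda x+y]=\sum_{i=1}^{p-1}i\,s_i(x,y)\lambda^{i-1}$ ($p-1$ brackets, $\lambda$ a formal variable). Let $FL_p(u_1,\dots,u_m)$ denote the free $p$-Lie algebra over $\mathbb Z_p$. **Theorem.** The $p$-power operation given on homogeneous elements by $\overline g^{\,[p]}=\overline{g^p}$, for $g\in\gamma^{[p]}_k(\mathbb Z_p^{\mathcal K})$ and with the class of $g^p$ taken in degree $pk$, extends uniquely to a $p$-Lie algebra structure on the Lie algebra $\operatorname{gr}_\bullet\gamma^{[p]}(\mathbb Z_p^{\mathcal K})$, and with this structure there is an isomorphism of $p$-Lie algebras over $\mathbb Z_p$ $$\operatorname{gr}_\bullet\gamma^{[p]}\bigl(\mathbb Z_p^{\mathcal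 K}\bigr)\;\cong\;FL_p(u_1,\dots,u_m)\big/\bigl(u_i^{[p]}=0,\ [u_i,u_j]=0\text{ for }\{i,j\}\in\mathcal K\bigr).$$ Moreover, the algebra $L$ on the right-hand side is the graph product of $m$ copies of the trivial one-generator $p$-Lie algebra $\mathbb Z_p\langle u\rangle=FL_p(u)/(u^{[p]}=0)$: it is the colimit, in the category of $p$-Lie algebras over $\mathbb Z_p$, of the diagram $I\mapsto\prod_{i\in I}\mathbb Z_p\langle u\rangle$ over the simplices $I\in\mathcal K$ and their inclusions, where for $I\subseteq J$ the map $\prod_{i\in I}\mathbb Z_p\langle u\rangle\to\prod_{j\in J}\mathbb Z_p\langle u\rangle$ is extension by zero, and where the structure map $\mathbb Z_p\langle u\rangle\to L$ of the vertex $\{i\}$ sends $u$ to $u_i$. -/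

import Mathlib

open scoped DirectSum

universe w

/-! ## Restricted Lie algebras over `ZMod p` -/

namespace RestrictedLie

/-- `adCoeff x y n j` is the coefficient of `λ ^ j` in the expansion of the `n`-fold bracket
`[…[[x, λ x + y], λ x + y], …, λ x + y]` (see `adCoeff_expansion`). Only raw operations are used,
so that the same expression makes sense for formal terms. -/
def adCoeff {L : Type*} [Add L] [Zero L] [Bracket L L] (x y : L) : ℕ → ℕ → L
  | 0, 0 => x
  | 0, _ + 1 => 0
  | n + 1, 0 => ⁅adCoeff x y n 0, y⁆
  | n + 1, j + 1 => ⁅adCoeff x y n j, x⁆ + ⁅adCoeff x y n (j + 1), y⁆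

/-- The element `s_i(x, y)`, determined by the expansion
`[…[[x, λ x + y], λ x + y], …, λ x + y] = ∑ i s_i(x, y) λ ^ (i - 1)` with `p - 1` brackets on the
left and `1 ≤ i ≤ p - 1` on the right. -/
def jacobson (p : ℕ) {L : Type*} [Add L] [Zero L] [SMul (ZMod p) L] [Bracket L L]
    (x y : L) (i : ℕ) : L :=
  ((i : ZMod p)⁻¹) • adCoeff x y (p - 1) (i - 1)

/-- The finite sum `f 1 + ⋯ + f n`, again for raw operations. -/
def sumUpTo {L : Type*} [Add L] [Zero L] (f : ℕ → L) : ℕ → L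
  | 0 => 0
  | n + 1 => sumUpTo f n + f (n + 1)

theorem sumUpTo_eq {L : Type*} [AddCommMonoid L] (f : ℕ → L) (n : ℕ) :
    sumUpTo f n = ∑ i ∈ Finset.Icc 1 n, f i := by
  induction n with
  | zero => rfl
  | succ n ih => rw [sumUpTo, ih, Finset.sum_Icc_succ_top (by omega)]

theorem adCoeff_eq_zero {L : Type*} [LieRing L] (x y : L) (n : ℕ) :
    ∀ j : ℕ, n < j → adCoeff x y n j = 0 := by
  induction n with
  | zero =>
    rintro (_ | j) hj
    · omega
    · rfl
  | succ n ih =>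
    rintro (_ | j) hj
    · omega
    · simp [adCoeff, ih j (by omega), ih (j + 1) (by omega)]

theorem adCoeff_expansion {R L : Type*} [CommRing R] [LieRing L] [LieAlgebra R L]
    (x y : L) (t : R) (n : ℕ) :
    (fun z => ⁅z, t • x + y⁆)^[n] x = ∑ j ∈ Finset.range (n + 1), t ^ j • adCoeff x y n j := by
  induction n with
  | zero => simp [adCoeff]
  | succ n ih =>
    rw [Function.iterate_succ_apply', ih]
    have h1 : ∑ j ∈ Finset.range (n + 1), t ^ (j + 1) • ⁅adCoeff x y n (j + 1), y⁆
        + t ^ 0 • ⁅adCoeff x y n 0, y⁆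
        = ∑ j ∈ Finset.range (n + 1), t ^ j • ⁅adCoeff x y n j, y⁆ := by
      rw [← Finset.sum_range_succ' (fun j => t ^ j • ⁅adCoeff x y n j, y⁆) (n + 1),
        Finset.sum_range_succ, adCoeff_eq_zero x y n (n + 1) (by omega)]
      simp
    rw [Finset.sum_range_succ' _ (n + 1)]
    simp only [adCoeff, smul_add, Finset.sum_add_distrib, sum_lie, smul_lie, lie_add,
      lie_smul]
    rw [add_assoc, h1, Finset.smul_sum]
    simp only [smul_smul, pow_succ']

theorem map_adCoeff {L M : Type*} [Add L] [Zero L] [Bracket L L] [Add M] [Zero M]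
    [Bracket M M] (f : M → L) (h0 : f 0 = 0) (ha : ∀ x y, f (x + y) = f x + f y)
    (hb : ∀ x y : M, f ⁅x, y⁆ = ⁅f x, f y⁆) (x y : M) :
    ∀ n j : ℕ, f (adCoeff x y n j) = adCoeff (f x) (f y) n j
  | 0, 0 => rfl
  | 0, _ + 1 => h0
  | n + 1, 0 => by simp only [adCoeff, hb, map_adCoeff f h0 ha hb x y n 0]
  | n + 1, j + 1 => by
    simp only [adCoeff, hb, ha, map_adCoeff f h0 ha hb x y n j,
      map_adCoeff f h0 ha hb x y n (j + 1)]

end RestrictedLie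

/-- A `p`-Lie algebra (restricted Lie algebra) over the prime field `ZMod p`: a Lie algebra with a
`p`-power operation `x ↦ x^[p]`, written `pmap p x`, subject to the three usual identities. The
number `p` is meant to be a prime. -/
class RestrictedLieAlgebra (p : ℕ) (L : Type*) [LieRing L]
    [LieAlgebra (ZMod p) L] where
  /-- The `p`-power operation. -/
  pmap (p) : L → L
  /-- `[x, y^[p]] = […[[x, y], y], …, y]` with `p` brackets. -/
  lie_pmap (x y : L) : ⁅x, pmap y⁆ = (fun z => ⁅z, y⁆)^[p] x
  smul_pmap (a : ZMod p) (x : L) : pmap (a • x) = a ^ p • pmap x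
  pmap_add (x y : L) : pmap (x + y) =
    pmap x + pmap y + ∑ i ∈ Finset.Icc 1 (p - 1), RestrictedLie.jacobson p x y i

namespace RestrictedLie

open RestrictedLieAlgebra

/-- A Lie algebra homomorphism is a homomorphism of `p`-Lie algebras if it respects the
`p`-power operations. -/
def IsRestrictedHom (p : ℕ) {L M : Type*}
    [LieRing L] [LieAlgebra (ZMod p) L] [RestrictedLieAlgebra p L]
    [LieRing M] [LieAlgebra (ZMod p) M] [RestrictedLieAlgebra p M]
    (f : L →ₗ⁅ZMod p⁆ M) : Prop :=
  ∀ x : L, f (pmap p x) = pmap p (f x)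

/-! ### Products -/

section Product

variable {ι : Type*} (L : ι → Type*)

/-- The product of a family of Lie algebras, with the componentwise bracket. -/
instance piLieRing [∀ i, LieRing (L i)] : LieRing (∀ i, L i) where
  bracket x y := fun i => ⁅x i, y i⁆
  add_lie _ _ _ := funext fun _ => add_lie _ _ _
  lie_add _ _ _ := funext fun _ => lie_add _ _ _
  lie_self _ := funext fun _ => lie_self _
  leibniz_lie _ _ _ := funext fun _ => leibniz_lie _ _ _

instance piLieAlgebra (R : Type*) [CommRing R] [∀ i, LieRing (L i)] [∀ i, LieAlgebra R (L i)] :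
    LieAlgebra R (∀ i, L i) where
  lie_smul _ _ _ := funext fun _ => lie_smul _ _ _

theorem pi_adCoeff [∀ i, LieRing (L i)] (x y : ∀ i, L i) (n j : ℕ) (i : ι) :
    adCoeff x y n j i = adCoeff (x i) (y i) n j :=
  map_adCoeff (fun z : ∀ i, L i => z i) rfl (fun _ _ => rfl) (fun _ _ => rfl) x y n j

/-- The product of a family of `p`-Lie algebras, with the componentwise `p`-power operation. -/
instance piRestricted (p : ℕ) [∀ i, LieRing (L i)]
    [∀ i, LieAlgebra (ZMod p) (L i)] [∀ i, RestrictedLieAlgebra p (L i)] :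
    RestrictedLieAlgebra p (∀ i, L i) where
  pmap x := fun i => pmap p (x i)
  lie_pmap x y := by
    have h : ∀ n : ℕ, (fun z => ⁅z, y⁆)^[n] x = fun i => (fun z => ⁅z, y i⁆)^[n] (x i) := by
      intro n
      induction n with
      | zero => rfl
      | succ n ih =>
        rw [Function.iterate_succ_apply', ih]
        funext i
        rw [Function.iterate_succ_apply']
        rfl
    rw [h]
    funext i
    exact lie_pmap (x i) (y i)
  smul_pmap a x := funext fun i => smul_pmap a (x i)
  pmap_add x y := by
    funext i
    simp only [Pi.add_apply, Finset.sum_apply, jacobson, Pi.smul_apply, pi_adCoeff]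
    exact pmap_add (x i) (y i)

end Product

/-! ### Quotients by restricted ideals -/

section Quotient

theorem adCoeff_mem {R L : Type*} [CommRing R] [LieRing L] [LieAlgebra R L] {I : LieIdeal R L}
    {x : L} (hx : x ∈ I) (y : L) : ∀ n j : ℕ, adCoeff x y n j ∈ I
  | 0, 0 => hx
  | 0, _ + 1 => I.zero_mem
  | n + 1, 0 => lie_mem_left _ _ _ _ _ (adCoeff_mem hx y n 0)
  | n + 1, j + 1 => I.add_mem (lie_mem_left _ _ _ _ _ (adCoeff_mem hx y n j))
      (lie_mem_left _ _ _ _ _ (adCoeff_mem hx y n (j + 1)))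

variable (p : ℕ) {L : Type*} [LieRing L] [LieAlgebra (ZMod p) L]
  [RestrictedLieAlgebra p L]

/-- The restricted ideal generated by a set `S`: the smallest Lie ideal that contains `S` and is
closed under the `p`-power operation. -/
def restrictedSpan (S : Set L) : LieIdeal (ZMod p) L :=
  sInf {I | S ⊆ (I : Set L) ∧ ∀ x ∈ I, pmap p x ∈ I}

theorem mem_restrictedSpan {S : Set L} {x : L} : x ∈ restrictedSpan p S ↔
    ∀ I : LieIdeal (ZMod p) L, S ⊆ (I : Set L) → (∀ x ∈ I, pmap p x ∈ I) → x ∈ I := by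
  rw [← SetLike.mem_coe, restrictedSpan, LieSubmodule.coe_sInf]
  simp

theorem subset_restrictedSpan (S : Set L) : S ⊆ (restrictedSpan p S : Set L) :=
  fun _ hx => (mem_restrictedSpan p).2 fun _ hS _ => hS hx

theorem pmap_mem_restrictedSpan {S : Set L} {x : L} (hx : x ∈ restrictedSpan p S) :
    pmap p x ∈ restrictedSpan p S :=
  (mem_restrictedSpan p).2 fun I hS hI => hI x ((mem_restrictedSpan p).1 hx I hS hI)

/-- The quotient of a `p`-Lie algebra `L` by the relations `x = 0` for `x ∈ S`. -/
abbrev QuotientBy (S : Set L) : Type _ := L ⧸ restrictedSpan p S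

/-- The canonical projection. -/
def quotientMk (S : Set L) : L →ₗ⁅ZMod p⁆ QuotientBy p S where
  toFun := LieSubmodule.Quotient.mk
  map_add' _ _ := rfl
  map_smul' _ _ := rfl
  map_lie' := rfl

instance quotientRestricted (S : Set L) : RestrictedLieAlgebra p (QuotientBy p S) where
  pmap := Quotient.map' (pmap p) (by
    intro x y h
    rw [Submodule.quotientRel_def] at h ⊢
    obtain ⟨n, rfl⟩ : ∃ n, x = n + y := ⟨x - y, by abel⟩
    have hn : n ∈ restrictedSpan p S := by simpa using h
    have : pmap p (n + y) - pmap p y ∈ restrictedSpan p S := by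
      rw [pmap_add, show ∀ a b c : L, a + b + c - b = a + c by intros; abel]
      exact add_mem (pmap_mem_restrictedSpan p hn)
        (sum_mem fun i _ => SMulMemClass.smul_mem _ (adCoeff_mem hn y _ _))
    exact this)
  lie_pmap x y := by
    obtain ⟨x, rfl⟩ : ∃ a, quotientMk p S a = x := Quotient.mk_surjective x
    obtain ⟨y, rfl⟩ : ∃ a, quotientMk p S a = y := Quotient.mk_surjective y
    have h : ∀ n : ℕ, (fun z => ⁅z, quotientMk p S y⁆)^[n] (quotientMk p S x)
        = quotientMk p S ((fun z => ⁅z, y⁆)^[n] x) := by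
      intro n
      induction n with
      | zero => rfl
      | succ n ih => rw [Function.iterate_succ_apply', ih, Function.iterate_succ_apply']; rfl
    rw [h, ← lie_pmap]
    rfl
  smul_pmap a x := by
    obtain ⟨x, rfl⟩ : ∃ a, quotientMk p S a = x := Quotient.mk_surjective x
    exact congrArg (quotientMk p S) (smul_pmap a x)
  pmap_add x y := by
    obtain ⟨x, rfl⟩ : ∃ a, quotientMk p S a = x := Quotient.mk_surjective x
    obtain ⟨y, rfl⟩ : ∃ a, quotientMk p S a = y := Quotient.mk_surjective y
    have h : ∀ n j, adCoeff (quotientMk p S x) (quotientMk p S y) n j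
        = quotientMk p S (adCoeff x y n j) := fun n j =>
      (map_adCoeff (quotientMk p S : L → QuotientBy p S) rfl (fun _ _ => rfl) (fun _ _ => rfl) x y n j).symm
    have h2 := congrArg (quotientMk p S) (pmap_add (p := p) x y)
    simp only [jacobson, h]
    simp only [jacobson, map_add (quotientMk p S), map_sum, map_smul] at h2
    exact h2

theorem quotientMk_pmap (S : Set L) : IsRestrictedHom p (quotientMk p S) := fun _ => rfl

end Quotient

/-! ### Free `p`-Lie algebras -/

/-- Formal expressions in the operations of a `p`-Lie algebra over `ZMod p`. -/
inductive Term (p : ℕ) (X : Type*) : Type _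
  | of : X → Term p X
  | zero : Term p X
  | add : Term p X → Term p X → Term p X
  | smul : ZMod p → Term p X → Term p X
  | lie : Term p X → Term p X → Term p X
  | pow : Term p X → Term p X

namespace Term

variable {p : ℕ} {X : Type*}

instance : Zero (Term p X) := ⟨zero⟩
instance : Add (Term p X) := ⟨add⟩
instance : SMul (ZMod p) (Term p X) := ⟨smul⟩
instance : Bracket (Term p X) (Term p X) := ⟨lie⟩

/-- The relation on formal expressions generated by the axioms of a `p`-Lie algebra. -/
inductive Rel : Term p X → Term p X → Prop
  | add_congr_left {a a' : Term p X} (b : Term p X) : Rel a a' → Rel (a + b) (a' + b)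
  | add_congr_right (a : Term p X) {b b' : Term p X} : Rel b b' → Rel (a + b) (a + b')
  | smul_congr (t : ZMod p) {a a' : Term p X} : Rel a a' → Rel (t • a) (t • a')
  | lie_congr_left {a a' : Term p X} (b : Term p X) : Rel a a' → Rel ⁅a, b⁆ ⁅a', b⁆
  | lie_congr_right (a : Term p X) {b b' : Term p X} : Rel b b' → Rel ⁅a, b⁆ ⁅a, b'⁆
  | pow_congr {a a' : Term p X} : Rel a a' → Rel (pow a) (pow a')
  | add_assoc (a b c : Term p X) : Rel (a + b + c) (a + (b + c))
  | add_comm (a b : Term p X) : Rel (a + b) (b + a)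
  | zero_add (a : Term p X) : Rel (0 + a) a
  | one_smul (a : Term p X) : Rel ((1 : ZMod p) • a) a
  | mul_smul (s t : ZMod p) (a : Term p X) : Rel ((s * t) • a) (s • t • a)
  | smul_add (t : ZMod p) (a b : Term p X) : Rel (t • (a + b)) (t • a + t • b)
  | add_smul (s t : ZMod p) (a : Term p X) : Rel ((s + t) • a) (s • a + t • a)
  | zero_smul (a : Term p X) : Rel ((0 : ZMod p) • a) 0
  | add_lie (a b c : Term p X) : Rel ⁅a + b, c⁆ (⁅a, c⁆ + ⁅b, c⁆)
  | lie_add (a b c : Term p X) : Rel ⁅a, b + c⁆ (⁅a, b⁆ + ⁅a, c⁆)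
  | lie_self (a : Term p X) : Rel ⁅a, a⁆ 0
  | leibniz_lie (a b c : Term p X) : Rel ⁅a, ⁅b, c⁆⁆ (⁅⁅a, b⁆, c⁆ + ⁅b, ⁅a, c⁆⁆)
  | lie_smul (t : ZMod p) (a b : Term p X) : Rel ⁅a, t • b⁆ (t • ⁅a, b⁆)
  | lie_pow (a b : Term p X) : Rel ⁅a, pow b⁆ ((fun z => ⁅z, b⁆)^[p] a)
  | smul_pow (t : ZMod p) (a : Term p X) : Rel (pow (t • a)) (t ^ p • pow a)
  | pow_add (a b : Term p X) :
      Rel (pow (a + b)) (pow a + pow b + sumUpTo (jacobson p a b) (p - 1))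

end Term

/-- The free `p`-Lie algebra `FL_p(x_s : s ∈ X)` over `ZMod p`: formal expressions modulo the
axioms of a `p`-Lie algebra. Its universal property is `FreeRestricted.existsUnique_lift`. -/
def FreeRestricted (p : ℕ) (X : Type*) : Type _ := Quot (Term.Rel (p := p) (X := X))

namespace FreeRestricted

variable {p : ℕ} {X : Type*}

/-- The class of a formal expression. -/
def mk (a : Term p X) : FreeRestricted p X := Quot.mk _ a

/-- The free generators. -/
def of (p : ℕ) {X : Type*} (x : X) : FreeRestricted p X := mk (Term.of x)

instance : Zero (FreeRestricted p X) := ⟨mk 0⟩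

instance : Add (FreeRestricted p X) :=
  ⟨Quot.map₂ (· + ·) (fun a _ _ h => .add_congr_right a h) (fun _ _ b h => .add_congr_left b h)⟩

instance : Neg (FreeRestricted p X) :=
  ⟨Quot.map ((-1 : ZMod p) • ·) (fun _ _ h => .smul_congr _ h)⟩

instance : AddCommGroup (FreeRestricted p X) where
  add_assoc := by rintro ⟨a⟩ ⟨b⟩ ⟨c⟩; exact Quot.sound (.add_assoc a b c)
  add_comm := by rintro ⟨a⟩ ⟨b⟩; exact Quot.sound (.add_comm a b)
  zero_add := by rintro ⟨a⟩; exact Quot.sound (.zero_add a)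
  add_zero := by
    rintro ⟨a⟩
    exact (Quot.sound (.add_comm a 0)).trans (Quot.sound (.zero_add a))
  neg_add_cancel := by
    rintro ⟨a⟩
    have h1 : mk ((-1 : ZMod p) • a + a) = mk ((-1 : ZMod p) • a + (1 : ZMod p) • a) :=
      (Quot.sound (.add_congr_right _ (.one_smul a))).symm
    have h2 : mk ((-1 : ZMod p) • a + (1 : ZMod p) • a) = mk (((-1 : ZMod p) + 1) • a) :=
      (Quot.sound (.add_smul _ _ a)).symm
    refine h1.trans (h2.trans ?_)
    rw [neg_add_cancel]
    exact Quot.sound (.zero_smul a)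
  nsmul := nsmulRec
  zsmul := zsmulRec

instance : Module (ZMod p) (FreeRestricted p X) where
  smul t := Quot.map (t • ·) (fun _ _ h => .smul_congr t h)
  one_smul := by rintro ⟨a⟩; exact Quot.sound (.one_smul a)
  mul_smul := by rintro s t ⟨a⟩; exact Quot.sound (.mul_smul s t a)
  smul_add := by rintro t ⟨a⟩ ⟨b⟩; exact Quot.sound (.smul_add t a b)
  add_smul := by rintro s t ⟨a⟩; exact Quot.sound (.add_smul s t a)
  zero_smul := by rintro ⟨a⟩; exact Quot.sound (.zero_smul a)
  smul_zero := by
    intro t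
    have h : mk (p := p) (X := X) (t • 0) = mk (t • (0 : ZMod p) • 0) :=
      (Quot.sound (.smul_congr t (.zero_smul 0))).symm
    refine h.trans ((Quot.sound (.mul_smul t 0 0)).symm.trans ?_)
    rw [mul_zero]
    exact Quot.sound (.zero_smul 0)

instance : LieRing (FreeRestricted p X) where
  bracket := Quot.map₂ (⁅·, ·⁆) (fun a _ _ h => .lie_congr_right a h)
    (fun _ _ b h => .lie_congr_left b h)
  add_lie := by rintro ⟨a⟩ ⟨b⟩ ⟨c⟩; exact Quot.sound (.add_lie a b c)
  lie_add := by rintro ⟨a⟩ ⟨b⟩ ⟨c⟩; exact Quot.sound (.lie_add a b c)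
  lie_self := by rintro ⟨a⟩; exact Quot.sound (.lie_self a)
  leibniz_lie := by rintro ⟨a⟩ ⟨b⟩ ⟨c⟩; exact Quot.sound (.leibniz_lie a b c)

instance : LieAlgebra (ZMod p) (FreeRestricted p X) where
  lie_smul := by rintro t ⟨a⟩ ⟨b⟩; exact Quot.sound (.lie_smul t a b)

theorem mk_iterate (a b : Term p X) (n : ℕ) :
    mk ((fun z => ⁅z, b⁆)^[n] a) = (fun z => ⁅z, mk b⁆)^[n] (mk a) := by
  induction n with
  | zero => rfl
  | succ n ih => rw [Function.iterate_succ_apply', Function.iterate_succ_apply', ← ih]; rfl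

theorem mk_adCoeff (a b : Term p X) : ∀ n j : ℕ,
    mk (adCoeff a b n j) = adCoeff (mk a) (mk b) n j
  | 0, 0 => rfl
  | 0, _ + 1 => rfl
  | n + 1, 0 => congrArg (fun z : FreeRestricted p X => ⁅z, mk b⁆) (mk_adCoeff a b n 0)
  | n + 1, j + 1 => congrArg₂ (fun z w : FreeRestricted p X => ⁅z, mk a⁆ + ⁅w, mk b⁆)
      (mk_adCoeff a b n j) (mk_adCoeff a b n (j + 1))

theorem mk_sumUpTo (f : ℕ → Term p X) (n : ℕ) :
    mk (sumUpTo f n) = ∑ i ∈ Finset.Icc 1 n, mk (f i) := by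
  rw [← sumUpTo_eq (fun i => mk (f i))]
  induction n with
  | zero => rfl
  | succ n ih => exact congrArg (fun z : FreeRestricted p X => z + mk (f (n + 1))) ih

instance : RestrictedLieAlgebra p (FreeRestricted p X) where
  pmap := Quot.map Term.pow (fun _ _ h => .pow_congr h)
  lie_pmap := by
    rintro ⟨a⟩ ⟨b⟩
    exact (Quot.sound (.lie_pow a b)).trans (mk_iterate a b p)
  smul_pmap := by rintro t ⟨a⟩; exact Quot.sound (.smul_pow t a)
  pmap_add := by
    rintro ⟨a⟩ ⟨b⟩
    refine (Quot.sound (.pow_add a b)).trans ?_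
    change mk (Term.pow a) + mk (Term.pow b) + mk (sumUpTo (jacobson p a b) (p - 1)) = _
    rw [mk_sumUpTo]
    refine congrArg _ (Finset.sum_congr rfl fun i _ => ?_)
    exact congrArg (fun z : FreeRestricted p X => ((i : ZMod p)⁻¹) • z) (mk_adCoeff a b _ _)

section Lift

variable {M : Type*} [LieRing M] [LieAlgebra (ZMod p) M] [RestrictedLieAlgebra p M]

/-- Evaluation of formal expressions in a `p`-Lie algebra. -/
def eval (g : X → M) : Term p X → M
  | .of x => g x
  | .zero => 0
  | .add a b => eval g a + eval g b
  | .smul t a => t • eval g a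
  | .lie a b => ⁅eval g a, eval g b⁆
  | .pow a => pmap p (eval g a)

theorem eval_rel (g : X → M) {a b : Term p X} (h : Term.Rel a b) : eval g a = eval g b := by
  induction h with
  | add_congr_left b _ ih => exact congrArg (· + eval g b) ih
  | add_congr_right a _ ih => exact congrArg (eval g a + ·) ih
  | smul_congr t _ ih => exact congrArg (t • ·) ih
  | lie_congr_left b _ ih => exact congrArg (⁅·, eval g b⁆) ih
  | lie_congr_right a _ ih => exact congrArg (⁅eval g a, ·⁆) ih
  | pow_congr _ ih => exact congrArg (pmap p) ih
  | add_assoc a b c => exact add_assoc _ _ _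
  | add_comm a b => exact add_comm _ _
  | zero_add a => exact zero_add _
  | one_smul a => exact one_smul _ _
  | mul_smul s t a => exact mul_smul _ _ _
  | smul_add t a b => exact smul_add _ _ _
  | add_smul s t a => exact add_smul _ _ _
  | zero_smul a => exact zero_smul _ _
  | add_lie a b c => exact add_lie _ _ _
  | lie_add a b c => exact lie_add _ _ _
  | lie_self a => exact lie_self _
  | leibniz_lie a b c => exact leibniz_lie _ _ _
  | lie_smul t a b => exact lie_smul _ _ _
  | lie_pow a b =>
    have h : ∀ n : ℕ, eval g ((fun z => ⁅z, b⁆)^[n] a) = (fun z => ⁅z, eval g b⁆)^[n] (eval g a) := by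
      intro n
      induction n with
      | zero => rfl
      | succ n ih => rw [Function.iterate_succ_apply', Function.iterate_succ_apply', ← ih]; rfl
    rw [h, ← lie_pmap]
    rfl
  | smul_pow t a => exact smul_pmap _ _
  | pow_add a b =>
    have h : ∀ n : ℕ, eval g (sumUpTo (jacobson p a b) n)
        = sumUpTo (jacobson p (eval g a) (eval g b)) n := by
      intro n
      induction n with
      | zero => rfl
      | succ n ih =>
        refine congrArg₂ (· + ·) ih ?_
        exact congrArg (((n + 1 : ℕ) : ZMod p)⁻¹ • ·)
          (map_adCoeff (eval g) rfl (fun _ _ => rfl) (fun _ _ => rfl) a b _ _)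
    refine (pmap_add (eval g a) (eval g b)).trans ?_
    rw [← sumUpTo_eq, ← h]
    rfl

/-- The universal property of the free `p`-Lie algebra. -/
theorem existsUnique_lift (g : X → M) : ∃! f : FreeRestricted p X →ₗ⁅ZMod p⁆ M,
    IsRestrictedHom p f ∧ ∀ x, f (of p x) = g x := by
  refine ⟨{ toFun := Quot.lift (eval g) (fun _ _ h => eval_rel g h)
            map_add' := by rintro ⟨a⟩ ⟨b⟩; rfl
            map_smul' := by rintro t ⟨a⟩; rfl
            map_lie' := by rintro ⟨a⟩ ⟨b⟩; rfl },
    ⟨by rintro ⟨a⟩; rfl, fun _ => rfl⟩, ?_⟩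
  rintro f ⟨hf, hg⟩
  ext ⟨a⟩
  change f (mk a) = eval g a
  induction a with
  | of x => exact hg x
  | zero => exact map_zero f
  | add a b iha ihb => exact (map_add f (mk a) (mk b)).trans (congrArg₂ (· + ·) iha ihb)
  | smul t a ih => exact (map_smul f t (mk a)).trans (congrArg (t • ·) ih)
  | lie a b iha ihb => exact (LieHom.map_lie f (mk a) (mk b)).trans (congrArg₂ (⁅·, ·⁆) iha ihb)
  | pow a ih => exact (hf (mk a)).trans (congrArg (pmap p) ih)

end Lift

end FreeRestricted

end RestrictedLie

/-! ## The lower `p`-central series and its associated graded Lie algebra -/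

/-- A `p`-central series `G = Γ_1 ⊇ Γ_2 ⊇ ⋯` on a group `G`. For convenience of indexing it is
extended by `Γ_0 = G`; this puts no condition on the terms of positive index. -/
structure PCentralSeries (p : ℕ) (G : Type*) [Group G] where
  /-- The terms of the series. -/
  term : ℕ → Subgroup G
  term_zero : term 0 = ⊤
  term_one : term 1 = ⊤
  term_succ_le (k : ℕ) : term (k + 1) ≤ term k
  commutator_le (k l : ℕ) : ⁅term k, term l⁆ ≤ term (k + l)
  pow_mem (k : ℕ) (g : G) : g ∈ term k → g ^ p ∈ term (p * k)

namespace PCentralSeries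

section Basic

variable {p : ℕ} {G : Type*} [Group G]

/-- The lower `p`-central series: the fastest descending `p`-central series, whose `k`-th term is
the intersection of the `k`-th terms of all `p`-central series. -/
def lower (p : ℕ) (G : Type*) [Group G] : PCentralSeries p G where
  term k := ⨅ Γ : PCentralSeries p G, Γ.term k
  term_zero := by simp [term_zero]
  term_one := by simp [term_one]
  term_succ_le k := iInf_mono fun Γ => Γ.term_succ_le k
  commutator_le k l := le_iInf fun Γ =>
    (Subgroup.commutator_mono (iInf_le _ Γ) (iInf_le _ Γ)).trans (Γ.commutator_le k l)
  pow_mem k g hg := by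
    rw [Subgroup.mem_iInf] at hg ⊢
    exact fun Γ => Γ.pow_mem k g (hg Γ)

theorem lower_le (Γ : PCentralSeries p G) (k : ℕ) : (lower p G).term k ≤ Γ.term k :=
  iInf_le _ Γ

variable (Γ : PCentralSeries p G)

theorem term_anti : Antitone Γ.term := antitone_nat_of_succ_le Γ.term_succ_le

/-- The group commutator `(g, h) = g⁻¹ h⁻¹ g h`. -/
def comm (g h : G) : G := g⁻¹ * h⁻¹ * g * h

theorem comm_mem {k l : ℕ} {g h : G} (hg : g ∈ Γ.term k) (hh : h ∈ Γ.term l) :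
    comm g h ∈ Γ.term (k + l) := by
  have := Γ.commutator_le k l
    (Subgroup.commutator_mem_commutator (inv_mem hg) (inv_mem hh))
  simpa [comm, commutatorElement_def] using this

theorem comm_mem_succ {k : ℕ} {g : G} (hg : g ∈ Γ.term k) (h : G) :
    comm g h ∈ Γ.term (k + 1) :=
  Γ.comm_mem hg (by rw [Γ.term_one]; trivial)

instance term_normal (k : ℕ) : (Γ.term k).Normal where
  conj_mem g hg h := by
    have h1 := mul_mem hg (Γ.term_succ_le k (Γ.comm_mem_succ hg h⁻¹))
    simpa [comm, mul_assoc] using h1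

/-- The quotient `Γ_k / Γ_{k+1}`. -/
abbrev QuotientGroupAt (k : ℕ) : Type _ := Γ.term k ⧸ (Γ.term (k + 1)).subgroupOf (Γ.term k)

theorem mk_eq_mk_iff {k : ℕ} (g h : Γ.term k) :
    (QuotientGroup.mk g : Γ.QuotientGroupAt k) = QuotientGroup.mk h ↔
      (QuotientGroup.mk (g : G) : G ⧸ Γ.term (k + 1)) = QuotientGroup.mk (h : G) := by
  rw [QuotientGroup.eq, QuotientGroup.eq, Subgroup.mem_subgroupOf]
  rfl

theorem mk_commute {k : ℕ} {g : G} (hg : g ∈ Γ.term k) (h : G) :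
    Commute (QuotientGroup.mk g : G ⧸ Γ.term (k + 1)) (QuotientGroup.mk h) := by
  have h1 : (QuotientGroup.mk (comm g h) : G ⧸ Γ.term (k + 1)) = 1 :=
    (QuotientGroup.eq_one_iff _).2 (Γ.comm_mem_succ hg h)
  have h2 : h * g * comm g h = g * h := by simp [comm, mul_assoc]
  have h3 := congrArg (QuotientGroup.mk' (Γ.term (k + 1))) h2
  simp only [map_mul, QuotientGroup.mk'_apply, h1, mul_one] at h3
  exact h3.symm

instance (k : ℕ) : CommGroup (Γ.QuotientGroupAt k) where
  mul_comm := by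
    rintro ⟨g⟩ ⟨h⟩
    exact (Γ.mk_eq_mk_iff (g * h) (h * g)).2 (Γ.mk_commute g.2 h)

/-- The quotient `Γ_k / Γ_{k+1}`, written additively. It vanishes for `k = 0`. -/
abbrev Piece (k : ℕ) : Type _ := Additive (Γ.QuotientGroupAt k)

/-- The class of `g ∈ Γ_k` in `Γ_k / Γ_{k+1}`. -/
def cls (k : ℕ) (g : Γ.term k) : Γ.Piece k := Additive.ofMul (QuotientGroup.mk g)

theorem cls_surjective (k : ℕ) : Function.Surjective (Γ.cls k) := fun x =>
  QuotientGroup.mk_surjective (Additive.toMul x)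

theorem cls_mul {k : ℕ} (g h : Γ.term k) : Γ.cls k (g * h) = Γ.cls k g + Γ.cls k h := rfl

theorem cls_pow {k : ℕ} (g : Γ.term k) (n : ℕ) : Γ.cls k (g ^ n) = n • Γ.cls k g := rfl

theorem cls_eq_iff {k : ℕ} (g h : Γ.term k) : Γ.cls k g = Γ.cls k h ↔
    (QuotientGroup.mk (g : G) : G ⧸ Γ.term (k + 1)) = QuotientGroup.mk (h : G) :=
  Γ.mk_eq_mk_iff g h

theorem cls_eq_zero {k : ℕ} (g : Γ.term k) (hg : (g : G) ∈ Γ.term (k + 1)) : Γ.cls k g = 0 :=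
  (Γ.cls_eq_iff g 1).2 ((QuotientGroup.eq_one_iff _).2 hg)

theorem piece_zero (x : Γ.Piece 0) : x = 0 := by
  obtain ⟨g, rfl⟩ := Γ.cls_surjective 0 x
  exact Γ.cls_eq_zero g (by rw [Γ.term_one]; trivial)

/-- The commutator of an element of `Γ_k` and an element of `Γ_l`, as an element of `Γ_{k+l}`. -/
def commAt {k l : ℕ} (g : Γ.term k) (h : Γ.term l) : Γ.term (k + l) :=
  ⟨comm (g : G) (h : G), Γ.comm_mem g.2 h.2⟩

theorem cls_comm_mul_left {k l : ℕ} (g g' : Γ.term k) (h : Γ.term l) :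
    Γ.cls (k + l) (Γ.commAt (g * g') h)
      = Γ.cls (k + l) (Γ.commAt g h) + Γ.cls (k + l) (Γ.commAt g' h) := by
  rw [← cls_mul, cls_eq_iff]
  have h1 : comm ((g : G) * g') h = (g' : G)⁻¹ * comm (g : G) h * g' * comm (g' : G) h := by
    simp [comm, mul_assoc]
  have h2 := Γ.mk_commute (Γ.comm_mem g.2 h.2) g'
  change QuotientGroup.mk' (Γ.term (k + l + 1)) (comm ((g : G) * g') h) =
    QuotientGroup.mk' (Γ.term (k + l + 1)) (comm (g : G) h * comm (g' : G) h)
  rw [h1]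
  simp only [map_mul, map_inv, QuotientGroup.mk'_apply]
  rw [mul_assoc (_)⁻¹, h2.eq, inv_mul_cancel_left]

theorem commAt_swap {k l : ℕ} (g : Γ.term k) (h : Γ.term l) :
    (Γ.commAt g h : G) = (Γ.commAt h g : G)⁻¹ := by
  simp [commAt, comm, mul_assoc]

theorem cls_comm_mul_right {k l : ℕ} (g : Γ.term k) (h h' : Γ.term l) :
    Γ.cls (k + l) (Γ.commAt g (h * h'))
      = Γ.cls (k + l) (Γ.commAt g h) + Γ.cls (k + l) (Γ.commAt g h') := by
  rw [← cls_mul, cls_eq_iff]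
  have h1 : comm (g : G) ((h : G) * h') = comm (g : G) h' * ((h' : G)⁻¹ * comm (g : G) h * h') := by
    simp [comm, mul_assoc]
  have h2 := Γ.mk_commute (Γ.comm_mem g.2 h.2) h'
  have h3 := Γ.mk_commute (Γ.comm_mem g.2 h.2) (comm (g : G) h')
  change QuotientGroup.mk' (Γ.term (k + l + 1)) (comm (g : G) ((h : G) * h')) =
    QuotientGroup.mk' (Γ.term (k + l + 1)) (comm (g : G) h * comm (g : G) h')
  rw [h1]
  simp only [map_mul, map_inv, QuotientGroup.mk'_apply]
  rw [mul_assoc (_)⁻¹, h2.eq, inv_mul_cancel_left, h3.eq]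

theorem cls_comm_congr {k l : ℕ} {g g' : Γ.term k} {h h' : Γ.term l}
    (hg : Γ.cls k g = Γ.cls k g') (hh : Γ.cls l h = Γ.cls l h') :
    Γ.cls (k + l) (Γ.commAt g h) = Γ.cls (k + l) (Γ.commAt g' h') := by
  rw [cls_eq_iff, QuotientGroup.eq] at hg hh
  obtain ⟨n, hn, rfl⟩ : ∃ n : Γ.term k, (n : G) ∈ Γ.term (k + 1) ∧ g' = g * n :=
    ⟨g⁻¹ * g', hg, by simp⟩
  obtain ⟨m, hm, rfl⟩ : ∃ m : Γ.term l, (m : G) ∈ Γ.term (l + 1) ∧ h' = h * m :=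
    ⟨h⁻¹ * h', hh, by simp⟩
  have h1 : Γ.cls (k + l) (Γ.commAt n (h * m)) = 0 := Γ.cls_eq_zero _ (by
    have := Γ.comm_mem hn (h * m).2
    rwa [show k + 1 + l = k + l + 1 by omega] at this)
  have h2 : Γ.cls (k + l) (Γ.commAt g m) = 0 := Γ.cls_eq_zero _ (Γ.comm_mem (k := k) (l := l + 1) g.2 hm)
  rw [cls_comm_mul_left, cls_comm_mul_right, h1, h2, add_zero, add_zero]

/-- The bracket `Γ_k / Γ_{k+1} × Γ_l / Γ_{l+1} → Γ_{k+l} / Γ_{k+l+1}` induced by the group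
commutator. -/
def pieceBracket (k l : ℕ) : Γ.Piece k →+ Γ.Piece l →+ Γ.Piece (k + l) :=
  AddMonoidHom.mk' (fun x => AddMonoidHom.mk'
    (fun y => Quotient.liftOn₂ x y (fun g h => Γ.cls (k + l) (Γ.commAt g h))
      fun _ _ _ _ hg hh => Γ.cls_comm_congr (Quotient.sound hg) (Quotient.sound hh))
    (by
      obtain ⟨g, rfl⟩ := Γ.cls_surjective k x
      intro y y'
      obtain ⟨h, rfl⟩ := Γ.cls_surjective l y
      obtain ⟨h', rfl⟩ := Γ.cls_surjective l y'
      exact Γ.cls_comm_mul_right g h h'))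
    (by
      intro x x'
      refine AddMonoidHom.ext fun y => ?_
      obtain ⟨g, rfl⟩ := Γ.cls_surjective k x
      obtain ⟨g', rfl⟩ := Γ.cls_surjective k x'
      obtain ⟨h, rfl⟩ := Γ.cls_surjective l y
      exact Γ.cls_comm_mul_left g g' h)

theorem pieceBracket_cls {k l : ℕ} (g : Γ.term k) (h : Γ.term l) :
    Γ.pieceBracket k l (Γ.cls k g) (Γ.cls l h) = Γ.cls (k + l) (Γ.commAt g h) := rfl

/-- The congruence of commutators behind the Jacobi identity. -/
theorem jacobi_aux {k l m : ℕ} (hk : 0 < k) (hl : 0 < l) (hm : 0 < m) {x y z : G}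
    (hx : x ∈ Γ.term k) (hy : y ∈ Γ.term l) (hz : z ∈ Γ.term m) :
    (QuotientGroup.mk (comm (comm y z) x) : G ⧸ Γ.term (l + m + k + 1)) =
      QuotientGroup.mk (comm y (comm z x) * comm (comm y x) z) := by
  have hyz := Γ.comm_mem hy hz
  have hyx := Γ.comm_mem hy hx
  have hzx := Γ.comm_mem hz hx
  set π := QuotientGroup.mk' (Γ.term (l + m + k + 1)) with hπ
  have triv : ∀ (n : ℕ) (g : G), g ∈ Γ.term n → l + m + k + 1 ≤ n → π g = 1 := fun n g hg hn =>
    (QuotientGroup.eq_one_iff _).2 (Γ.term_anti hn hg)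
  have com : ∀ g h : G, π (comm g h) = 1 → Commute (π g) (π h) := by
    intro g h h1
    have h2 : h * g * comm g h = g * h := by simp [comm, mul_assoc]
    have h3 := congrArg π h2
    rw [map_mul, h1, mul_one, map_mul, map_mul] at h3
    exact h3.symm
  have mc : ∀ g h : G, π (comm g h) = comm (π g) (π h) := fun g h => by simp [comm]
  have conj : ∀ (a b : G ⧸ Γ.term (l + m + k + 1)), Commute a b → b⁻¹ * a * b = a :=
    fun a b h => by rw [mul_assoc, h.eq, inv_mul_cancel_left]
  -- the pairs of commutators that commute modulo `Γ_{k+l+m+1}`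
  have c1 : Commute (π (comm y z)) (π (comm y x)) :=
    com _ _ (triv _ _ (Γ.comm_mem hyz hyx) (by omega))
  have c2 : Commute (π (comm y z)) (π (comm z x)) :=
    com _ _ (triv _ _ (Γ.comm_mem hyz hzx) (by omega))
  have c3 : Commute (π (comm y (comm z x))) (π (comm y x)) :=
    com _ _ (triv _ _ (Γ.comm_mem (Γ.comm_mem hy hzx) hyx) (by omega))
  have c4 : Commute (π (comm (comm y x) z)) (π (comm z x)) :=
    com _ _ (triv _ _ (Γ.comm_mem (Γ.comm_mem hyx hz) hzx) (by omega))
  have c6 : Commute (π (comm y (comm z x))) (π (comm y z)) :=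
    com _ _ (triv _ _ (Γ.comm_mem (Γ.comm_mem hy hzx) hyz) (by omega))
  have id1 : comm y z * comm (comm y z) x = comm (y * comm y x) (z * comm z x) := by
    simp [comm, mul_assoc]
  have id2 : ∀ a b c : G ⧸ Γ.term (l + m + k + 1),
      comm (a * b) c = b⁻¹ * comm a c * b * comm b c := fun a b c => by simp [comm, mul_assoc]
  have id3 : ∀ a b c : G ⧸ Γ.term (l + m + k + 1),
      comm a (b * c) = comm a c * (c⁻¹ * comm a b * c) := fun a b c => by simp [comm, mul_assoc]
  have h1 := congrArg π id1
  rw [map_mul, mc (y * comm y x), map_mul, map_mul, id2, id3, id3 (π (comm y x))] at h1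
  rw [← mc, ← mc y, ← mc (comm y x), conj _ _ c2] at h1
  have h5 : π (comm (comm y x) (comm z x)) = 1 :=
    triv _ _ (Γ.comm_mem hyx hzx) (by omega)
  rw [h5, one_mul, ← mc (comm y x), conj _ _ c4, conj _ _ (c3.mul_left c1), c6.eq, mul_assoc] at h1
  have h6 := mul_left_cancel h1
  change π _ = π _
  rw [map_mul, h6]

/-- The biadditive extension of the brackets `pieceBracket` to the direct sum. -/
def sumBracket : (⨁ k, Γ.Piece k) →+ (⨁ k, Γ.Piece k) →+ ⨁ k, Γ.Piece k :=
  DirectSum.toAddMonoid fun k => AddMonoidHom.flip (DirectSum.toAddMonoid fun l =>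
    AddMonoidHom.flip ((AddMonoidHom.compHom (DirectSum.of Γ.Piece (k + l))).comp
      (Γ.pieceBracket k l)))

theorem sumBracket_of {k l : ℕ} (x : Γ.Piece k) (y : Γ.Piece l) :
    Γ.sumBracket (DirectSum.of Γ.Piece k x) (DirectSum.of Γ.Piece l y) =
      DirectSum.of Γ.Piece (k + l) (Γ.pieceBracket k l x y) := by
  rw [sumBracket, DirectSum.toAddMonoid_of, AddMonoidHom.flip_apply, DirectSum.toAddMonoid_of]
  rfl

/-- The associated graded abelian group `⨁_k Γ_k / Γ_{k+1}`. -/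
def Gr : Type _ := ⨁ k, Γ.Piece k

instance : AddCommGroup Γ.Gr := inferInstanceAs (AddCommGroup (⨁ k, Γ.Piece k))

namespace Gr

/-- The homogeneous element of degree `k` of the associated graded group given by `g ∈ Γ_k`. -/
def of (k : ℕ) (g : Γ.term k) : Γ.Gr := DirectSum.of Γ.Piece k (Γ.cls k g)

variable {Γ} in
theorem induction {C : Γ.Gr → Prop} (zero : C 0) (of : ∀ k (g : Γ.term k), C (of Γ k g))
    (add : ∀ x y, C x → C y → C (x + y)) (x : Γ.Gr) : C x :=
  DirectSum.induction_on x zero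
    (fun k y => by obtain ⟨g, rfl⟩ := Γ.cls_surjective k y; exact of k g) add

theorem of_mul {k : ℕ} (g h : Γ.term k) : of Γ k (g * h) = of Γ k g + of Γ k h :=
  (DirectSum.of Γ.Piece k).map_add (Γ.cls k g) (Γ.cls k h)

theorem of_inv {k : ℕ} (g : Γ.term k) : of Γ k g⁻¹ = - of Γ k g :=
  (DirectSum.of Γ.Piece k).map_neg (Γ.cls k g)

theorem of_eq_zero {k : ℕ} (g : Γ.term k) (hg : (g : G) ∈ Γ.term (k + 1)) : of Γ k g = 0 := by
  rw [of, Γ.cls_eq_zero g hg, map_zero]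
  rfl

theorem of_congr {k l : ℕ} (h : k = l) (g : Γ.term k) (g' : Γ.term l)
    (hg : (QuotientGroup.mk (g : G) : G ⧸ Γ.term (k + 1)) = QuotientGroup.mk (g' : G)) :
    of Γ k g = of Γ l g' := by
  subst h
  rw [of, of, (Γ.cls_eq_iff g g').2 hg]

/-- The bracket on the associated graded group, extended biadditively from homogeneous elements. -/
def bracketHom : Γ.Gr →+ Γ.Gr →+ Γ.Gr := Γ.sumBracket

theorem bracketHom_of {k l : ℕ} (g : Γ.term k) (h : Γ.term l) :
    bracketHom Γ (of Γ k g) (of Γ l h) = of Γ (k + l) (Γ.commAt g h) :=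
  Γ.sumBracket_of (Γ.cls k g) (Γ.cls l h)

theorem bracketHom_swap (x y : Γ.Gr) : bracketHom Γ x y = - bracketHom Γ y x := by
  induction x using Gr.induction with
  | zero => simp
  | add x x' hx hx' => simp [hx, hx', add_comm]
  | of k g =>
    induction y using Gr.induction with
    | zero => simp
    | add y y' hy hy' => simp [hy, hy', add_comm]
    | of l h =>
      rw [bracketHom_of, bracketHom_of, ← of_inv]
      refine of_congr Γ (add_comm k l) _ _ ?_
      exact congrArg _ (Γ.commAt_swap g h)

theorem bracketHom_self (x : Γ.Gr) : bracketHom Γ x x = 0 := by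
  induction x using Gr.induction with
  | zero => simp
  | add x y hx hy =>
    simp only [map_add, AddMonoidHom.add_apply, hx, hy, bracketHom_swap Γ x y]
    simp
  | of k g =>
    rw [bracketHom_of]
    exact of_eq_zero Γ _ (by simp [commAt, comm, mul_assoc, one_mem])

/-- The Jacobi identity for homogeneous elements. -/
theorem bracketHom_jacobi_of {k l m : ℕ} (x : Γ.term k) (y : Γ.term l) (z : Γ.term m) :
    bracketHom Γ (bracketHom Γ (of Γ l y) (of Γ m z)) (of Γ k x) =
      bracketHom Γ (of Γ l y) (bracketHom Γ (of Γ m z) (of Γ k x)) +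
      bracketHom Γ (bracketHom Γ (of Γ l y) (of Γ k x)) (of Γ m z) := by
  rcases Nat.eq_zero_or_pos k with rfl | hk
  · have h0 : of Γ 0 x = 0 := of_eq_zero Γ x (by rw [Γ.term_one]; trivial)
    simp [h0]
  rcases Nat.eq_zero_or_pos l with rfl | hl
  · have h0 : of Γ 0 y = 0 := of_eq_zero Γ y (by rw [Γ.term_one]; trivial)
    simp [h0]
  rcases Nat.eq_zero_or_pos m with rfl | hm
  · have h0 : of Γ 0 z = 0 := of_eq_zero Γ z (by rw [Γ.term_one]; trivial)
    simp [h0]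
  simp only [bracketHom_of]
  have m1 : (Γ.commAt y (Γ.commAt z x) : G) ∈ Γ.term (l + m + k) :=
    Γ.term_anti (by omega) (Γ.commAt y (Γ.commAt z x)).2
  have m2 : (Γ.commAt (Γ.commAt y x) z : G) ∈ Γ.term (l + m + k) :=
    Γ.term_anti (by omega) (Γ.commAt (Γ.commAt y x) z).2
  have e1 : of Γ (l + (m + k)) (Γ.commAt y (Γ.commAt z x)) = of Γ (l + m + k) ⟨_, m1⟩ :=
    of_congr Γ (add_assoc l m k).symm _ _ rfl
  have e2 : of Γ (l + k + m) (Γ.commAt (Γ.commAt y x) z) = of Γ (l + m + k) ⟨_, m2⟩ :=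
    of_congr Γ (add_right_comm l k m) _ _ rfl
  rw [e1, e2, ← of_mul]
  refine of_congr Γ rfl _ _ ?_
  exact Γ.jacobi_aux hk hl hm x.2 y.2 z.2

theorem bracketHom_leibniz (x y z : Γ.Gr) : bracketHom Γ x (bracketHom Γ y z) =
    bracketHom Γ (bracketHom Γ x y) z + bracketHom Γ y (bracketHom Γ x z) := by
  have key : bracketHom Γ (bracketHom Γ y z) x =
      bracketHom Γ y (bracketHom Γ z x) + bracketHom Γ (bracketHom Γ y x) z := by
    induction x using Gr.induction with
    | zero => simp
    | add x x' hx hx' => simp only [map_add, AddMonoidHom.add_apply, hx, hx']; abel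
    | of k g =>
      induction y using Gr.induction with
      | zero => simp
      | add y y' hy hy' => simp only [map_add, AddMonoidHom.add_apply, hy, hy']; abel
      | of l h =>
        induction z using Gr.induction with
        | zero => simp
        | add z z' hz hz' => simp only [map_add, AddMonoidHom.add_apply, hz, hz']; abel
        | of m i => exact bracketHom_jacobi_of Γ g h i
  rw [bracketHom_swap Γ x, key, bracketHom_swap Γ y x, bracketHom_swap Γ z x]
  simp

instance : LieRing Γ.Gr where
  bracket x y := bracketHom Γ x y
  add_lie x y z := by simp only [map_add, AddMonoidHom.add_apply]
  lie_add x y z := map_add _ _ _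
  lie_self := bracketHom_self Γ
  leibniz_lie := bracketHom_leibniz Γ

/-- On homogeneous elements the bracket is given by the group commutator. -/
theorem lie_of {k l : ℕ} (g : Γ.term k) (h : Γ.term l) :
    ⁅of Γ k g, of Γ l h⁆ = of Γ (k + l) (Γ.commAt g h) :=
  bracketHom_of Γ g h

variable [Fact p.Prime]

theorem nsmul_eq_zero (x : Γ.Gr) : p • x = 0 := by
  induction x using Gr.induction with
  | zero => simp
  | add x y hx hy => rw [smul_add, hx, hy, add_zero]
  | of k g =>
    have h1 : p • of Γ k g = of Γ k (g ^ p) := by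
      rw [of, of, cls_pow, map_nsmul]
      rfl
    have hp := (Fact.out : p.Prime).two_le
    rw [h1]
    apply of_eq_zero
    rcases Nat.eq_zero_or_pos k with rfl | hk
    · rw [Γ.term_one]; trivial
    · exact Γ.term_anti (by nlinarith) (Γ.pow_mem k g g.2)

instance : Module (ZMod p) Γ.Gr := AddCommGroup.zmodModule (nsmul_eq_zero Γ)

instance : LieAlgebra (ZMod p) Γ.Gr where
  lie_smul t x y := ZMod.map_smul (bracketHom Γ x) t y

/-- The condition on a `p`-Lie algebra structure on the associated graded Lie algebra that the
`p`-power operation is induced by `p`-th powers in the group: `(class of g)^[p] = class of g ^ p`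
for `g ∈ Γ_k`, with the second class taken in degree `p k`. By `IsInduced.unique` there is at most
one such structure. -/
def IsInduced (P : RestrictedLieAlgebra p Γ.Gr) : Prop :=
  ∀ (k : ℕ) (g : Γ.term k), P.pmap (of Γ k g) = of Γ (p * k) ⟨(g : G) ^ p, Γ.pow_mem k g g.2⟩

theorem IsInduced.unique {P P' : RestrictedLieAlgebra p Γ.Gr} (hP : IsInduced Γ P)
    (hP' : IsInduced Γ P') : P = P' := by
  have h : ∀ x, P.pmap x = P'.pmap x := by
    intro x
    induction x using Gr.induction with
    | zero =>
      have h1 := hP 0 1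
      have h2 := hP' 0 1
      have h0 : of Γ 0 1 = 0 := of_eq_zero Γ 1 (one_mem _)
      rw [h0] at h1 h2
      rw [h1, h2]
    | of k g => rw [hP, hP']
    | add x y hx hy => rw [P.pmap_add, P'.pmap_add, hx, hy]
  cases P
  cases P'
  congr
  exact funext h

end Gr

end Basic

end PCentralSeries

/-! ## Graph products -/

section GraphProduct

variable {ι : Type*} [DecidableEq ι]

/-- The graph product `Z_p^K`: the group with generators `a_i`, one for each vertex, and relations
`a_i ^ p = 1` for all `i` and `a_i a_j = a_j a_i` for `{i, j} ∈ K`. -/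
abbrev CyclicGraphProduct (p : ℕ) (K : AbstractSimplicialComplex ι) : Type _ :=
  PresentedGroup
    ({r | ∃ i : ι, r = FreeGroup.of i ^ p} ∪
      {r | ∃ i j : ι, ({i, j} : Finset ι) ∈ K ∧
        r = FreeGroup.of i * FreeGroup.of j * (FreeGroup.of j * FreeGroup.of i)⁻¹} :
      Set (FreeGroup ι))

namespace RestrictedLie

open RestrictedLieAlgebra

variable (p : ℕ)

/-- The `p`-Lie algebra `FL_p(u_i : i ∈ ι) / (u_i^[p] = 0, [u_i, u_j] = 0 for {i, j} ∈ K)` over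
`ZMod p`. -/
abbrev GraphAlgebra (K : AbstractSimplicialComplex ι) : Type _ :=
  QuotientBy p
    ({r | ∃ i : ι, r = pmap p (FreeRestricted.of p i)} ∪
      {r | ∃ i j : ι, ({i, j} : Finset ι) ∈ K ∧
        r = ⁅FreeRestricted.of p i, FreeRestricted.of p j⁆} :
      Set (FreeRestricted p ι))

/-- The generator `u_i` of the algebra `GraphAlgebra p K`. -/
def GraphAlgebra.gen (K : AbstractSimplicialComplex ι) (i : ι) : GraphAlgebra p K :=
  quotientMk p _ (FreeRestricted.of p i)

/-- The trivial `p`-Lie algebra with one generator, `FL_p(u) / (u^[p] = 0)`. -/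
abbrev OneGenerator : Type :=
  QuotientBy p ({pmap p (FreeRestricted.of p ())} : Set (FreeRestricted p Unit))

/-- The generator `u` of the trivial `p`-Lie algebra with one generator. -/
def OneGenerator.gen : OneGenerator p := quotientMk p _ (FreeRestricted.of p ())

/-- The simplices of `K`, including the empty one. -/
def Simplex (K : AbstractSimplicialComplex ι) : Type _ := {I : Finset ι // I = ∅ ∨ I ∈ K}

/-- The vertex `i` as a simplex of `K`. -/
def Simplex.vertex (K : AbstractSimplicialComplex ι) (i : ι) : Simplex K :=
  ⟨{i}, Or.inr (K.singleton_mem i)⟩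

/-- For `I ⊆ J`, the canonical map from the product over `I` to the product over `J`, which
extends a family by zero. -/
def extendByZero {A : ι → Type*} [∀ i, Zero (A i)] {I : Finset ι} (J : Finset ι)
    (x : ∀ i : I, A i) : ∀ j : J, A j :=
  fun j => if h : (j : ι) ∈ I then x ⟨j, h⟩ else 0


variable (K : AbstractSimplicialComplex ι) (A : ι → Type*) [∀ i, LieRing (A i)]
  [∀ i, LieAlgebra (ZMod p) (A i)] [∀ i, RestrictedLieAlgebra p (A i)]

/-- A cocone under the diagram `I ↦ A^I = ∏_{i ∈ I} A_i` of `p`-Lie algebras indexed by the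
simplices of `K` and their inclusions. -/
structure IsCocone {L : Type*} [LieRing L] [LieAlgebra (ZMod p) L] [RestrictedLieAlgebra p L]
    (φ : ∀ I : Simplex K, (∀ i : I.1, A i) →ₗ⁅ZMod p⁆ L) : Prop where
  isRestrictedHom (I : Simplex K) : IsRestrictedHom p (φ I)
  compatible (I J : Simplex K) (_ : I.1 ⊆ J.1) (x : ∀ i : I.1, A i) :
    φ J (extendByZero J.1 x) = φ I x

/-- The cocone `φ` exhibits `L` as the graph product `A^K`, that is, as the colimit of the diagram
`I ↦ A^I` over the simplices of `K` in the category of `p`-Lie algebras. The universe of the test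
objects is the parameter `w`. -/
structure IsGraphProduct {L : Type*} [LieRing L] [LieAlgebra (ZMod p) L]
    [RestrictedLieAlgebra p L] (φ : ∀ I : Simplex K, (∀ i : I.1, A i) →ₗ⁅ZMod p⁆ L) : Prop where
  isCocone : IsCocone p K A φ
  existsUnique_desc (M : Type w) [LieRing M] [LieAlgebra (ZMod p) M] [RestrictedLieAlgebra p M]
    (ψ : ∀ I : Simplex K, (∀ i : I.1, A i) →ₗ⁅ZMod p⁆ M) (_ : IsCocone p K A ψ) :
    ∃! f : L →ₗ⁅ZMod p⁆ M, IsRestrictedHom p f ∧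
      ∀ (I : Simplex K) (x : ∀ i : I.1, A i), f (φ I x) = ψ I x

end RestrictedLie

end GraphProduct

/-!
The isomorphism of the theorem is compared with the restricted enveloping algebra. Write `L` for
the algebra generated by `u_i` with `u_i^[p] = 0` and `[u_i, u_j] = 0` along the edges of `K`, `G`
for the graph product of groups, and `γ` for its lower `p`-central series.

*The `p`-power operation on `gr γ`.* For every `p`-central series `Γ` of a finitely generated
group, the products `(g₁ - 1) ⋯ (g_r - 1)` weighted by `Γ` define a filtration `E` of the group
ring, and `g ↦ g - 1` induces a homomorphism from `gr Γ` to `gr E` that takes classes of `p`-th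
powers to `p`-th powers. It is injective (Lazard, Jennings): if `g - 1 ∈ E_n` then `g ∈ Γ_n`,
`PCentralSeries.mem_of_sub_one_mem`. As the terms of `Γ` have finite index, this reduces to finite
`p`-groups, where a subgroup of index `p` is split off: its group ring and the powers of one further
element `x - 1` describe the filtration (`IsPSeries.mem_of_sub_one_mem_of_ker`). So `gr Γ` is a Lie
subalgebra of an associative algebra closed under `p`-th powers of homogeneous elements, hence, by
Jacobson's formula, closed under all `p`-th powers: `PCentralSeries.Gr.exists_isInduced`.

*Surjectivity of `Φ : L → gr γ`, `u_i ↦ a_i`.* The elements of `γ_k` whose class lies in the image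
of `Φ` form a `p`-central series, so they exhaust `γ_k` by the minimality of `γ`:
`gr_lower_induction`.

*Injectivity of `Φ`.* For elements `v_i` of an associative algebra `B` with `v_i ^ p = 0` that
commute along the edges of `K`, the Magnus map `a_i ↦ 1 + v_i t` defines a homomorphism from `G` to
the units of `B[t]`. Taking leading coefficients gives a homomorphism `gr γ → B` with `a_i ↦ v_i`:
`exists_graphProductHom`. When `B` is the restricted enveloping algebra of `L` and `v_i = u_i`, its
composite with `Φ` is the canonical map from `L` to its restricted enveloping algebra. This map is
injective by a Poincaré–Birkhoff–Witt theorem, `GraphAlgebra.ι_injective`. The relations of `L` are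
homogeneous, so that `L` embeds in the `p`-Lie algebra `L[t]` by `u_i ↦ u_i t`. This gives a
separated filtration of `L` by ideals of finite index. The quotients are finite nilpotent algebras,
for which one adjoins one generator at a time, `ι_injective_of_ker`. The construction of a
`p`-power operation on `L[t]` uses that the sum of the Jacobson polynomials is a symmetric cocycle,
`cocycleDefect_eq_zero`.

*The graph product.* A cocone on the diagram of products of one-generator algebras amounts to the
images of the generators, subject to the defining relations of `L`: `exists_isGraphProduct`.
-/

namespace RestrictedLie

open RestrictedLieAlgebra

attribute [local instance 100] LieRing.ofAssociativeRing

/-! ### Associative algebras as `p`-Lie algebras -/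

section Associative

variable {p : ℕ} [hp : Fact p.Prime]

theorem choose_prime_sub_one (i : ℕ) (hi : i < p) :
    (((p - 1).choose i : ℕ) : ZMod p) = (-1) ^ i := by
  induction i with
  | zero => simp
  | succ i ih =>
    have h1 : p.choose (i + 1) = (p - 1).choose i + (p - 1).choose (i + 1) := by
      conv_lhs => rw [← Nat.sub_add_cancel hp.out.one_le]
      exact Nat.choose_succ_succ _ _
    have h2 : ((p.choose (i + 1) : ℕ) : ZMod p) = 0 :=
      (ZMod.natCast_eq_zero_iff _ _).2 (hp.out.dvd_choose_self (by omega) hi)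
    rw [h1, Nat.cast_add, ih (by omega)] at h2
    rw [pow_succ]
    linear_combination h2

variable {A : Type*} [Ring A] [Algebra (ZMod p) A]

variable (p A) in
theorem natCast_prime_eq_zero : (p : A) = 0 := by
  have h := map_natCast (algebraMap (ZMod p) A) p
  rw [← h]
  simp

theorem add_pow_prime_of_commute {a b : A} (h : Commute a b) : (a + b) ^ p = a ^ p + b ^ p := by
  obtain ⟨r, hr⟩ := h.exists_add_pow_prime_eq hp.out
  rw [hr, natCast_prime_eq_zero p A]
  simp

theorem sub_pow_prime_of_commute {a b : A} (h : Commute a b) : (a - b) ^ p = a ^ p - b ^ p := by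
  have := add_pow_prime_of_commute (p := p) (a := a - b) (b := b) (h.sub_left (Commute.refl b))
  rw [sub_add_cancel] at this
  rw [this, add_sub_cancel_right]

theorem iterate_lie_right (a b : A) (n : ℕ) :
    (fun z => ⁅z, a⁆)^[n] b =
      ((LinearMap.mulRight (ZMod p) a - LinearMap.mulLeft (ZMod p) a) ^ n) b := by
  rw [Module.End.pow_apply]
  rfl

/-- In characteristic `p`, the `(p-1)`-fold bracket with `a` is the derivative of the `p`-th power
at `a`. -/
theorem sum_pow_mul_pow (a b : A) : ∑ i ∈ Finset.range p, a ^ i * b * a ^ (p - 1 - i) =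
    (fun z => ⁅z, a⁆)^[p - 1] b := by
  have hc : Commute (-LinearMap.mulLeft (ZMod p) a) (LinearMap.mulRight (ZMod p) a) :=
    (LinearMap.commute_mulLeft_right a a).neg_left
  rw [iterate_lie_right (p := p), sub_eq_add_neg, add_comm, hc.add_pow, LinearMap.sum_apply,
    Nat.sub_add_cancel hp.out.one_le]
  refine Finset.sum_congr rfl fun i hi => ?_
  have h1 : (((p - 1).choose i : ℕ) : Module.End (ZMod p) A) =
      algebraMap (ZMod p) _ ((-1) ^ i) := by
    rw [← choose_prime_sub_one i (Finset.mem_range.1 hi), map_natCast]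
  rw [h1, neg_pow, LinearMap.pow_mulLeft, LinearMap.pow_mulRight, map_pow, map_neg, map_one]
  have h2 : ((-1 : Module.End (ZMod p) A) ^ i) * (-1) ^ i = 1 := by
    rw [← (Commute.refl _).mul_pow]; simp
  have h3 := ((Commute.neg_one_left (LinearMap.mulLeft (ZMod p) (a ^ i) *
    LinearMap.mulRight (ZMod p) (a ^ (p - 1 - i)))).pow_left i).eq
  rw [mul_assoc ((-1) ^ i), h3, mul_assoc _ _ ((-1) ^ i), h2, mul_one]
  simp [mul_assoc]

theorem coeff_iterate_lie (x y : A) (n j : ℕ) :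
    ((fun z : Polynomial A => ⁅z, Polynomial.C x * Polynomial.X + Polynomial.C y⁆)^[n]
      (Polynomial.C x)).coeff j = adCoeff x y n j := by
  induction n generalizing j with
  | zero => cases j <;> simp [adCoeff, Polynomial.coeff_C]
  | succ n ih =>
    rw [Function.iterate_succ_apply', Ring.lie_def, Polynomial.coeff_sub]
    generalize (fun z : Polynomial A => ⁅z, Polynomial.C x * Polynomial.X + Polynomial.C y⁆)^[n]
      (Polynomial.C x) = g at ih
    cases j with
    | zero => simp [adCoeff, mul_add, add_mul, ih, Ring.lie_def, ← mul_assoc]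
    | succ j =>
      simp only [adCoeff, mul_add, add_mul, Polynomial.coeff_add, ← mul_assoc,
        Polynomial.coeff_mul_X, Polynomial.coeff_mul_C, ih, Ring.lie_def, Polynomial.coeff_C_mul]
      rw [mul_assoc, Polynomial.X_mul, ← mul_assoc, Polynomial.coeff_mul_X, Polynomial.coeff_C_mul,
        ih]
      abel

theorem derivative_pow_eq_sum (f : Polynomial A) (n : ℕ) : Polynomial.derivative (f ^ n) =
    ∑ i ∈ Finset.range n, f ^ i * Polynomial.derivative f * f ^ (n - 1 - i) := by
  induction n with
  | zero => simp
  | succ n ih =>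
    rw [pow_succ', Polynomial.derivative_mul, ih, Finset.sum_range_succ', add_comm, Finset.mul_sum]
    congr 1
    · refine Finset.sum_congr rfl fun i hi => ?_
      rw [pow_succ', show n + 1 - 1 - (i + 1) = n - 1 - i by omega]
      simp only [mul_assoc]
    · simp

/-- Jacobson's formula for the `p`-th power of a sum in an associative algebra. -/
theorem add_pow_prime_jacobson (x y : A) : (x + y) ^ p =
    x ^ p + y ^ p + ∑ i ∈ Finset.Icc 1 (p - 1), jacobson p x y i := by
  set f : Polynomial A := Polynomial.C x * Polynomial.X + Polynomial.C y with hf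
  have hdeg : f.natDegree ≤ 1 := by
    rw [hf]; exact Polynomial.natDegree_linear_le
  have hder : Polynomial.derivative f = Polynomial.C x := by
    rw [hf]; simp
  have hp1 := hp.out.one_le
  have hco : ∀ j, 1 ≤ j → j < p → (f ^ p).coeff j = jacobson p x y j := by
    intro j hj hjp
    have h1 := congrArg (fun g => Polynomial.coeff g (j - 1)) (derivative_pow_eq_sum f p)
    simp only [hder] at h1
    rw [sum_pow_mul_pow, hf, coeff_iterate_lie, Polynomial.coeff_derivative, ← hf] at h1
    rw [jacobson, ← h1, Nat.sub_add_cancel hj]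
    have h2 : ((j - 1 : ℕ) : A) + 1 = algebraMap (ZMod p) A j := by
      rw [map_natCast]
      exact_mod_cast congrArg (Nat.cast : ℕ → A) (Nat.sub_add_cancel hj)
    have h3 : (j : ZMod p) ≠ 0 := by
      rw [Ne, ZMod.natCast_eq_zero_iff]
      exact Nat.not_dvd_of_pos_of_lt hj hjp
    rw [h2, ← Algebra.commutes, ← Algebra.smul_def, smul_smul, inv_mul_cancel₀ h3, one_smul]
  have hev := map_pow (Polynomial.eval₂RingHom' (RingHom.id A) 1 fun a => Commute.one_right _) f p
  have h0 : (f ^ p).coeff 0 = y ^ p := by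
    change Polynomial.constantCoeff (f ^ p) = _
    rw [map_pow, hf]
    simp
  have hpp : (f ^ p).coeff p = x ^ p := by
    have := Polynomial.coeff_pow_of_natDegree_le hdeg (m := p)
    rw [mul_one] at this
    rw [this, hf]
    simp
  have hdegp : (f ^ p).natDegree < p + 1 :=
    Nat.lt_succ_of_le ((Polynomial.natDegree_pow_le_of_le p hdeg).trans (by simp))
  have e1 : Polynomial.eval₂RingHom' (RingHom.id A) 1 (fun a => Commute.one_right _) f = x + y := by
    simp [Polynomial.eval₂RingHom', hf]
  have e2 : Polynomial.eval₂RingHom' (RingHom.id A) 1 (fun a => Commute.one_right _) (f ^ p) =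
      ∑ j ∈ Finset.range (p + 1), (f ^ p).coeff j := by
    change Polynomial.eval₂ _ _ _ = _
    rw [Polynomial.eval₂_eq_sum_range' _ hdegp]
    simp
  rw [e1, e2, Finset.sum_range_succ, hpp, Finset.sum_range_eq_add_Ico _ (by omega), h0] at hev
  rw [← hev]
  have h4 : ∑ j ∈ Finset.Ico 1 p, (f ^ p).coeff j =
      ∑ i ∈ Finset.Icc 1 (p - 1), jacobson p x y i := by
    refine Finset.sum_congr ?_ fun j hj => ?_
    · ext j; simp only [Finset.mem_Ico, Finset.mem_Icc]; omega
    · rw [Finset.mem_Icc] at hj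
      exact hco j hj.1 (by omega)
  rw [h4]
  abel

variable (p A) in
/-- An associative algebra over `ZMod p` is a `p`-Lie algebra with the commutator bracket and
`x^[p] = x ^ p`. -/
@[reducible]
def ofAssociative : RestrictedLieAlgebra p A where
  pmap x := x ^ p
  lie_pmap x y := by
    rw [iterate_lie_right (p := p), sub_pow_prime_of_commute
      (LinearMap.commute_mulLeft_right y y).symm, LinearMap.pow_mulLeft, LinearMap.pow_mulRight]
    rfl
  smul_pmap a x := smul_pow a x p
  pmap_add := add_pow_prime_jacobson

end Associative

attribute [local instance 100] ofAssociative

theorem pmap_associative {p : ℕ} [Fact p.Prime] {A : Type*} [Ring A] [Algebra (ZMod p) A] (a : A) :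
    pmap p a = a ^ p :=
  rfl

/-! ### Generation and universal properties -/

section Generation

theorem quotientMk_eq_zero {p : ℕ} {L : Type*} [LieRing L] [LieAlgebra (ZMod p) L]
    [RestrictedLieAlgebra p L] {S : Set L} {x : L} :
    quotientMk p S x = 0 ↔ x ∈ restrictedSpan p S :=
  LieSubmodule.Quotient.mk_eq_zero _

theorem GraphAlgebra.pmap_gen {p : ℕ} {ι : Type*} [DecidableEq ι] (K : AbstractSimplicialComplex ι)
    (i : ι) : pmap p (GraphAlgebra.gen p K i) = 0 :=
  quotientMk_eq_zero.2 (subset_restrictedSpan p _ (Or.inl ⟨i, rfl⟩))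

theorem GraphAlgebra.lie_gen {p : ℕ} {ι : Type*} [DecidableEq ι] {K : AbstractSimplicialComplex ι}
    {i j : ι} (h : ({i, j} : Finset ι) ∈ K) :
    ⁅GraphAlgebra.gen p K i, GraphAlgebra.gen p K j⁆ = 0 :=
  quotientMk_eq_zero.2 (subset_restrictedSpan p _ (Or.inr ⟨i, j, h, rfl⟩))

variable {p : ℕ} [hp : Fact p.Prime]
variable {L : Type*} [LieRing L] [LieAlgebra (ZMod p) L]

theorem adCoeff_mem_filtration {J : ℕ → Submodule (ZMod p) L}
    (hJ : ∀ a b, ∀ x ∈ J a, ∀ y ∈ J b, ⁅x, y⁆ ∈ J (a + b)) {i : ℕ} {x y : L}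
    (hx : x ∈ J i) (hy : y ∈ J i) (n j : ℕ) : adCoeff x y n j ∈ J ((n + 1) * i) := by
  induction n generalizing j with
  | zero =>
    cases j
    · simpa [adCoeff] using hx
    · exact zero_mem _
  | succ n ih =>
    rw [Nat.succ_mul]
    cases j with
    | zero => exact hJ _ _ _ (ih 0) _ hy
    | succ j => exact add_mem (hJ _ _ _ (ih j) _ hx) (hJ _ _ _ (ih (j + 1)) _ hy)

theorem jacobson_mem_filtration {J : ℕ → Submodule (ZMod p) L}
    (hJ : ∀ a b, ∀ x ∈ J a, ∀ y ∈ J b, ⁅x, y⁆ ∈ J (a + b)) {i : ℕ} {x y : L}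
    (hx : x ∈ J i) (hy : y ∈ J i) (j : ℕ) : jacobson p x y j ∈ J (p * i) := by
  have := adCoeff_mem_filtration hJ hx hy (p - 1) (j - 1)
  rw [Nat.sub_add_cancel hp.out.one_le] at this
  exact Submodule.smul_mem _ _ this

theorem map_jacobson {M : Type*} [LieRing M] [LieAlgebra (ZMod p) M]
    (f : L →ₗ⁅ZMod p⁆ M) (x y : L) (i : ℕ) :
    f (jacobson p x y i) = jacobson p (f x) (f y) i := by
  rw [jacobson, map_smul, map_adCoeff f (map_zero f) (map_add f) (LieHom.map_lie f)]
  rfl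

variable [RestrictedLieAlgebra p L]

variable (p L) in
theorem pmap_zero : pmap p (0 : L) = 0 := by
  have := smul_pmap (p := p) 0 (0 : L)
  rwa [zero_smul, zero_pow hp.out.ne_zero, zero_smul] at this

theorem pmap_mem_of_mem_span {J : ℕ → Submodule (ZMod p) L}
    (hJ : ∀ a b, ∀ x ∈ J a, ∀ y ∈ J b, ⁅x, y⁆ ∈ J (a + b)) {i : ℕ} {S : Set L}
    (hS : Submodule.span (ZMod p) S = J i) (h : ∀ x ∈ S, pmap p x ∈ J (p * i))
    {x : L} (hx : x ∈ J i) : pmap p x ∈ J (p * i) := by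
  rw [← hS] at hx
  induction hx using Submodule.span_induction with
  | mem x hx => exact h x hx
  | zero => rw [pmap_zero]; exact zero_mem _
  | smul a x _ hx => rw [smul_pmap]; exact Submodule.smul_mem _ _ hx
  | add x y hx hy hx' hy' =>
    rw [hS] at hx hy
    rw [pmap_add]
    exact add_mem (add_mem hx' hy') (sum_mem fun j _ => jacobson_mem_filtration hJ hx hy j)

section Hom

variable {M : Type*} [LieRing M] [LieAlgebra (ZMod p) M] [RestrictedLieAlgebra p M]

/-- A Lie algebra homomorphism that respects the `p`-power operations on a spanning set respects
them everywhere. -/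
theorem isRestrictedHom_of_span (f : L →ₗ⁅ZMod p⁆ M) {S : Set L}
    (hS : Submodule.span (ZMod p) S = ⊤) (h : ∀ x ∈ S, f (pmap p x) = pmap p (f x)) :
    IsRestrictedHom p f := by
  intro x
  have hx : x ∈ Submodule.span (ZMod p) S := hS ▸ Submodule.mem_top
  induction hx using Submodule.span_induction with
  | mem x hx => exact h x hx
  | zero => rw [map_zero, pmap_zero, pmap_zero, map_zero]
  | smul a x _ hx => rw [map_smul, smul_pmap, smul_pmap, map_smul, hx]
  | add x y _ _ hx hy => simp only [map_add, pmap_add, map_sum, map_jacobson, hx, hy]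

/-- The universal property of the quotient by a restricted ideal. -/
theorem exists_quotientLift {S : Set L} (f : L →ₗ⁅ZMod p⁆ M) (hf : IsRestrictedHom p f)
    (hfp : pmap p (0 : M) = 0) (hS : ∀ x ∈ S, f x = 0) :
    ∃ g : QuotientBy p S →ₗ⁅ZMod p⁆ M, IsRestrictedHom p g ∧ ∀ x, g (quotientMk p S x) = f x := by
  have hle : ∀ x ∈ restrictedSpan p S, f x = 0 := fun x hx =>
    (LieHom.mem_ker (f := f)).1 ((mem_restrictedSpan p).1 hx f.ker
      (fun y hy => (LieHom.mem_ker (f := f)).2 (hS y hy))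
      fun y hy => by
        rw [LieHom.mem_ker] at hy ⊢
        rw [hf, hy, hfp])
  let g : QuotientBy p S →ₗ[ZMod p] M :=
    (restrictedSpan p S).toSubmodule.liftQ (f : L →ₗ[ZMod p] M) hle
  have hg : ∀ x, g (quotientMk p S x) = f x := fun _ => rfl
  refine ⟨{ g with map_lie' := ?_ }, ?_, hg⟩
  · intro x y
    obtain ⟨x, rfl⟩ : ∃ a, quotientMk p S a = x := Quotient.mk_surjective x
    obtain ⟨y, rfl⟩ : ∃ a, quotientMk p S a = y := Quotient.mk_surjective y
    exact LieHom.map_lie f x y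
  · intro x
    obtain ⟨x, rfl⟩ : ∃ a, quotientMk p S a = x := Quotient.mk_surjective x
    exact hf x

end Hom

/-- Induction over the free `p`-Lie algebra modulo relations. -/
theorem quotient_free_induction {X : Type*} {S : Set (FreeRestricted p X)}
    {C : QuotientBy p S → Prop} (of : ∀ x, C (quotientMk p S (FreeRestricted.of p x)))
    (zero : C 0) (add : ∀ x y, C x → C y → C (x + y))
    (smul : ∀ (a : ZMod p) x, C x → C (a • x)) (lie : ∀ x y, C x → C y → C ⁅x, y⁆)
    (pow : ∀ x, C x → C (pmap p x)) (x : QuotientBy p S) : C x := by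
  obtain ⟨x, rfl⟩ : ∃ a, quotientMk p S a = x := Quotient.mk_surjective x
  obtain ⟨a⟩ := x
  induction a with
  | of x => exact of x
  | zero => exact zero
  | add a b ha hb => exact add _ _ ha hb
  | smul t a ha => exact smul t _ ha
  | lie a b ha hb => exact lie _ _ ha hb
  | pow a ha => exact pow _ ha

theorem quotient_free_hom_ext {X : Type*} {S : Set (FreeRestricted p X)}
    {M : Type*} [LieRing M] [LieAlgebra (ZMod p) M] [RestrictedLieAlgebra p M]
    {f g : QuotientBy p S →ₗ⁅ZMod p⁆ M} (hf : IsRestrictedHom p f) (hg : IsRestrictedHom p g)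
    (h : ∀ x, f (quotientMk p S (FreeRestricted.of p x)) =
      g (quotientMk p S (FreeRestricted.of p x))) : f = g := by
  ext x
  induction x using quotient_free_induction with
  | of x => exact h x
  | zero => rw [map_zero, map_zero]
  | add x y hx hy => rw [map_add, map_add, hx, hy]
  | smul a x hx => rw [map_smul, map_smul, hx]
  | lie x y hx hy => rw [LieHom.map_lie, LieHom.map_lie, hx, hy]
  | pow x hx => rw [hf, hg, hx]

theorem GraphAlgebra.exists_lift {ι : Type*} [DecidableEq ι] {K : AbstractSimplicialComplex ι}
    {M : Type*} [LieRing M] [LieAlgebra (ZMod p) M] [RestrictedLieAlgebra p M] (v : ι → M)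
    (hv : ∀ i, pmap p (v i) = 0) (hK : ∀ i j, ({i, j} : Finset ι) ∈ K → ⁅v i, v j⁆ = 0) :
    ∃ f : GraphAlgebra p K →ₗ⁅ZMod p⁆ M, IsRestrictedHom p f ∧
      ∀ i, f (GraphAlgebra.gen p K i) = v i := by
  obtain ⟨g, ⟨hg, hgv⟩, -⟩ := FreeRestricted.existsUnique_lift (p := p) v
  obtain ⟨f, hf, hfg⟩ := exists_quotientLift (p := p)
    (S := {r | ∃ i : ι, r = pmap p (FreeRestricted.of p i)} ∪
      {r | ∃ i j : ι, ({i, j} : Finset ι) ∈ K ∧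
        r = ⁅FreeRestricted.of p i, FreeRestricted.of p j⁆}) g hg (pmap_zero p M) (by
    rintro x (⟨i, rfl⟩ | ⟨i, j, hij, rfl⟩)
    · rw [hg, hgv, hv]
    · rw [LieHom.map_lie, hgv, hgv, hK i j hij])
  exact ⟨f, hf, fun i => (hfg _).trans (hgv i)⟩

end Generation

/-! ### The Jacobson cocycle -/

section Cocycle

variable (p : ℕ) [hp : Fact p.Prime]

/-- The sum `∑ s_i(x, y)` measuring the failure of additivity of the `p`-power operation. -/
def jacobsonSum {L : Type*} [LieRing L] [LieAlgebra (ZMod p) L] (x y : L) : L :=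
  ∑ i ∈ Finset.Icc 1 (p - 1), jacobson p x y i

variable {p} {L M : Type*} [LieRing L] [LieAlgebra (ZMod p) L] [LieRing M] [LieAlgebra (ZMod p) M]

theorem map_jacobsonSum (f : L →ₗ⁅ZMod p⁆ M) (x y : L) :
    f (jacobsonSum p x y) = jacobsonSum p (f x) (f y) := by
  simp only [jacobsonSum, map_sum, map_jacobson]

theorem jacobsonSum_associative {A : Type*} [Ring A] [Algebra (ZMod p) A] (x y : A) :
    jacobsonSum p x y = (x + y) ^ p - x ^ p - y ^ p := by
  rw [add_pow_prime_jacobson, jacobsonSum]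
  abel

theorem adCoeff_of_lie_eq_zero {x y : L} (h : ⁅x, y⁆ = 0) :
    ∀ n j : ℕ, adCoeff x y (n + 1) j = 0
  | 0, 0 => h
  | 0, 1 => by simp [adCoeff]
  | 0, j + 2 => by simp [adCoeff]
  | n + 1, 0 => by rw [adCoeff, adCoeff_of_lie_eq_zero h, zero_lie]
  | n + 1, j + 1 => by
    rw [adCoeff, adCoeff_of_lie_eq_zero h, adCoeff_of_lie_eq_zero h, zero_lie, zero_lie, add_zero]

theorem jacobsonSum_of_lie_eq_zero {x y : L} (h : ⁅x, y⁆ = 0) : jacobsonSum p x y = 0 := by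
  refine Finset.sum_eq_zero fun i _ => ?_
  obtain ⟨n, hn⟩ : ∃ n, p - 1 = n + 1 := ⟨p - 2, by have := hp.out.two_le; omega⟩
  rw [jacobson, hn, adCoeff_of_lie_eq_zero h, smul_zero]

variable (p) in
/-- The defect of the cocycle identity for `jacobsonSum`. -/
def cocycleDefect (x y z : L) : L :=
  jacobsonSum p x y + jacobsonSum p (x + y) z - jacobsonSum p y z - jacobsonSum p x (y + z)

theorem map_cocycleDefect (f : L →ₗ⁅ZMod p⁆ M) (x y z : L) :
    f (cocycleDefect p x y z) = cocycleDefect p (f x) (f y) (f z) := by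
  simp only [cocycleDefect, map_sub, map_add, map_jacobsonSum]

theorem cocycleDefect_associative {A : Type*} [Ring A] [Algebra (ZMod p) A] (x y z : A) :
    cocycleDefect p x y z = 0 := by
  simp only [cocycleDefect, jacobsonSum_associative, add_assoc]
  abel

theorem jacobsonSum_comm_associative {A : Type*} [Ring A] [Algebra (ZMod p) A] (x y : A) :
    jacobsonSum p x y - jacobsonSum p y x = 0 := by
  simp only [jacobsonSum_associative, add_comm y x]
  abel

/-- The restriction to `L` of the adjoint representation of the semidirect product of `L` with a
one-dimensional algebra acting by the derivation `d`; the second coordinate of `L × ZMod p` stands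
for the multiples of `d`. -/
def derivationRep (d : LieDerivation (ZMod p) L L) :
    L →ₗ⁅ZMod p⁆ Module.End (ZMod p) (L × ZMod p) where
  toFun x := LinearMap.inl (ZMod p) L (ZMod p) ∘ₗ
    (LieAlgebra.ad (ZMod p) L x ∘ₗ LinearMap.fst (ZMod p) L (ZMod p) -
      LinearMap.toSpanSingleton (ZMod p) L (d x) ∘ₗ LinearMap.snd (ZMod p) L (ZMod p))
  map_add' x y := by
    refine LinearMap.ext fun v => Prod.ext ?_ (add_zero _).symm
    change ⁅x + y, v.1⁆ - v.2 • d (x + y) = ⁅x, v.1⁆ - v.2 • d x + (⁅y, v.1⁆ - v.2 • d y)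
    rw [add_lie, map_add, smul_add]
    abel
  map_smul' a x := by
    refine LinearMap.ext fun v => Prod.ext ?_ (smul_zero _).symm
    change ⁅a • x, v.1⁆ - v.2 • d (a • x) = a • (⁅x, v.1⁆ - v.2 • d x)
    rw [smul_lie, map_smul, smul_sub, smul_comm]
  map_lie' {x y} := by
    refine LinearMap.ext fun v => Prod.ext ?_ (sub_zero _).symm
    have h : d ⁅x, y⁆ = ⁅x, d y⁆ - ⁅y, d x⁆ := d.apply_lie_eq_sub x y
    change ⁅⁅x, y⁆, v.1⁆ - v.2 • d ⁅x, y⁆ =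
      ⁅x, ⁅y, v.1⁆ - v.2 • d y⁆ - (0 : ZMod p) • d x -
        (⁅y, ⁅x, v.1⁆ - v.2 • d x⁆ - (0 : ZMod p) • d y)
    simp only [h, lie_lie, lie_sub, lie_smul, smul_sub, zero_smul]
    abel

theorem derivation_eq_zero_of_rep_eq_zero (d : LieDerivation (ZMod p) L L) {x : L}
    (h : derivationRep d x = 0) : d x = 0 := by
  have : ⁅x, (0 : L)⁆ - (1 : ZMod p) • d x = 0 :=
    congrArg (fun f : Module.End (ZMod p) (L × ZMod p) => (f (0, 1)).1) h
  simpa using this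

end Cocycle

/-! ### Polynomial loops -/

section Loop

open scoped TensorProduct Polynomial

variable {p : ℕ} [hp : Fact p.Prime] {L : Type*} [LieRing L] [LieAlgebra (ZMod p) L]

variable (p L) in
/-- The Lie algebra `L[t]` of polynomials with coefficients in `L`. -/
def Loop : Type _ := (ZMod p)[X] ⊗[ZMod p] L

namespace Loop

noncomputable instance : LieRing (Loop p L) := inferInstanceAs (LieRing ((ZMod p)[X] ⊗[ZMod p] L))

noncomputable instance : LieAlgebra (ZMod p) (Loop p L) :=
  inferInstanceAs (LieAlgebra (ZMod p) ((ZMod p)[X] ⊗[ZMod p] L))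

/-- The element `x t ^ i` of `L[t]`. -/
noncomputable def mon (i : ℕ) : L →ₗ[ZMod p] Loop p L :=
  TensorProduct.mk (ZMod p) (ZMod p)[X] L (Polynomial.X ^ i)

theorem lie_mon (i j : ℕ) (x y : L) :
    ⁅(mon i x : Loop p L), (mon j y : Loop p L)⁆ = mon (i + j) ⁅x, y⁆ := by
  change (Polynomial.X ^ i * Polynomial.X ^ j : (ZMod p)[X]) ⊗ₜ[ZMod p] ⁅x, y⁆ = _
  rw [← pow_add]
  rfl

theorem span_mon : Submodule.span (ZMod p) {v : Loop p L | ∃ i x, v = mon i x} = ⊤ := by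
  refine eq_top_iff.2 fun v _ => ?_
  refine TensorProduct.induction_on v (zero_mem _) (fun f x => ?_) fun v w hv hw => add_mem hv hw
  rw [f.as_sum_range_C_mul_X_pow, TensorProduct.sum_tmul]
  refine sum_mem fun i _ => ?_
  rw [← Polynomial.smul_eq_C_mul, ← TensorProduct.smul_tmul']
  exact Submodule.smul_mem _ _ (Submodule.subset_span ⟨i, x, rfl⟩)

theorem induction {C : Loop p L → Prop} (zero : C 0) (mon : ∀ i x, C (Loop.mon i x))
    (add : ∀ v w, C v → C w → C (v + w)) (v : Loop p L) : C v := by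
  have hv : v ∈ Submodule.span (ZMod p) {v : Loop p L | ∃ i x, v = Loop.mon i x} :=
    by rw [span_mon]; exact Submodule.mem_top
  induction hv using Submodule.closure_induction with
  | zero => exact zero
  | add v w _ _ hv hw => exact add v w hv hw
  | smul_mem a v hv =>
    obtain ⟨i, x, rfl⟩ := hv
    rw [← map_smul]
    exact mon i _

theorem hom_ext {M : Type*} [AddCommGroup M] [Module (ZMod p) M] {f g : Loop p L →ₗ[ZMod p] M}
    (h : ∀ i x, f (mon i x) = g (mon i x)) : f = g := by
  refine LinearMap.ext_on span_mon ?_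
  rintro _ ⟨i, x, rfl⟩
  exact h i x

/-- The linear map `L[t] → M` given by linear maps on the homogeneous components. -/
noncomputable def lift {M : Type*} [AddCommGroup M] [Module (ZMod p) M] (f : ℕ → L →ₗ[ZMod p] M) :
    Loop p L →ₗ[ZMod p] M :=
  TensorProduct.lift ((Polynomial.basisMonomials (ZMod p)).constr (M' := L →ₗ[ZMod p] M) (ZMod p) f)

theorem lift_mon {M : Type*} [AddCommGroup M] [Module (ZMod p) M] (f : ℕ → L →ₗ[ZMod p] M)
    (i : ℕ) (x : L) : lift f (mon i x) = f i x := by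
  change TensorProduct.lift _ ((Polynomial.X ^ i : (ZMod p)[X]) ⊗ₜ[ZMod p] x) = _
  have h := (Polynomial.basisMonomials (ZMod p)).constr_basis (M' := L →ₗ[ZMod p] M) (ZMod p) f i
  rw [Polynomial.coe_basisMonomials] at h
  rw [← Polynomial.monomial_one_right_eq_X_pow]
  exact LinearMap.congr_fun h x

/-- The coefficient of `t ^ i`. -/
noncomputable def coeff (i : ℕ) : Loop p L →ₗ[ZMod p] L :=
  lift fun j => if i = j then LinearMap.id else 0

theorem coeff_mon (i j : ℕ) (x : L) :
    coeff i (mon j x : Loop p L) = if i = j then x else 0 := by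
  rw [coeff, lift_mon]
  split_ifs <;> rfl

/-- Evaluation at `t = a`. -/
noncomputable def eval (a : ZMod p) : Loop p L →ₗ⁅ZMod p⁆ L where
  toLinearMap := lift fun i => a ^ i • LinearMap.id
  map_lie' {v w} := by
    change lift _ _ = ⁅lift _ _, lift _ _⁆
    induction v using induction with
    | zero => simp
    | add v v' hv hv' => simp only [add_lie, map_add, hv, hv']
    | mon i x =>
      induction w using induction with
      | zero => simp
      | add w w' hw hw' => simp only [lie_add, map_add, hw, hw']
      | mon j y => simp [lie_mon, lift_mon, smul_smul, pow_add, mul_comm]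

theorem eval_mon (a : ZMod p) (i : ℕ) (x : L) : eval a (mon i x) = a ^ i • x :=
  lift_mon _ i x

/-- The derivation `d / dt`. -/
noncomputable def deriv : LieDerivation (ZMod p) (Loop p L) (Loop p L) where
  toLinearMap := lift fun i => (i : ZMod p) • mon (i - 1)
  leibniz' v w := by
    induction v using induction with
    | zero => simp
    | add v v' hv hv' =>
      simp only [add_lie, map_add, hv, hv', lie_add]; abel
    | mon i x =>
      induction w using induction with
      | zero => simp
      | add w w' hw hw' => simp only [add_lie, map_add, hw, hw', lie_add]; abel
      | mon j y =>
        simp only [lie_mon, lift_mon, LinearMap.smul_apply, lie_smul, ← lie_skew y x, map_neg]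
        rcases i with _ | i <;> rcases j with _ | j
        · simp
        · simp
        · simp
        · rw [show i + 1 + (j + 1) - 1 = i + j + 1 by omega,
            show i + 1 + (j + 1 - 1) = i + j + 1 by omega,
            show j + 1 + (i + 1 - 1) = i + j + 1 by omega]
          push_cast
          module

theorem deriv_mon (i : ℕ) (x : L) :
    deriv (mon i x : Loop p L) = (i : ZMod p) • mon (i - 1) x :=
  lift_mon _ i x

theorem coeff_deriv (i : ℕ) (v : Loop p L) :
    coeff i (deriv v) = ((i + 1 : ℕ) : ZMod p) • coeff (i + 1) v := by
  refine LinearMap.congr_fun (f := coeff i ∘ₗ deriv.toLinearMap)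
    (g := ((i + 1 : ℕ) : ZMod p) • coeff (i + 1)) (hom_ext fun j x => ?_) v
  change coeff i (deriv (mon j x)) = _
  rw [deriv_mon, map_smul, coeff_mon, LinearMap.smul_apply, coeff_mon]
  rcases j with _ | j
  · simp
  · rcases eq_or_ne i j with rfl | h
    · simp
    · simp [h]

/-- The polynomials of degree at most `d`. -/
noncomputable def degLE (d : ℕ) : Submodule (ZMod p) (Loop p L) :=
  Submodule.span (ZMod p) {v | ∃ i x, i ≤ d ∧ v = mon i x}

theorem mon_mem_degLE {i d : ℕ} (h : i ≤ d) (x : L) : (mon i x : Loop p L) ∈ degLE d :=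
  Submodule.subset_span ⟨i, x, h, rfl⟩

theorem degLE_mono {d e : ℕ} (h : d ≤ e) : degLE (p := p) (L := L) d ≤ degLE e := by
  refine Submodule.span_mono ?_
  rintro _ ⟨i, x, hi, rfl⟩
  exact ⟨i, x, hi.trans h, rfl⟩

theorem lie_mem_degLE {d e : ℕ} {v w : Loop p L} (hv : v ∈ degLE d) (hw : w ∈ degLE e) :
    ⁅v, w⁆ ∈ degLE (d + e) := by
  induction hv using Submodule.span_induction with
  | zero => rw [zero_lie]; exact zero_mem _
  | add v v' _ _ hv hv' => rw [add_lie]; exact add_mem hv hv'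
  | smul a v _ hv => rw [smul_lie]; exact Submodule.smul_mem _ _ hv
  | mem v hv =>
    obtain ⟨i, x, hi, rfl⟩ := hv
    induction hw using Submodule.span_induction with
    | zero => rw [lie_zero]; exact zero_mem _
    | add w w' _ _ hw hw' => rw [lie_add]; exact add_mem hw hw'
    | smul a w _ hw => rw [lie_smul]; exact Submodule.smul_mem _ _ hw
    | mem w hw =>
      obtain ⟨j, y, hj, rfl⟩ := hw
      rw [lie_mon]
      exact mon_mem_degLE (by omega) _

theorem eval_one_eq_sum {d : ℕ} {v : Loop p L} (hv : v ∈ degLE d) :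
    eval 1 v = ∑ i ∈ Finset.range (d + 1), coeff i v := by
  induction hv using Submodule.span_induction with
  | zero => simp
  | add v v' _ _ hv hv' => simp [hv, hv', Finset.sum_add_distrib]
  | smul a v _ hv => simp [hv, Finset.smul_sum]
  | mem v hv =>
    obtain ⟨i, x, hi, rfl⟩ := hv
    simp [coeff_mon, eval_mon, hi]

theorem eval_zero_eq (v : Loop p L) : eval 0 v = coeff 0 v := by
  refine LinearMap.congr_fun (f := (eval 0 : Loop p L →ₗ⁅ZMod p⁆ L).toLinearMap)
    (g := coeff 0) (hom_ext fun j x => ?_) v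
  change eval 0 (mon j x) = _
  rw [eval_mon, coeff_mon]
  rcases j with _ | j <;> simp

/-- A polynomial of degree less than `p` with vanishing derivative is constant. -/
theorem eval_one_eq_eval_zero {v : Loop p L} (hv : v ∈ degLE (p - 1)) (hd : deriv v = 0) :
    eval 1 v = eval 0 v := by
  rw [eval_one_eq_sum hv, eval_zero_eq, Finset.sum_range_succ', add_eq_right]
  refine Finset.sum_eq_zero fun i hi => ?_
  have h1 := coeff_deriv i v
  rw [hd, map_zero] at h1
  refine (smul_eq_zero.1 h1.symm).resolve_left ?_
  rw [ZMod.natCast_eq_zero_iff]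
  rw [Finset.mem_range] at hi
  exact Nat.not_dvd_of_pos_of_lt (by omega) (by omega)

theorem adCoeff_mem_degLE {a b : ℕ} {v w : Loop p L} (hv : v ∈ degLE a) (hw : w ∈ degLE b)
    (n j : ℕ) (hj : j ≤ n) : adCoeff v w n j ∈ degLE ((j + 1) * a + (n - j) * b) := by
  induction n generalizing j with
  | zero =>
    obtain rfl : j = 0 := by omega
    simpa [adCoeff] using hv
  | succ n ih =>
    cases j with
    | zero =>
      have := lie_mem_degLE (ih 0 (by omega)) hw
      refine degLE_mono (le_of_eq ?_) this
      simp; ring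
    | succ j =>
      refine add_mem ?_ ?_
      · refine degLE_mono (le_of_eq ?_) (lie_mem_degLE (ih j (by omega)) hv)
        rw [Nat.add_sub_add_right]; ring
      · rcases Nat.lt_or_ge j n with h | h
        · refine degLE_mono (le_of_eq ?_) (lie_mem_degLE (ih (j + 1) (by omega)) hw)
          obtain ⟨k, rfl⟩ : ∃ k, n = j + 1 + k := ⟨n - (j + 1), by omega⟩
          rw [show j + 1 + k + 1 - (j + 1) = k + 1 by omega, show j + 1 + k - (j + 1) = k by omega]
          ring
        · rw [adCoeff_eq_zero v w n (j + 1) (by omega), zero_lie]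
          exact zero_mem _

theorem jacobsonSum_mem_degLE {a b : ℕ} {v w : Loop p L} (hv : v ∈ degLE a) (hw : w ∈ degLE b)
    (hab : a + b ≤ 1) : jacobsonSum p v w ∈ degLE (p - 1) := by
  refine sum_mem fun i hi => Submodule.smul_mem _ _ ?_
  rw [Finset.mem_Icc] at hi
  refine degLE_mono ?_ (adCoeff_mem_degLE hv hw (p - 1) (i - 1) (by omega))
  obtain ⟨rfl, rfl⟩ | ⟨rfl, rfl⟩ | ⟨rfl, rfl⟩ :
    (a = 0 ∧ b = 0) ∨ (a = 1 ∧ b = 0) ∨ (a = 0 ∧ b = 1) := by omega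
  all_goals simp only [mul_one, mul_zero]; omega

end Loop

/-- The Jacobson polynomials form a cocycle. In an associative algebra this is clear, so the
defect, being a Lie polynomial, is sent to zero by every representation. By `derivationRep` it is
killed by every derivation. For `d / dt` on `L[t]` this shows that the defect of `x t, y, z`, of
degree less than `p` in `t`, does not depend on `t`, and it vanishes for `t = 0`. -/
theorem cocycleDefect_eq_zero (x y z : L) : cocycleDefect p x y z = 0 := by
  let X : Loop p L := Loop.mon 1 x
  let Y : Loop p L := Loop.mon 0 y
  let Z : Loop p L := Loop.mon 0 z
  have hX : X ∈ Loop.degLE 1 := Loop.mon_mem_degLE le_rfl x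
  have hY : Y ∈ Loop.degLE 0 := Loop.mon_mem_degLE le_rfl y
  have hZ : Z ∈ Loop.degLE 0 := Loop.mon_mem_degLE le_rfl z
  have h0 := Loop.degLE_mono (p := p) (L := L) zero_le_one
  have hdeg : cocycleDefect p X Y Z ∈ Loop.degLE (p - 1) :=
    sub_mem (sub_mem (add_mem (Loop.jacobsonSum_mem_degLE hX hY le_rfl)
      (Loop.jacobsonSum_mem_degLE (add_mem hX (h0 hY)) hZ le_rfl))
      (Loop.jacobsonSum_mem_degLE hY hZ zero_le_one))
      (Loop.jacobsonSum_mem_degLE hX (add_mem hY hZ) le_rfl)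
  have hd : Loop.deriv (cocycleDefect p X Y Z) = 0 :=
    derivation_eq_zero_of_rep_eq_zero _ (by rw [map_cocycleDefect, cocycleDefect_associative])
  have := Loop.eval_one_eq_eval_zero hdeg hd
  rw [map_cocycleDefect, map_cocycleDefect] at this
  simp only [X, Y, Z, Loop.eval_mon, one_smul, pow_one, pow_zero, zero_smul] at this
  rw [this]
  simp [cocycleDefect, jacobsonSum_of_lie_eq_zero (zero_lie _)]

/-- The cocycle is symmetric, for the same reason as in `cocycleDefect_eq_zero`. -/
theorem jacobsonSum_comm (x y : L) : jacobsonSum p x y = jacobsonSum p y x := by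
  let X : Loop p L := Loop.mon 1 x
  let Y : Loop p L := Loop.mon 0 y
  have hX : X ∈ Loop.degLE 1 := Loop.mon_mem_degLE le_rfl x
  have hY : Y ∈ Loop.degLE 0 := Loop.mon_mem_degLE le_rfl y
  have hdeg : jacobsonSum p X Y - jacobsonSum p Y X ∈ Loop.degLE (p - 1) :=
    sub_mem (Loop.jacobsonSum_mem_degLE hX hY le_rfl) (Loop.jacobsonSum_mem_degLE hY hX le_rfl)
  have hd : Loop.deriv (jacobsonSum p X Y - jacobsonSum p Y X) = 0 :=
    derivation_eq_zero_of_rep_eq_zero _ (by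
      rw [map_sub, map_jacobsonSum, map_jacobsonSum, jacobsonSum_comm_associative])
  have := Loop.eval_one_eq_eval_zero hdeg hd
  rw [map_sub, map_sub] at this
  simp only [map_jacobsonSum, X, Y, Loop.eval_mon, one_smul, pow_one, pow_zero,
    zero_smul] at this
  rw [jacobsonSum_of_lie_eq_zero (zero_lie _), jacobsonSum_of_lie_eq_zero (lie_zero _),
    sub_self] at this
  exact sub_eq_zero.1 this

end Loop

/-! ### The extension defined by the Jacobson cocycle -/

section Extension

variable {p : ℕ} [hp : Fact p.Prime] {L : Type*} [LieRing L] [LieAlgebra (ZMod p) L]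

theorem jacobsonSum_assoc (x y z : L) :
    jacobsonSum p x y + jacobsonSum p (x + y) z = jacobsonSum p y z + jacobsonSum p x (y + z) := by
  have := cocycleDefect_eq_zero (p := p) x y z
  rw [cocycleDefect, sub_sub, sub_eq_zero] at this
  exact this

theorem jacobsonSum_zero_left (x : L) : jacobsonSum p 0 x = 0 :=
  jacobsonSum_of_lie_eq_zero (zero_lie x)

/-- The abelian extension of `L` by itself with the cocycle `jacobsonSum`. An additive section of
`base` is the same as a map satisfying the addition formula of a `p`-power operation. -/
@[ext]
structure JacobsonExt (p : ℕ) (L : Type*) where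
  /-- The projection to `L`. -/
  base : L
  /-- The coordinate in the kernel, a candidate for the `p`-th power of `base`. -/
  value : L

namespace JacobsonExt

instance : Add (JacobsonExt p L) :=
  ⟨fun e f => ⟨e.base + f.base, e.value + f.value + jacobsonSum p e.base f.base⟩⟩

instance : Zero (JacobsonExt p L) := ⟨⟨0, 0⟩⟩

instance : Neg (JacobsonExt p L) := ⟨fun e => ⟨-e.base, -e.value⟩⟩

theorem base_add (e f : JacobsonExt p L) : (e + f).base = e.base + f.base := rfl

theorem value_add (e f : JacobsonExt p L) :
    (e + f).value = e.value + f.value + jacobsonSum p e.base f.base := rfl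

instance : AddCommGroup (JacobsonExt p L) where
  add_assoc e f g := by
    ext
    · exact add_assoc _ _ _
    · simp only [value_add, base_add]
      have := jacobsonSum_assoc (p := p) e.base f.base g.base
      rw [add_right_comm, add_assoc _ (jacobsonSum p e.base f.base), this]
      abel
  zero_add e := by
    ext
    · exact zero_add _
    · simp only [value_add]
      change 0 + e.value + jacobsonSum p 0 e.base = _
      rw [jacobsonSum_zero_left, zero_add, add_zero]
  add_zero e := by
    ext
    · exact add_zero _
    · simp only [value_add]
      change e.value + 0 + jacobsonSum p e.base 0 = _
      rw [jacobsonSum_comm, jacobsonSum_zero_left, add_zero, add_zero]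
  add_comm e f := by
    ext
    · exact add_comm _ _
    · simp only [value_add]
      rw [add_comm e.value, jacobsonSum_comm]
  neg_add_cancel e := by
    ext
    · exact neg_add_cancel _
    · change -e.value + e.value + jacobsonSum p (-e.base) e.base = 0
      rw [jacobsonSum_of_lie_eq_zero (by simp), neg_add_cancel, add_zero]
  nsmul := nsmulRec
  zsmul := zsmulRec

theorem nsmul_eq (n : ℕ) (e : JacobsonExt p L) : n • e = ⟨n • e.base, n • e.value⟩ := by
  induction n with
  | zero => simp only [zero_smul]; rfl
  | succ n ih =>
    rw [succ_nsmul, ih]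
    ext
    · exact (succ_nsmul _ _).symm
    · rw [value_add]
      simp only
      rw [jacobsonSum_of_lie_eq_zero (by simp), add_zero, succ_nsmul]

noncomputable instance : Module (ZMod p) (JacobsonExt p L) :=
  AddCommGroup.zmodModule fun e => by
    rw [nsmul_eq]
    have h : ∀ x : L, p • x = 0 := fun x => by
      rw [← Nat.cast_smul_eq_nsmul (ZMod p)]; simp
    rw [h, h]
    rfl

theorem smul_eq (a : ZMod p) (e : JacobsonExt p L) : a • e = ⟨a • e.base, a • e.value⟩ := by
  obtain ⟨n, rfl⟩ := ZMod.natCast_zmod_surjective a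
  simp only [Nat.cast_smul_eq_nsmul, nsmul_eq]

/-- The projection to `L`. -/
noncomputable def baseHom : JacobsonExt p L →ₗ[ZMod p] L where
  toFun := base
  map_add' := base_add
  map_smul' a e := by rw [smul_eq]; rfl

end JacobsonExt

/-- The bracket axiom of a `p`-Lie algebra, in terms of the adjoint representation. -/
theorem lie_pow_iff (y v : L) :
    (∀ x : L, ⁅x, v⁆ = (fun z => ⁅z, y⁆)^[p] x) ↔
      LieAlgebra.ad (ZMod p) L v = LieAlgebra.ad (ZMod p) L y ^ p := by
  have h : ∀ (n : ℕ) (x : L), (fun z => ⁅z, y⁆)^[n] x =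
      ((-LieAlgebra.ad (ZMod p) L y) ^ n) x := fun n x => by
    rw [Module.End.pow_apply]
    refine congrFun (congrArg (fun f : L → L => f^[n]) (funext fun z => ?_)) x
    simp
  have h2 : (-LieAlgebra.ad (ZMod p) L y) ^ p = -(LieAlgebra.ad (ZMod p) L y ^ p) := by
    have := sub_pow_prime_of_commute (p := p) (Commute.zero_left (LieAlgebra.ad (ZMod p) L y))
    rwa [zero_sub, zero_pow hp.out.ne_zero, zero_sub] at this
  simp only [h, h2]
  constructor
  · intro h3
    ext x
    rw [LieAlgebra.ad_apply, ← lie_skew, h3, LinearMap.neg_apply, neg_neg]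
  · intro h3 x
    rw [← h3, ← lie_skew]
    rfl

variable (L) in
/-- The elements of the extension whose value acts as the `p`-th power of the base. -/
noncomputable def JacobsonExt.admissible : Submodule (ZMod p) (JacobsonExt p L) where
  carrier := {e | LieAlgebra.ad (ZMod p) L e.value = LieAlgebra.ad (ZMod p) L e.base ^ p}
  zero_mem' := by
    change LieAlgebra.ad (ZMod p) L 0 = LieAlgebra.ad (ZMod p) L 0 ^ p
    rw [map_zero, zero_pow hp.out.ne_zero]
  add_mem' {e f} he hf := by
    change LieAlgebra.ad (ZMod p) L (e.value + f.value + jacobsonSum p e.base f.base) =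
      LieAlgebra.ad (ZMod p) L (e.base + f.base) ^ p
    rw [Set.mem_ofPred_eq] at he hf
    rw [map_add, map_add, map_jacobsonSum, he, hf, jacobsonSum_associative, map_add]
    abel
  smul_mem' a e he := by
    rw [Set.mem_ofPred_eq] at he ⊢
    rw [JacobsonExt.smul_eq, map_smul, map_smul, he, smul_pow, ZMod.pow_card]

/-- An admissible linear section of the extension is a `p`-Lie algebra structure. -/
@[reducible]
noncomputable def restrictedOfSection (σ : L →ₗ[ZMod p] JacobsonExt p L)
    (hσ : ∀ x, (σ x).base = x) (hσ' : ∀ x, σ x ∈ JacobsonExt.admissible L) :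
    RestrictedLieAlgebra p L where
  pmap x := (σ x).value
  lie_pmap x y := by
    refine (lie_pow_iff y (σ y).value).2 ?_ x
    have := hσ' y
    conv_rhs => rw [← hσ y]
    exact this
  smul_pmap a x := by rw [map_smul, JacobsonExt.smul_eq, ZMod.pow_card]
  pmap_add x y := by rw [map_add, JacobsonExt.value_add, hσ, hσ]; rfl

end Extension

/-! ### The `p`-Lie algebra `L[t]` -/

namespace Loop

variable {p : ℕ} [hp : Fact p.Prime] {L : Type*} [LieRing L] [LieAlgebra (ZMod p) L]

theorem adCoeff_mon (i : ℕ) (x y : L) (n j : ℕ) :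
    adCoeff (mon i x : Loop p L) (mon i y) n j = mon ((n + 1) * i) (adCoeff x y n j) := by
  induction n generalizing j with
  | zero => cases j <;> simp [adCoeff]
  | succ n ih => cases j <;> simp only [adCoeff, ih, lie_mon, Nat.succ_mul, map_add]

theorem jacobsonSum_mon (i : ℕ) (x y : L) :
    jacobsonSum p (mon i x : Loop p L) (mon i y) = mon (p * i) (jacobsonSum p x y) := by
  simp only [jacobsonSum, jacobson, adCoeff_mon, Nat.sub_add_cancel hp.out.one_le, map_sum,
    map_smul]

theorem lie_mon_iterate (i j : ℕ) (x y : L) (n : ℕ) :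
    (fun z => ⁅z, (mon j y : Loop p L)⁆)^[n] (mon i x) =
      mon (i + n * j) ((fun z => ⁅z, y⁆)^[n] x) := by
  induction n with
  | zero => simp
  | succ n ih =>
    rw [Function.iterate_succ_apply', Function.iterate_succ_apply', ih, lie_mon]
    congr 1
    ring_nf

/-- The multiples of `t ^ n`. -/
noncomputable def ordGE (n : ℕ) : Submodule (ZMod p) (Loop p L) :=
  Submodule.span (ZMod p) {v | ∃ i x, n ≤ i ∧ v = mon i x}

theorem mon_mem_ordGE {i n : ℕ} (h : n ≤ i) (x : L) : (mon i x : Loop p L) ∈ ordGE n :=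
  Submodule.subset_span ⟨i, x, h, rfl⟩

theorem ordGE_anti {m n : ℕ} (h : m ≤ n) : ordGE (p := p) (L := L) n ≤ ordGE m := by
  refine Submodule.span_mono ?_
  rintro _ ⟨i, x, hi, rfl⟩
  exact ⟨i, x, h.trans hi, rfl⟩

theorem lie_mem_ordGE (a b : ℕ) (v : Loop p L) (hv : v ∈ ordGE a) (w : Loop p L)
    (hw : w ∈ ordGE b) : ⁅v, w⁆ ∈ ordGE (a + b) := by
  induction hv using Submodule.span_induction with
  | zero => rw [zero_lie]; exact zero_mem _
  | add v v' _ _ hv hv' => rw [add_lie]; exact add_mem hv hv'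
  | smul a v _ hv => rw [smul_lie]; exact Submodule.smul_mem _ _ hv
  | mem v hv =>
    obtain ⟨i, x, hi, rfl⟩ := hv
    induction hw using Submodule.span_induction with
    | zero => rw [lie_zero]; exact zero_mem _
    | add w w' _ _ hw hw' => rw [lie_add]; exact add_mem hw hw'
    | smul a w _ hw => rw [lie_smul]; exact Submodule.smul_mem _ _ hw
    | mem w hw =>
      obtain ⟨j, y, hj, rfl⟩ := hw
      rw [lie_mon]
      exact mon_mem_ordGE (by omega) _

theorem coeff_eq_zero_of_mem_ordGE {i n : ℕ} (h : i < n) {v : Loop p L} (hv : v ∈ ordGE n) :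
    coeff i v = 0 := by
  induction hv using Submodule.span_induction with
  | zero => rw [map_zero]
  | add v w _ _ hv hw => rw [map_add, hv, hw, add_zero]
  | smul a v _ hv => rw [map_smul, hv, smul_zero]
  | mem v hv =>
    obtain ⟨j, x, hj, rfl⟩ := hv
    rw [coeff_mon, if_neg (by omega)]

theorem eq_zero_of_coeff {v : Loop p L} (h : ∀ i, coeff i v = 0) : v = 0 := by
  have key : ∃ d, ∀ e, d ≤ e → v = ∑ i ∈ Finset.range e, mon i (coeff i v) := by
    clear h
    induction v using induction with
    | zero => exact ⟨0, fun e _ => by simp⟩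
    | add v w hv hw =>
      obtain ⟨d, hd⟩ := hv
      obtain ⟨d', hd'⟩ := hw
      refine ⟨max d d', fun e he => ?_⟩
      simp only [map_add, Finset.sum_add_distrib]
      rw [← hd e (by omega), ← hd' e (by omega)]
    | mon i x =>
      refine ⟨i + 1, fun e he => ?_⟩
      rw [Finset.sum_eq_single i]
      · simp [coeff_mon]
      · intro j _ hj
        rw [coeff_mon, if_neg hj, map_zero]
      · intro hi
        exact absurd (Finset.mem_range.2 he) hi
  obtain ⟨d, hd⟩ := key
  rw [hd d le_rfl]
  simp [h]

variable [RestrictedLieAlgebra p L]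

/-- The section `x t ^ i ↦ x^[p] t ^ (p i)`. -/
noncomputable def jacobsonSection : Loop p L →ₗ[ZMod p] JacobsonExt p (Loop p L) :=
  lift fun i =>
    { toFun := fun x => ⟨mon i x, mon (p * i) (pmap p x)⟩
      map_add' := fun x y => by
        ext
        · exact map_add _ x y
        · change mon (p * i) (pmap p (x + y)) = mon (p * i) (pmap p x) + mon (p * i) (pmap p y) +
            jacobsonSum p (mon i x) (mon i y)
          rw [jacobsonSum_mon, pmap_add, map_add, map_add]
          rfl
      map_smul' := fun a x => by
        rw [RingHom.id_apply, JacobsonExt.smul_eq, map_smul, smul_pmap, map_smul, ZMod.pow_card] }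

theorem jacobsonSection_mon (i : ℕ) (x : L) :
    jacobsonSection (mon i x : Loop p L) = ⟨mon i x, mon (p * i) (pmap p x)⟩ :=
  lift_mon _ i x

noncomputable instance : RestrictedLieAlgebra p (Loop p L) :=
  restrictedOfSection jacobsonSection
    (fun v => LinearMap.congr_fun (f := JacobsonExt.baseHom ∘ₗ jacobsonSection)
      (g := LinearMap.id) (hom_ext fun i x => by
        rw [LinearMap.comp_apply, jacobsonSection_mon]; rfl) v)
    (fun v => by
      induction v using induction with
      | zero => rw [map_zero]; exact zero_mem _
      | add v w hv hw => rw [map_add]; exact add_mem hv hw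
      | mon i x =>
        rw [jacobsonSection_mon]
        refine (lie_pow_iff _ _).1 fun z => ?_
        induction z using induction with
        | zero =>
          have h : ∀ n, (fun z => ⁅z, (mon i x : Loop p L)⁆)^[n] 0 = 0 := fun n =>
            Function.iterate_fixed (f := fun z => ⁅z, (mon i x : Loop p L)⁆) (zero_lie _) n
          rw [h, zero_lie]
        | add v w hv hw =>
          have h : ∀ n, (fun z => ⁅z, (mon i x : Loop p L)⁆)^[n] (v + w) =
              (fun z => ⁅z, (mon i x : Loop p L)⁆)^[n] v +
              (fun z => ⁅z, (mon i x : Loop p L)⁆)^[n] w := fun n => by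
            induction n with
            | zero => rfl
            | succ n ih => simp only [Function.iterate_succ_apply', ih, add_lie]
          rw [h, add_lie, hv, hw]
        | mon j y => rw [lie_mon_iterate, lie_mon, lie_pmap])

theorem pmap_mon (i : ℕ) (x : L) : pmap p (mon i x : Loop p L) = mon (p * i) (pmap p x) :=
  congrArg JacobsonExt.value (jacobsonSection_mon i x)

theorem eval_one_isRestrictedHom : IsRestrictedHom p (eval 1 : Loop p L →ₗ⁅ZMod p⁆ L) := by
  refine isRestrictedHom_of_span _ span_mon ?_
  rintro _ ⟨i, x, rfl⟩
  rw [pmap_mon, eval_mon, eval_mon, one_pow, one_pow, one_smul, one_smul]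

theorem pmap_mem_ordGE (n : ℕ) {v : Loop p L} (hv : v ∈ ordGE n) : pmap p v ∈ ordGE (p * n) := by
  refine pmap_mem_of_mem_span (J := ordGE) lie_mem_ordGE rfl ?_ hv
  rintro _ ⟨i, x, hi, rfl⟩
  rw [pmap_mon]
  exact mon_mem_ordGE (Nat.mul_le_mul_left p hi) _

end Loop

/-! ### The restricted enveloping algebra -/

section Envelope

variable (p : ℕ) [hp : Fact p.Prime] (N : Type*) [LieRing N] [LieAlgebra (ZMod p) N]
  [RestrictedLieAlgebra p N]

/-- The relations `x ^ p = x^[p]` in the universal enveloping algebra. -/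
inductive EnvRel : UniversalEnvelopingAlgebra (ZMod p) N →
    UniversalEnvelopingAlgebra (ZMod p) N → Prop
  | pow (x : N) : EnvRel (UniversalEnvelopingAlgebra.ι (ZMod p) x ^ p)
      (UniversalEnvelopingAlgebra.ι (ZMod p) (pmap p x))

/-- The restricted enveloping algebra of a `p`-Lie algebra. -/
def Env : Type _ := RingQuot (EnvRel p N)

noncomputable instance : Ring (Env p N) := inferInstanceAs (Ring (RingQuot (EnvRel p N)))

noncomputable instance : Algebra (ZMod p) (Env p N) :=
  inferInstanceAs (Algebra (ZMod p) (RingQuot (EnvRel p N)))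

namespace Env

/-- The canonical map from a `p`-Lie algebra to its restricted enveloping algebra. -/
noncomputable def ι : N →ₗ⁅ZMod p⁆ Env p N :=
  (RingQuot.mkAlgHom (ZMod p) (EnvRel p N)).toLieHom.comp
    (UniversalEnvelopingAlgebra.ι (ZMod p))

theorem ι_isRestrictedHom : IsRestrictedHom p (ι p N) := fun x => by
  have := RingQuot.mkAlgHom_rel (ZMod p) (EnvRel.pow (p := p) x)
  rw [map_pow] at this
  exact this.symm

variable {p N} {A : Type*} [Ring A] [Algebra (ZMod p) A]

/-- The universal property of the restricted enveloping algebra. -/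
noncomputable def lift (f : N →ₗ⁅ZMod p⁆ A) (hf : IsRestrictedHom p f) : Env p N →ₐ[ZMod p] A :=
  RingQuot.liftAlgHom (ZMod p) ⟨UniversalEnvelopingAlgebra.lift (ZMod p) f, by
    rintro _ _ ⟨x⟩
    rw [map_pow, UniversalEnvelopingAlgebra.lift_ι_apply,
      UniversalEnvelopingAlgebra.lift_ι_apply, hf]
    rfl⟩

theorem lift_ι (f : N →ₗ⁅ZMod p⁆ A) (hf : IsRestrictedHom p f) (x : N) :
    lift f hf (ι p N x) = f x := by
  have := RingQuot.liftAlgHom_mkAlgHom_apply (S := ZMod p)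
    (UniversalEnvelopingAlgebra.lift (ZMod p) f) (s := EnvRel p N) (by
    rintro _ _ ⟨x⟩
    rw [map_pow, UniversalEnvelopingAlgebra.lift_ι_apply,
      UniversalEnvelopingAlgebra.lift_ι_apply, hf]
    rfl) (UniversalEnvelopingAlgebra.ι (ZMod p) x)
  rw [UniversalEnvelopingAlgebra.lift_ι_apply] at this
  exact this

theorem algHom_ext {f g : Env p N →ₐ[ZMod p] A} (h : ∀ x, f (ι p N x) = g (ι p N x)) : f = g := by
  refine RingQuot.ringQuot_ext' (ZMod p) f g ?_
  exact UniversalEnvelopingAlgebra.hom_ext (R := ZMod p) (L := N) (LieHom.ext h)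

theorem mem_of_ι_mem (S : Subalgebra (ZMod p) (Env p N)) (h : ∀ x, ι p N x ∈ S) (r : Env p N) :
    r ∈ S := by
  let f : N →ₗ⁅ZMod p⁆ S :=
    { toFun := fun x => ⟨ι p N x, h x⟩
      map_add' := fun x y => Subtype.ext (map_add _ x y)
      map_smul' := fun a x => Subtype.ext (map_smul _ a x)
      map_lie' := fun {x y} => Subtype.ext (LieHom.map_lie (ι p N) x y) }
  have hf : IsRestrictedHom p f := fun x => Subtype.ext (ι_isRestrictedHom p N x)
  have h1 : S.val.comp (lift f hf) = AlgHom.id _ _ := algHom_ext fun x => by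
    rw [AlgHom.comp_apply, lift_ι]
    rfl
  have h2 := DFunLike.congr_fun h1 r
  rw [← show _ = r from h2]
  exact (lift f hf r).2

instance : Nontrivial (Env p N) := by
  have h : IsRestrictedHom p (0 : N →ₗ⁅ZMod p⁆ ZMod p) := fun x => by
    change (0 : ZMod p) = 0 ^ p
    rw [zero_pow hp.out.ne_zero]
  exact (lift (0 : N →ₗ⁅ZMod p⁆ ZMod p) h).toRingHom.domain_nontrivial

section Derivation

open TrivSqZeroExt

theorem snd_pow {A : Type*} [Ring A] (x : TrivSqZeroExt A A) (n : ℕ) :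
    (x ^ n).snd = ∑ i ∈ Finset.range n, x.fst ^ i * x.snd * x.fst ^ (n - 1 - i) := by
  induction n with
  | zero => simp
  | succ n ih =>
    rw [pow_succ', snd_mul, ih, Finset.sum_range_succ', fst_pow, smul_eq_mul, Finset.mul_sum]
    congr 1
    · refine Finset.sum_congr rfl fun i hi => ?_
      rw [pow_succ', show n + 1 - 1 - (i + 1) = n - 1 - i by omega]
      simp only [mul_assoc]
    · simp

/-- A derivation `δ` of a `p`-Lie algebra that is compatible with `p`-th powers extends to the
restricted enveloping algebra. -/
theorem exists_derivation (δ : N →ₗ[ZMod p] N) (hlie : ∀ x y, δ ⁅x, y⁆ = ⁅δ x, y⁆ + ⁅x, δ y⁆)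
    (hpow : ∀ x, δ (pmap p x) = (fun z => ⁅z, x⁆)^[p - 1] (δ x)) :
    ∃ D : Env p N →ₗ[ZMod p] Env p N, (∀ r s, D (r * s) = D r * s + r * D s) ∧
      ∀ x, D (ι p N x) = ι p N (δ x) := by
  let f : N →ₗ⁅ZMod p⁆ TrivSqZeroExt (Env p N) (Env p N) :=
    { toFun := fun x => inl (ι p N x) + inr (ι p N (δ x))
      map_add' := fun x y => by
        ext <;> simp
      map_smul' := fun a x => by
        ext <;> simp
      map_lie' := fun {x y} => by
        ext
        · simp [Ring.lie_def]
        · simp [Ring.lie_def, hlie]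
          abel }
  have hf : IsRestrictedHom p f := fun x => by
    change inl (ι p N (pmap p x)) + inr (ι p N (δ (pmap p x))) =
      (inl (ι p N x) + inr (ι p N (δ x))) ^ p
    ext
    · simp only [fst_add, fst_inl, fst_inr, add_zero, fst_pow]
      exact ι_isRestrictedHom p N x
    · rw [snd_pow]
      simp only [fst_add, fst_inl, fst_inr, add_zero, snd_add, snd_inl, snd_inr, zero_add]
      rw [sum_pow_mul_pow, hpow]
      generalize p - 1 = n
      generalize δ x = y
      induction n with
      | zero => rfl
      | succ n ih =>
        rw [Function.iterate_succ_apply', Function.iterate_succ_apply', LieHom.map_lie, ih]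
  have hfst : ∀ r, (lift f hf r).fst = r := by
    intro r
    have h1 : (fstHom (ZMod p) (Env p N) (Env p N)).comp (lift f hf) = AlgHom.id _ _ :=
      algHom_ext fun x => by
        rw [AlgHom.comp_apply, lift_ι]
        simp [f]
    exact DFunLike.congr_fun h1 r
  refine ⟨{ toFun := fun r => (lift f hf r).snd
            map_add' := fun r s => by simp
            map_smul' := fun a r => by simp }, fun r s => ?_, fun x => ?_⟩
  · change (lift f hf (r * s)).snd = (lift f hf r).snd * s + r * (lift f hf s).snd
    rw [map_mul, snd_mul, hfst, hfst, smul_eq_mul, op_smul_eq_mul, add_comm]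
  · change (lift f hf (ι p N x)).snd = _
    rw [lift_ι]
    simp [f]

end Derivation

end Env

end Envelope

/-! ### The Poincaré–Birkhoff–Witt theorem for finite nilpotent `p`-Lie algebras -/

section CyclicExtension

variable {p : ℕ} [hp : Fact p.Prime] {U : Type*} [Ring U] [Algebra (ZMod p) U]

/-- The space of sequences in `U` with `f (n + p) = f n * c`. It is a free left module of rank `p`
over `U`, and the shift is a `p`-th root of right multiplication by `c`. -/
def twistedSeq (p : ℕ) [Fact p.Prime] {U : Type*} [Ring U] [Algebra (ZMod p) U] (c : U) :
    Submodule (ZMod p) (ℕ → U) where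
  carrier := {f | ∀ n, f (n + p) = f n * c}
  zero_mem' n := (zero_mul c).symm
  add_mem' {f g} hf hg n := by
    change f (n + p) + g (n + p) = (f n + g n) * c
    rw [hf, hg, add_mul]
  smul_mem' a f hf n := by
    change a • f (n + p) = (a • f n) * c
    rw [hf, smul_mul_assoc]

namespace twistedSeq

variable {c : U}

/-- Left multiplication. -/
def leftMul (c : U) : U →ₐ[ZMod p] Module.End (ZMod p) (twistedSeq p c) where
  toFun r :=
    { toFun := fun f => ⟨fun n => r * f.1 n, fun n => by
        change r * f.1 (n + p) = r * f.1 n * c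
        rw [f.2 n, mul_assoc]⟩
      map_add' := fun f g => Subtype.ext (funext fun n => mul_add _ _ _)
      map_smul' := fun a f => Subtype.ext (funext fun n => mul_smul_comm _ _ _) }
  map_one' := LinearMap.ext fun f => Subtype.ext (funext fun n => one_mul _)
  map_mul' r s := LinearMap.ext fun f => Subtype.ext (funext fun n => mul_assoc _ _ _)
  map_zero' := LinearMap.ext fun f => Subtype.ext (funext fun n => zero_mul _)
  map_add' r s := LinearMap.ext fun f => Subtype.ext (funext fun n => add_mul _ _ _)
  commutes' a := LinearMap.ext fun f => Subtype.ext (funext fun n => (Algebra.smul_def _ _).symm)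

/-- The shift. -/
def shift (c : U) : Module.End (ZMod p) (twistedSeq p c) where
  toFun f := ⟨fun n => f.1 (n + 1), fun n => by rw [← f.2, add_right_comm]⟩
  map_add' _ _ := rfl
  map_smul' _ _ := rfl

/-- The entrywise action of a derivation killing `c`. -/
def entrywise (D : U →ₗ[ZMod p] U) (hD : ∀ r s, D (r * s) = D r * s + r * D s) (hc : D c = 0) :
    Module.End (ZMod p) (twistedSeq p c) where
  toFun f := ⟨fun n => D (f.1 n), fun n => by
    change D (f.1 (n + p)) = D (f.1 n) * c
    rw [f.2, hD, hc, mul_zero, add_zero]⟩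
  map_add' f g := Subtype.ext (funext fun n => map_add D _ _)
  map_smul' a f := Subtype.ext (funext fun n => map_smul D _ _)

variable {D : U →ₗ[ZMod p] U} (hD : ∀ r s, D (r * s) = D r * s + r * D s) (hc : D c = 0)

theorem shift_pow (k : ℕ) (f : twistedSeq p c) (n : ℕ) :
    ((shift c ^ k) f).1 n = f.1 (n + k) := by
  induction k generalizing n with
  | zero => rfl
  | succ k ih =>
    rw [pow_succ', Module.End.mul_apply]
    change ((shift c ^ k) f).1 (n + 1) = _
    rw [ih, add_assoc, add_comm 1 k]

theorem entrywise_pow (k : ℕ) (f : twistedSeq p c) (n : ℕ) :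
    ((entrywise D hD hc ^ k) f).1 n = (D ^ k) (f.1 n) := by
  induction k with
  | zero => rfl
  | succ k ih =>
    rw [pow_succ', Module.End.mul_apply, pow_succ', Module.End.mul_apply, ← ih]
    rfl

/-- The operator adjoining to `U` an element whose commutator is `D` and whose `p`-th power is
`c`. -/
def adjoin (D : U →ₗ[ZMod p] U) (hD : ∀ r s, D (r * s) = D r * s + r * D s) (hc : D c = 0) :
    Module.End (ZMod p) (twistedSeq p c) := shift c + entrywise D hD hc

theorem adjoin_lie (r : U) :
    ⁅adjoin (p := p) D hD hc, leftMul (p := p) c r⁆ = leftMul (p := p) c (D r) := by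
  refine LinearMap.ext fun f => Subtype.ext (funext fun n => ?_)
  change r * f.1 (n + 1) + D (r * f.1 n) - r * (f.1 (n + 1) + D (f.1 n)) = D r * f.1 n
  rw [hD, mul_add]
  abel

theorem leftMul_add_smul_adjoin_apply (r : U) (a : ZMod p) (f : twistedSeq p c) (n : ℕ) :
    ((leftMul (p := p) c r + a • adjoin (p := p) D hD hc) f).1 n =
      r * f.1 n + a • (f.1 (n + 1) + D (f.1 n)) := rfl

theorem adjoin_pow (hDp : ∀ r, (D ^ p) r = c * r - r * c) :
    adjoin D hD hc ^ p = leftMul c c := by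
  have hcomm : Commute (shift (p := p) c) (entrywise D hD hc) := LinearMap.ext fun f => rfl
  rw [adjoin, add_pow_prime_of_commute hcomm]
  refine LinearMap.ext fun f => Subtype.ext (funext fun n => ?_)
  change ((shift c ^ p) f).1 n + ((entrywise D hD hc ^ p) f).1 n = c * f.1 n
  rw [shift_pow, entrywise_pow, hDp, f.2]
  abel

/-- The sequence spanning, as a left module, the degree-one part. -/
def unitOne (c : U) : twistedSeq p c :=
  ⟨fun n => if n % p = 1 then c ^ (n / p) else 0, fun n => by
    simp only [Nat.add_mod_right, Nat.add_div_right n hp.out.pos]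
    split_ifs
    · rw [pow_succ]
    · rw [zero_mul]⟩

theorem unitOne_zero : (unitOne (p := p) c).1 0 = 0 := by simp [unitOne]

theorem unitOne_one : (unitOne (p := p) c).1 1 = 1 := by
  simp [unitOne, Nat.mod_eq_of_lt hp.out.one_lt, Nat.div_eq_of_lt hp.out.one_lt]

end twistedSeq

/-- The `p`-th power of a derivation in characteristic `p` is a derivation. -/
theorem derivation_pow_prime {D : U →ₗ[ZMod p] U} (hD : ∀ r s, D (r * s) = D r * s + r * D s)
    (r s : U) : (D ^ p) (r * s) = (D ^ p) r * s + r * (D ^ p) s := by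
  have h1 : LieAlgebra.ad (ZMod p) (Module.End (ZMod p) U) (D ^ p) =
      LieAlgebra.ad (ZMod p) (Module.End (ZMod p) U) D ^ p :=
    (lie_pow_iff (p := p) D (D ^ p)).1 fun x => lie_pmap (p := p) x D
  have h2 : ∀ n : ℕ, (LieAlgebra.ad (ZMod p) (Module.End (ZMod p) U) D ^ n)
      (LinearMap.mulLeft (ZMod p) r) = LinearMap.mulLeft (ZMod p) ((D ^ n) r) := fun n => by
    induction n with
    | zero => rfl
    | succ n ih =>
      rw [pow_succ', Module.End.mul_apply, ih, pow_succ', Module.End.mul_apply]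
      refine LinearMap.ext fun s => ?_
      change D ((D ^ n) r * s) - (D ^ n) r * D s = D ((D ^ n) r) * s
      rw [hD, add_sub_cancel_right]
  have h3 := LinearMap.congr_fun (h2 p) s
  rw [← h1] at h3
  change (D ^ p) (r * s) - r * (D ^ p) s = (D ^ p) r * s at h3
  rw [← h3, sub_add_cancel]

end CyclicExtension

section PBW

variable {p : ℕ} [hp : Fact p.Prime] {N : Type*} [LieRing N] [LieAlgebra (ZMod p) N]
  [RestrictedLieAlgebra p N]

/-- A Lie subalgebra closed under the `p`-power operation is a `p`-Lie algebra. -/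
@[reducible]
def restrictedSubalgebra (I : LieSubalgebra (ZMod p) N) (hI : ∀ x ∈ I, pmap p x ∈ I) :
    RestrictedLieAlgebra p I where
  pmap x := ⟨pmap p x.1, hI x.1 x.2⟩
  lie_pmap x y := by
    have h : ∀ n : ℕ, ((fun z => ⁅z, y⁆)^[n] x).1 = (fun z => ⁅z, y.1⁆)^[n] x.1 := fun n => by
      induction n with
      | zero => rfl
      | succ n ih => rw [Function.iterate_succ_apply', Function.iterate_succ_apply', ← ih]; rfl
    refine Subtype.ext ?_
    rw [h]
    exact lie_pmap x.1 y.1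
  smul_pmap a x := Subtype.ext (smul_pmap a x.1)
  pmap_add x y := by
    refine Subtype.ext ?_
    have h := map_jacobsonSum (p := p) I.incl x y
    change pmap p (x.1 + y.1) = pmap p x.1 + pmap p y.1 + I.incl (jacobsonSum p x y)
    rw [h, pmap_add]
    rfl

/-- The kernel of a linear functional vanishing on all brackets. -/
def kerSubalgebra (χ : N →ₗ[ZMod p] ZMod p) (hlie : ∀ x y : N, χ ⁅x, y⁆ = 0) :
    LieSubalgebra (ZMod p) N :=
  { LinearMap.ker χ with lie_mem' := fun {x y} _ _ => hlie x y }

set_option maxHeartbeats 1000000 in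
/-- The inductive step of the Poincaré–Birkhoff–Witt theorem, for an ideal `I = ker χ` and a
complementary element `x`. The derivation `[x, ·]` of `I` extends to the restricted enveloping
algebra of `I`, and its `p`-th power is the inner derivation by `c = x^[p] ∈ I`. Hence `N` acts on
the sequences `twistedSeq`, with `x` acting by `twistedSeq.adjoin`, and this action is faithful. -/
theorem ι_injective_of_ker (χ : N →ₗ[ZMod p] ZMod p) (hlie : ∀ x y : N, χ ⁅x, y⁆ = 0)
    (hpow : ∀ x, χ (pmap p x) = 0) {x : N} (hx : χ x = 1)
    {I : LieSubalgebra (ZMod p) N} (hI : ∀ y, y ∈ I ↔ χ y = 0) [RestrictedLieAlgebra p I]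
    (hres : ∀ y : I, (pmap p y : I).1 = pmap p y.1) (hinj : Function.Injective (Env.ι p I)) :
    Function.Injective (Env.ι p N) := by
  let δ : I →ₗ[ZMod p] I :=
    { toFun := fun y => ⟨⁅x, y.1⁆, (hI _).2 (hlie x y.1)⟩
      map_add' := fun y z => Subtype.ext (lie_add x y.1 z.1)
      map_smul' := fun a y => Subtype.ext (lie_smul a x y.1) }
  let c : I := ⟨pmap p x, (hI _).2 (hpow x)⟩
  have hiter : ∀ (n : ℕ) (y z : I), ((fun w => ⁅w, y⁆)^[n] z).1 = (fun w => ⁅w, y.1⁆)^[n] z.1 :=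
    fun n y z => by
      induction n with
      | zero => rfl
      | succ n ih => rw [Function.iterate_succ_apply', Function.iterate_succ_apply', ← ih]; rfl
  obtain ⟨D, hD, hDι⟩ := Env.exists_derivation (p := p) δ
    (fun y z => Subtype.ext (leibniz_lie x y.1 z.1)) (fun y => Subtype.ext (by
      rw [hiter]
      change ⁅x, (pmap p y : I).1⁆ = (fun w => ⁅w, y.1⁆)^[p - 1] ⁅x, y.1⁆
      rw [hres, lie_pmap, ← Function.iterate_succ_apply (fun w => ⁅w, y.1⁆), Nat.succ_eq_add_one,
        Nat.sub_add_cancel hp.out.one_le]))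
  have hadx : LieAlgebra.ad (ZMod p) N (pmap p x) = LieAlgebra.ad (ZMod p) N x ^ p :=
    (lie_pow_iff x _).1 fun y => lie_pmap y x
  have hδ : ∀ (n : ℕ) (y : I), ((δ ^ n) y).1 = (LieAlgebra.ad (ZMod p) N x ^ n) y.1 := fun n y => by
    induction n with
    | zero => rfl
    | succ n ih => rw [pow_succ', pow_succ', Module.End.mul_apply, Module.End.mul_apply, ← ih]; rfl
  have hδp : ∀ y, (δ ^ p) y = ⁅c, y⁆ := fun y => Subtype.ext (by
    rw [hδ, ← hadx]; rfl)
  have hδc : δ c = 0 := Subtype.ext (by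
    change ⁅x, pmap p x⁆ = 0
    rw [lie_pmap, ← Nat.sub_add_cancel hp.out.one_le, Function.iterate_succ_apply, lie_self]
    exact Function.iterate_fixed (f := fun z => ⁅z, x⁆) (zero_lie x) _)
  have hc : D (Env.ι p I c) = 0 := by rw [hDι, hδc, map_zero]
  have hD1 : D 1 = 0 := by
    have := hD 1 1
    rwa [mul_one, one_mul, mul_one, left_eq_add] at this
  have hDp1 : (D ^ p) 1 = 0 := by
    have h : ∀ n : ℕ, (D ^ (n + 1)) 1 = 0 := fun n => by
      rw [pow_succ, Module.End.mul_apply, hD1, map_zero]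
    have hp1 := h (p - 1)
    rwa [Nat.sub_add_cancel hp.out.one_le] at hp1
  have hDn : ∀ (n : ℕ) (y : I), (D ^ n) (Env.ι p I y) = Env.ι p I ((δ ^ n) y) := fun n y => by
    induction n with
    | zero => rfl
    | succ n ih => rw [pow_succ', pow_succ', Module.End.mul_apply, Module.End.mul_apply, ih, hDι]
  have hDp : ∀ r, (D ^ p) r = Env.ι p I c * r - r * Env.ι p I c := by
    let S : Subalgebra (ZMod p) (Env p I) :=
      { carrier := {r | (D ^ p) r = Env.ι p I c * r - r * Env.ι p I c}
        mul_mem' := fun {r s} hr hs => by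
          rw [Set.mem_ofPred_eq] at hr hs ⊢
          rw [derivation_pow_prime hD, hr, hs, sub_mul, mul_sub]
          simp only [mul_assoc]
          abel
        add_mem' := fun {r s} hr hs => by
          rw [Set.mem_ofPred_eq] at hr hs ⊢
          rw [map_add, hr, hs, mul_add, add_mul]
          abel
        algebraMap_mem' := fun a => by
          rw [Set.mem_ofPred_eq, Algebra.algebraMap_eq_smul_one, map_smul, hDp1]
          simp }
    intro r
    exact Env.mem_of_ι_mem S (fun y => by
      change (D ^ p) _ = _
      rw [hDn, hδp, LieHom.map_lie]
      rfl) r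
  -- the representation of `N` on sequences
  let X := twistedSeq.adjoin (p := p) D hD hc
  let Λ := twistedSeq.leftMul (p := p) (Env.ι p I c)
  have hX : ∀ r, ⁅X, Λ r⁆ = Λ (D r) := twistedSeq.adjoin_lie hD hc
  have hXp : X ^ p = Λ (Env.ι p I c) := twistedSeq.adjoin_pow hD hc hDp
  let π : N →ₗ[ZMod p] I :=
    { toFun := fun y => ⟨y - χ y • x, by
        rw [hI, map_sub, map_smul, hx, smul_eq_mul, mul_one, sub_self]⟩
      map_add' := fun y z => Subtype.ext (by
        change y + z - χ (y + z) • x = y - χ y • x + (z - χ z • x)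
        rw [map_add, add_smul]
        abel)
      map_smul' := fun a y => Subtype.ext (by
        change a • y - χ (a • y) • x = a • (y - χ y • x)
        rw [map_smul, smul_sub, smul_smul, smul_eq_mul]) }
  have hπ : ∀ y, (π y).1 + χ y • x = y := fun y => sub_add_cancel _ _
  have hπI : ∀ y : I, π y.1 = y := fun y => Subtype.ext (by
    change y.1 - χ y.1 • x = y.1
    rw [(hI _).1 y.2, zero_smul, sub_zero])
  let ρ : N →ₗ⁅ZMod p⁆ Module.End (ZMod p) (twistedSeq p (Env.ι p I c)) :=
    { toFun := fun y => Λ (Env.ι p I (π y)) + χ y • X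
      map_add' := fun y z => by
        simp only [map_add, add_smul]
        abel
      map_smul' := fun a y => by
        simp only [map_smul, smul_add, smul_smul, smul_eq_mul, RingHom.id_apply]
      map_lie' := fun {y z} => by
        have h1 : π ⁅y, z⁆ = ⁅π y, π z⁆ + χ y • δ (π z) - χ z • δ (π y) := Subtype.ext (by
          change ⁅y, z⁆ - χ ⁅y, z⁆ • x =
            ⁅(π y).1, (π z).1⁆ + χ y • ⁅x, (π z).1⁆ - χ z • ⁅x, (π y).1⁆
          rw [hlie, zero_smul, sub_zero]
          conv_lhs => rw [← hπ y, ← hπ z]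
          simp only [lie_add, add_lie, lie_smul, smul_lie, lie_self, smul_zero, add_zero]
          rw [← lie_skew x (π y).1, smul_neg]
          abel)
        have h2 : ⁅Λ (Env.ι p I (π y)), X⁆ = -Λ (D (Env.ι p I (π y))) := by
          rw [← hX, lie_skew]
        have h3 : Λ ⁅Env.ι p I (π y), Env.ι p I (π z)⁆ =
            ⁅Λ (Env.ι p I (π y)), Λ (Env.ι p I (π z))⁆ := by
          rw [Ring.lie_def, Ring.lie_def, map_sub, map_mul, map_mul]
        simp only [hlie, zero_smul, add_zero, h1, map_add, map_sub, map_smul, LieHom.map_lie,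
          ← hDι, h3, lie_add, add_lie, lie_smul, smul_lie, lie_self, smul_zero, h2, hX]
        rw [smul_neg]
        abel }
  have hρI : ∀ y : I, ρ y.1 = Λ (Env.ι p I y) := fun y => by
    change Λ (Env.ι p I (π y.1)) + χ y.1 • X = _
    rw [hπI, (hI _).1 y.2, zero_smul, add_zero]
  have hρx : ρ x = X := by
    change Λ (Env.ι p I (π x)) + χ x • X = _
    have : π x = 0 := Subtype.ext (by
      change x - χ x • x = 0
      rw [hx, one_smul, sub_self])
    rw [this, hx, one_smul, map_zero, map_zero, zero_add]
  have hρ : IsRestrictedHom p ρ := by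
    refine isRestrictedHom_of_span ρ (S := insert x (I : Set N)) ?_ ?_
    · refine eq_top_iff.2 fun y _ => ?_
      rw [← hπ y]
      exact add_mem (Submodule.subset_span (Or.inr (π y).2))
        (Submodule.smul_mem _ _ (Submodule.subset_span (Or.inl rfl)))
    · rintro y (rfl | hy)
      · have := hρI c
        change ρ (pmap p y) = ρ y ^ p
        rw [hρx, hXp]
        exact this
      · lift y to I using hy
        rw [← hres, hρI, hρI, Env.ι_isRestrictedHom]
        exact map_pow Λ _ _
  rw [injective_iff_map_eq_zero]
  intro y hy
  have h0 : ρ y = 0 := by rw [← Env.lift_ι ρ hρ, hy, map_zero]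
  -- the action on `unitOne` determines `χ y` and `π y`, by its entries `0` and `1`
  have hval : ∀ n, Env.ι p I (π y) * (twistedSeq.unitOne (p := p) (Env.ι p I c)).1 n +
      χ y • ((twistedSeq.unitOne (p := p) (Env.ι p I c)).1 (n + 1) +
        D ((twistedSeq.unitOne (p := p) (Env.ι p I c)).1 n)) = 0 := fun n => by
    rw [← twistedSeq.leftMul_add_smul_adjoin_apply hD hc]
    change ((ρ y) _).1 n = 0
    rw [h0]
    rfl
  have hχ : χ y = 0 := by
    have := hval 0
    rw [twistedSeq.unitOne_zero, map_zero, mul_zero, zero_add, add_zero, zero_add,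
      twistedSeq.unitOne_one] at this
    exact (smul_eq_zero.1 this).resolve_right one_ne_zero
  have hπ0 : π y = 0 := by
    have := hval 1
    rw [hχ, zero_smul, add_zero, twistedSeq.unitOne_one, mul_one] at this
    exact (injective_iff_map_eq_zero _).1 hinj _ this
  rw [← hπ y, hπ0, hχ, zero_smul, add_zero]
  rfl

/-- The Poincaré–Birkhoff–Witt theorem for finite `p`-Lie algebras with a finite filtration of
positive degree. If `J w` is the last term that is the whole algebra, brackets and `p`-th powers
lie in `J (w + 1)`, and a functional vanishing there splits off one generator. -/
theorem ι_injective_of_filtration {n : ℕ} : ∀ {N : Type w} [LieRing N] [LieAlgebra (ZMod p) N]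
    [RestrictedLieAlgebra p N] [Finite N] (J : ℕ → Submodule (ZMod p) N), J 1 = ⊤ → Antitone J →
    (∀ a b, ∀ x ∈ J a, ∀ y ∈ J b, ⁅x, y⁆ ∈ J (a + b)) →
    (∀ a, ∀ x ∈ J a, pmap p x ∈ J (p * a)) → (∃ k, J k = ⊥) → Nat.card N = n →
    Function.Injective (Env.ι p N) := by
  induction n using Nat.strong_induction_on with
  | _ n ih =>
    intro N _ _ _ _ J h1 hanti hlie hpow hbot hcard
    rcases subsingleton_or_nontrivial N with hN | hN
    · exact Function.injective_of_subsingleton _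
    obtain ⟨k, hk⟩ := hbot
    have hex : ∃ k, J k ≠ ⊤ := ⟨k, by rw [hk]; exact bot_ne_top⟩
    classical
    obtain ⟨w, hw, hw1, hwtop⟩ : ∃ w, J (w + 1) ≠ ⊤ ∧ 1 ≤ w ∧ J w = ⊤ := by
      have h2 : 2 ≤ Nat.find hex := by
        by_contra hlt
        exact Nat.find_spec hex (eq_top_iff.2 (h1.symm.le.trans (hanti (by omega))))
      refine ⟨Nat.find hex - 1, ?_, by omega, ?_⟩
      · rw [Nat.sub_add_cancel (by omega)]
        exact Nat.find_spec hex
      · by_contra h3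
        exact Nat.find_min hex (m := Nat.find hex - 1) (by omega) h3
    obtain ⟨χ, hχ, hle⟩ := Submodule.exists_le_ker_of_lt_top _ (lt_top_iff_ne_top.2 hw)
    have hχlie : ∀ x y, χ ⁅x, y⁆ = 0 := fun x y =>
      hle (hanti (by omega : w + 1 ≤ w + w) (hlie w w x (hwtop ▸ trivial) y (hwtop ▸ trivial)))
    have hχpow : ∀ x, χ (pmap p x) = 0 := fun x =>
      hle (hanti (by have := hp.out.two_le; nlinarith : w + 1 ≤ p * w)
        (hpow w x (hwtop ▸ trivial)))
    obtain ⟨x, hx⟩ : ∃ x, χ x = 1 := by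
      obtain ⟨y, hy⟩ := DFunLike.ne_iff.1 hχ
      refine ⟨(χ y)⁻¹ • y, ?_⟩
      rw [map_smul, smul_eq_mul, inv_mul_cancel₀ hy]
    let inst := restrictedSubalgebra (p := p) (kerSubalgebra χ hχlie) fun y _ => hχpow y
    refine ι_injective_of_ker χ hχlie hχpow hx (I := kerSubalgebra χ hχlie) (fun _ => Iff.rfl)
      (fun y => rfl) ?_
    refine ih (Nat.card (kerSubalgebra χ hχlie)) ?_
      (fun k => (J k).comap (kerSubalgebra χ hχlie).incl.toLinearMap) ?_ ?_ ?_ ?_ ⟨k, ?_⟩ rfl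
    · rw [← hcard]
      refine Finite.card_subtype_lt (x := x) ?_
      change ¬ χ x = 0
      rw [hx]
      exact one_ne_zero
    · rw [h1]; rfl
    · exact fun a b hab => Submodule.comap_mono (hanti hab)
    · exact fun a b x hx y hy => hlie a b x.1 hx y.1 hy
    · exact fun a x hx => hpow a x.1 hx
    · rw [hk, eq_bot_iff]
      exact fun y hy => Subtype.ext hy

end PBW

/-! ### Residually finite filtrations -/

section Filtration

variable {p : ℕ}

theorem restrictedSpan_coe {L : Type*} [LieRing L] [LieAlgebra (ZMod p) L]
    [RestrictedLieAlgebra p L] (I : LieIdeal (ZMod p) L) (hI : ∀ x ∈ I, pmap p x ∈ I) :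
    restrictedSpan p (I : Set L) = I :=
  le_antisymm (fun _ hy => (mem_restrictedSpan p).1 hy I (fun _ h => h) hI)
    fun _ hy => subset_restrictedSpan p _ hy

variable [hp : Fact p.Prime]

/-- The Poincaré–Birkhoff–Witt theorem for `p`-Lie algebras with a separated filtration by ideals
of finite index, by reduction to the finite quotients. -/
theorem ι_injective_of_separated {L : Type*} [LieRing L] [LieAlgebra (ZMod p) L]
    [RestrictedLieAlgebra p L] (J : ℕ → Submodule (ZMod p) L) (h1 : J 1 = ⊤) (hanti : Antitone J)
    (hlie : ∀ a b, ∀ x ∈ J a, ∀ y ∈ J b, ⁅x, y⁆ ∈ J (a + b))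
    (hpow : ∀ a, ∀ x ∈ J a, pmap p x ∈ J (p * a)) (hfin : ∀ n, Finite (L ⧸ J n))
    (hsep : ∀ x, (∀ n, x ∈ J n) → x = 0) : Function.Injective (Env.ι p L) := by
  rw [injective_iff_map_eq_zero]
  refine fun x hx => hsep x fun n => ?_
  let I : LieIdeal (ZMod p) L :=
    { J n with
      lie_mem := fun {y z} hz =>
        hanti (Nat.le_add_left n 1) (hlie 1 n y (h1 ▸ Submodule.mem_top) z hz) }
  have hI : restrictedSpan p (J n : Set L) = I := restrictedSpan_coe I fun z hz =>
    hanti (Nat.le_mul_of_pos_left n hp.out.pos) (hpow n z hz)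
  have hmem : ∀ y, quotientMk p (J n : Set L) y = 0 ↔ y ∈ J n := fun y => by
    rw [quotientMk_eq_zero, hI]
    rfl
  have hsurj : Function.Surjective (quotientMk p (J n : Set L)) := Quotient.mk_surjective
  have hfinite : Finite (QuotientBy p (J n : Set L)) := by
    have := hfin n
    refine Finite.of_surjective (α := L ⧸ J n) ((J n).liftQ
      (quotientMk p (J n : Set L) : L →ₗ[ZMod p] QuotientBy p (J n : Set L))
      fun y hy => LinearMap.mem_ker.2 ((hmem y).2 hy)) ?_
    intro y
    obtain ⟨z, rfl⟩ := hsurj y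
    exact ⟨Submodule.Quotient.mk z, rfl⟩
  have hinj := ι_injective_of_filtration (p := p) (N := QuotientBy p (J n : Set L))
    (fun k => (J k).map (quotientMk p (J n : Set L) : L →ₗ[ZMod p] QuotientBy p (J n : Set L)))
    (by
      rw [h1, Submodule.map_top, LinearMap.range_eq_top]
      exact hsurj)
    (fun a b hab => Submodule.map_mono (hanti hab))
    (by
      rintro a b _ ⟨y, hy, rfl⟩ _ ⟨z, hz, rfl⟩
      exact ⟨⁅y, z⁆, hlie a b y hy z hz, LieHom.map_lie (quotientMk p (J n : Set L)) y z⟩)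
    (by
      rintro a _ ⟨y, hy, rfl⟩
      exact ⟨pmap p y, hpow a y hy, rfl⟩)
    ⟨n, by
      rw [eq_bot_iff]
      rintro _ ⟨y, hy, rfl⟩
      exact (hmem y).2 hy⟩ rfl
  have hg : IsRestrictedHom p ((Env.ι p (QuotientBy p (J n : Set L))).comp
      (quotientMk p (J n : Set L))) := fun y =>
    Env.ι_isRestrictedHom p _ (quotientMk p (J n : Set L) y)
  have h2 : Env.ι p (QuotientBy p (J n : Set L)) (quotientMk p (J n : Set L) x) = 0 := by
    have := Env.lift_ι _ hg x
    rw [hx, map_zero] at this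
    exact this.symm
  exact (hmem x).1 ((injective_iff_map_eq_zero _).1 hinj _ h2)

/-- The values in a `p`-Lie algebra of the formal Lie monomials with `p`-th powers in the elements
`v i`, graded by their degree. -/
inductive IsMonomial {X L : Type*} [LieRing L] [LieAlgebra (ZMod p) L] [RestrictedLieAlgebra p L]
    (v : X → L) : ℕ → L → Prop
  | of (i : X) : IsMonomial v 1 (v i)
  | lie {a b : ℕ} {x y : L} : IsMonomial v a x → IsMonomial v b y → IsMonomial v (a + b) ⁅x, y⁆
  | pow {a : ℕ} {x : L} : IsMonomial v a x → IsMonomial v (p * a) (pmap p x)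

namespace IsMonomial

variable {X L : Type*} [LieRing L] [LieAlgebra (ZMod p) L] [RestrictedLieAlgebra p L] {v : X → L}

theorem pos {k : ℕ} {x : L} (h : IsMonomial (p := p) v k x) : 0 < k := by
  induction h with
  | of i => exact one_pos
  | lie _ _ ha _ => exact Nat.add_pos_left ha _
  | pow _ ha => exact Nat.mul_pos hp.out.pos ha

theorem finite [Finite X] (v : X → L) (k : ℕ) : {x | IsMonomial (p := p) v k x}.Finite := by
  induction k using Nat.strong_induction_on with
  | _ k ih =>
    have h1 : (⋃ a ∈ Set.Iio k, ⋃ b ∈ Set.Iio k, Set.image2 (fun x y : L => ⁅x, y⁆)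
        {x | IsMonomial (p := p) v a x} {x | IsMonomial (p := p) v b x}).Finite :=
      (Set.finite_Iio k).biUnion fun a ha => (Set.finite_Iio k).biUnion fun b hb =>
        (ih a ha).image2 _ (ih b hb)
    have h2 : (⋃ a ∈ Set.Iio k, pmap p '' {x | IsMonomial (p := p) v a x}).Finite :=
      (Set.finite_Iio k).biUnion fun a ha => (ih a ha).image _
    refine (((Set.finite_range v).union h1).union h2).subset ?_
    intro x hx
    rw [Set.mem_ofPred_eq] at hx
    cases hx with
    | of i => exact Or.inl (Or.inl ⟨i, rfl⟩)
    | @lie a b x y hx hy =>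
      refine Or.inl (Or.inr (Set.mem_biUnion (x := a) ?_ (Set.mem_biUnion (x := b) ?_
        ⟨x, hx, y, hy, rfl⟩)))
      · exact Nat.lt_add_of_pos_right hy.pos
      · exact Nat.lt_add_of_pos_left hx.pos
    | @pow a x hx =>
      refine Or.inr (Set.mem_biUnion (x := a) ?_ ⟨x, hx, rfl⟩)
      exact lt_mul_of_one_lt_left hx.pos hp.out.one_lt

theorem mem_filtration {J : ℕ → Submodule (ZMod p) L} (h1 : ∀ i, v i ∈ J 1)
    (hlie : ∀ a b, ∀ x ∈ J a, ∀ y ∈ J b, ⁅x, y⁆ ∈ J (a + b))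
    (hpow : ∀ a, ∀ x ∈ J a, pmap p x ∈ J (p * a)) {k : ℕ} {x : L}
    (h : IsMonomial (p := p) v k x) : x ∈ J k := by
  induction h with
  | of i => exact h1 i
  | lie _ _ hx hy => exact hlie _ _ _ hx _ hy
  | pow _ hx => exact hpow _ _ hx

theorem span_eq_top {S : Set (FreeRestricted p X)} : Submodule.span (ZMod p)
    {x : QuotientBy p S | ∃ k, IsMonomial (p := p)
      (fun i => quotientMk p S (FreeRestricted.of p i)) k x} = ⊤ := by
  set M := {x : QuotientBy p S | ∃ k, IsMonomial (p := p)
      (fun i => quotientMk p S (FreeRestricted.of p i)) k x} with hM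
  have hlie : ∀ x ∈ Submodule.span (ZMod p) M, ∀ y ∈ Submodule.span (ZMod p) M,
      ⁅x, y⁆ ∈ Submodule.span (ZMod p) M := by
    intro x hx y hy
    induction hx using Submodule.span_induction with
    | zero => rw [zero_lie]; exact zero_mem _
    | add x x' _ _ hx hx' => rw [add_lie]; exact add_mem hx hx'
    | smul a x _ hx => rw [smul_lie]; exact Submodule.smul_mem _ _ hx
    | mem x hx =>
      obtain ⟨k, hx⟩ := hx
      induction hy using Submodule.span_induction with
      | zero => rw [lie_zero]; exact zero_mem _
      | add y y' _ _ hy hy' => rw [lie_add]; exact add_mem hy hy'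
      | smul a y _ hy => rw [lie_smul]; exact Submodule.smul_mem _ _ hy
      | mem y hy =>
        obtain ⟨l, hy⟩ := hy
        exact Submodule.subset_span ⟨k + l, hx.lie hy⟩
  refine eq_top_iff.2 fun x _ => ?_
  induction x using quotient_free_induction with
  | of i => exact Submodule.subset_span ⟨1, .of i⟩
  | zero => exact zero_mem _
  | add x y hx hy => exact add_mem (hx trivial) (hy trivial)
  | smul a x hx => exact Submodule.smul_mem _ _ (hx trivial)
  | lie x y hx hy => exact hlie x (hx trivial) y (hy trivial)
  | pow x hx =>
    refine pmap_mem_of_mem_span (J := fun _ => Submodule.span (ZMod p) M) (i := 1)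
      (fun _ _ => hlie) rfl ?_ (hx trivial)
    rintro y ⟨k, hy⟩
    exact Submodule.subset_span ⟨p * k, hy.pow⟩

end IsMonomial

/-- The quotient by `J n` is spanned by the finitely many monomials of degree less than `n` in the
generators. -/
theorem finite_quotient_of_filtration {X : Type*} [Finite X] {S : Set (FreeRestricted p X)}
    (J : ℕ → Submodule (ZMod p) (QuotientBy p S)) (h1 : J 1 = ⊤) (hanti : Antitone J)
    (hlie : ∀ a b, ∀ x ∈ J a, ∀ y ∈ J b, ⁅x, y⁆ ∈ J (a + b))
    (hpow : ∀ a, ∀ x ∈ J a, pmap p x ∈ J (p * a)) (n : ℕ) : Finite (QuotientBy p S ⧸ J n) := by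
  set v : X → QuotientBy p S := fun i => quotientMk p S (FreeRestricted.of p i) with hv
  have hM : (⋃ k ∈ Set.Iio n, {x | IsMonomial (p := p) v k x}).Finite :=
    (Set.finite_Iio n).biUnion fun k _ => IsMonomial.finite v k
  have hspan : Submodule.span (ZMod p) ((J n).mkQ '' ⋃ k ∈ Set.Iio n,
      {x | IsMonomial (p := p) v k x}) = ⊤ := by
    rw [eq_top_iff, ← (J n).range_mkQ, LinearMap.range_eq_map, ← IsMonomial.span_eq_top,
      Submodule.map_span, Submodule.span_le]
    rintro _ ⟨x, ⟨k, hx⟩, rfl⟩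
    rcases lt_or_ge k n with hk | hk
    · exact Submodule.subset_span ⟨x, Set.mem_biUnion (x := k) hk hx, rfl⟩
    · have : (J n).mkQ x = 0 := (Submodule.Quotient.mk_eq_zero _).2
        (hanti hk (hx.mem_filtration (fun i => h1 ▸ Submodule.mem_top) hlie hpow))
      rw [this]
      exact zero_mem _
  have : Module.Finite (ZMod p) (QuotientBy p S ⧸ J n) :=
    ⟨hspan ▸ Submodule.fg_span (hM.image _)⟩
  exact Module.finite_of_finite (ZMod p)

end Filtration

/-! ### The grading of the graph algebra -/

namespace GraphAlgebra

variable {p : ℕ} [hp : Fact p.Prime] {ι : Type*} [DecidableEq ι]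

/-- The relations of the graph algebra are homogeneous, so it is filtered by degree; the degree is
recorded by the powers of `t` in the embedding into polynomials with `u_i ↦ u_i t`. -/
theorem exists_filtration (K : AbstractSimplicialComplex ι) :
    ∃ J : ℕ → Submodule (ZMod p) (GraphAlgebra p K), J 1 = ⊤ ∧ Antitone J ∧
      (∀ a b, ∀ x ∈ J a, ∀ y ∈ J b, ⁅x, y⁆ ∈ J (a + b)) ∧
      (∀ a, ∀ x ∈ J a, pmap p x ∈ J (p * a)) ∧ ∀ x, (∀ n, x ∈ J n) → x = 0 := by
  obtain ⟨Φ, hΦ, hgen⟩ := GraphAlgebra.exists_lift (p := p) (K := K)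
    (fun i => (Loop.mon 1 (gen p K i) : Loop p (GraphAlgebra p K)))
    (fun i => by rw [Loop.pmap_mon, pmap_gen, map_zero])
    (fun i j hij => by rw [Loop.lie_mon, lie_gen hij, map_zero])
  have heval : (Loop.eval 1).comp Φ = LieHom.id := by
    refine quotient_free_hom_ext (fun x => ?_) (fun x => rfl) fun i => ?_
    · rw [LieHom.comp_apply, hΦ, Loop.eval_one_isRestrictedHom]
      rfl
    · change Loop.eval 1 (Φ (gen p K i)) = gen p K i
      rw [hgen, Loop.eval_mon, one_pow, one_smul]
  have hlie : ∀ a b, ∀ x ∈ (Loop.ordGE a).comap Φ.toLinearMap,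
      ∀ y ∈ (Loop.ordGE b).comap Φ.toLinearMap, ⁅x, y⁆ ∈ (Loop.ordGE (a + b)).comap Φ.toLinearMap :=
    fun a b x hx y hy => by
      change Φ ⁅x, y⁆ ∈ Loop.ordGE (a + b)
      rw [LieHom.map_lie]
      exact Loop.lie_mem_ordGE a b _ hx _ hy
  have hanti : Antitone fun n => (Loop.ordGE n).comap Φ.toLinearMap :=
    fun a b hab => Submodule.comap_mono (Loop.ordGE_anti hab)
  have hpow : ∀ a, ∀ x ∈ (Loop.ordGE a).comap Φ.toLinearMap,
      pmap p x ∈ (Loop.ordGE (p * a)).comap Φ.toLinearMap := fun a x hx => by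
    change Φ (pmap p x) ∈ Loop.ordGE (p * a)
    rw [hΦ]
    exact Loop.pmap_mem_ordGE a hx
  refine ⟨fun n => (Loop.ordGE n).comap Φ.toLinearMap, ?_, hanti, hlie, hpow, fun x hx => ?_⟩
  · refine eq_top_iff.2 fun x _ => ?_
    induction x using quotient_free_induction with
    | of i =>
      change Φ (gen p K i) ∈ Loop.ordGE 1
      rw [hgen]
      exact Loop.mon_mem_ordGE le_rfl _
    | zero => exact zero_mem _
    | add x y hx hy => exact add_mem (hx trivial) (hy trivial)
    | smul a x hx => exact Submodule.smul_mem _ _ (hx trivial)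
    | lie x y hx hy => exact hanti one_le_two (hlie 1 1 x (hx trivial) y (hy trivial))
    | pow x hx => exact hanti (by have := hp.out.pos; omega) (hpow 1 x (hx trivial))
  · have h0 : Φ x = 0 := Loop.eq_zero_of_coeff fun i =>
      Loop.coeff_eq_zero_of_mem_ordGE (Nat.lt_succ_self i) (hx (i + 1))
    have := LieHom.congr_fun heval x
    rw [LieHom.comp_apply, h0, map_zero] at this
    exact this.symm

theorem ι_injective [Finite ι] (K : AbstractSimplicialComplex ι) :
    Function.Injective (Env.ι p (GraphAlgebra p K)) := by
  obtain ⟨J, h1, hanti, hlie, hpow, hsep⟩ := exists_filtration (p := p) K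
  exact ι_injective_of_separated J h1 hanti hlie hpow
    (finite_quotient_of_filtration J h1 hanti hlie hpow) hsep

end GraphAlgebra

/-! ### The filtration of an algebra defined by a descending series of subgroups -/

section ProductFiltration

variable {p : ℕ} {G A : Type*} [Group G] [Ring A] [Algebra (ZMod p) A]

/-- The products `(g₁ - 1) ⋯ (g_r - 1)`, of weight `k₁ + ⋯ + k_r` for `g_i ∈ Δ_{k_i}`. -/
inductive IsProduct (μ : G →* A) (Δ : ℕ → Subgroup G) : ℕ → A → Prop
  | one : IsProduct μ Δ 0 1
  | cons {k n : ℕ} {g : G} {r : A} : g ∈ Δ k → IsProduct μ Δ n r →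
      IsProduct μ Δ (k + n) ((μ g - 1) * r)

/-- The span of the products of weight at least `n`. -/
def productFiltration (μ : G →* A) (Δ : ℕ → Subgroup G) (n : ℕ) : Submodule (ZMod p) A :=
  Submodule.span (ZMod p) {r | ∃ n', n ≤ n' ∧ IsProduct μ Δ n' r}

namespace productFiltration

variable {μ : G →* A} {Δ : ℕ → Subgroup G}

theorem antitone : Antitone (productFiltration (p := p) μ Δ) := fun _ _ h =>
  Submodule.span_mono fun _ ⟨n', hn', hr⟩ => ⟨n', h.trans hn', hr⟩

theorem one_mem : (1 : A) ∈ productFiltration (p := p) μ Δ 0 :=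
  Submodule.subset_span ⟨0, le_rfl, .one⟩

theorem sub_one_mul_mem {k n : ℕ} {g : G} {r : A} (hg : g ∈ Δ k)
    (hr : r ∈ productFiltration (p := p) μ Δ n) :
    (μ g - 1) * r ∈ productFiltration (p := p) μ Δ (k + n) := by
  induction hr using Submodule.span_induction with
  | zero => rw [mul_zero]; exact zero_mem _
  | add r s _ _ hr hs => rw [mul_add]; exact add_mem hr hs
  | smul a r _ hr => rw [mul_smul_comm]; exact Submodule.smul_mem _ _ hr
  | mem r hr =>
    obtain ⟨n', hn', hr⟩ := hr
    exact Submodule.subset_span ⟨k + n', by omega, .cons hg hr⟩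

theorem sub_one_mem {k : ℕ} {g : G} (hg : g ∈ Δ k) :
    μ g - 1 ∈ productFiltration (p := p) μ Δ k := by
  have := sub_one_mul_mem (p := p) (μ := μ) hg one_mem
  rwa [mul_one] at this

theorem group_mem {g : G} (hg : g ∈ Δ 0) : μ g ∈ productFiltration (p := p) μ Δ 0 := by
  have := add_mem (sub_one_mem (p := p) (μ := μ) hg) one_mem
  rwa [sub_add_cancel] at this

/-- The product filtration is the least descending family of subspaces that contains `1` in degree
`0` and is shifted by `k` under multiplication by `g - 1` for `g ∈ Δ_k`. -/
theorem le_of_stable {V : ℕ → Submodule (ZMod p) A} (hV : Antitone V) (h1 : 1 ∈ V 0)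
    (h : ∀ k n g r, g ∈ Δ k → r ∈ V n → (μ g - 1) * r ∈ V (k + n)) (n : ℕ) :
    productFiltration (p := p) μ Δ n ≤ V n := by
  refine Submodule.span_le.2 ?_
  rintro r ⟨n', hn', hr⟩
  refine hV hn' ?_
  clear hn'
  induction hr with
  | one => exact h1
  | cons hg _ ih => exact h _ _ _ _ hg ih

theorem mul_mem {m n : ℕ} {r s : A} (hr : r ∈ productFiltration (p := p) μ Δ m)
    (hs : s ∈ productFiltration (p := p) μ Δ n) :
    r * s ∈ productFiltration (p := p) μ Δ (m + n) := by
  refine le_of_stable (V := fun m => (productFiltration (p := p) μ Δ (m + n)).comap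
    (LinearMap.mulRight (ZMod p) s)) (fun a b hab => Submodule.comap_mono
      (antitone (Nat.add_le_add_right hab n))) ?_ ?_ m hr
  · change 1 * s ∈ productFiltration μ Δ (0 + n)
    rwa [one_mul, zero_add]
  · intro k l g r hg hr
    change (μ g - 1) * r * s ∈ productFiltration μ Δ (k + l + n)
    rw [mul_assoc, add_assoc]
    exact sub_one_mul_mem hg hr

theorem map_mem {H B : Type*} [Group H] [Ring B] [Algebra (ZMod p) B] {ν : H →* B}
    {Δ' : ℕ → Subgroup H} (f : A →ₐ[ZMod p] B) (π : G →* H) (hf : ∀ g, f (μ g) = ν (π g))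
    (hπ : ∀ k, ∀ g ∈ Δ k, π g ∈ Δ' k) {n : ℕ} {r : A}
    (hr : r ∈ productFiltration (p := p) μ Δ n) : f r ∈ productFiltration (p := p) ν Δ' n := by
  refine le_of_stable (V := fun m => (productFiltration (p := p) ν Δ' m).comap f.toLinearMap)
    (fun a b hab => Submodule.comap_mono (antitone hab)) ?_ ?_ n hr
  · change f 1 ∈ productFiltration ν Δ' 0
    rw [map_one]
    exact one_mem
  · intro k l g r hg hr
    change f ((μ g - 1) * r) ∈ productFiltration ν Δ' (k + l)
    rw [map_mul, map_sub, map_one, hf]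
    exact sub_one_mul_mem (hπ k g hg) hr

variable {x : G}

theorem conj_mem (hx : ∀ k, ∀ g ∈ Δ k, x * g * x⁻¹ ∈ Δ k) {n : ℕ} {r : A}
    (hr : r ∈ productFiltration (p := p) μ Δ n) :
    μ x * r * μ x⁻¹ ∈ productFiltration (p := p) μ Δ n := by
  have hinv : μ x⁻¹ * μ x = 1 := by rw [← map_mul, inv_mul_cancel, map_one]
  refine le_of_stable (V := fun m => (productFiltration (p := p) μ Δ m).comap
    (LinearMap.mulRight (ZMod p) (μ x⁻¹) ∘ₗ LinearMap.mulLeft (ZMod p) (μ x)))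
    (fun a b hab => Submodule.comap_mono (antitone hab)) ?_ ?_ n hr
  · change μ x * 1 * μ x⁻¹ ∈ productFiltration μ Δ 0
    rw [mul_one, ← map_mul, mul_inv_cancel, map_one]
    exact one_mem
  · intro k l g r hg hr
    have h := sub_one_mul_mem (p := p) (μ := μ) (hx k g hg) hr
    change μ x * ((μ g - 1) * r) * μ x⁻¹ ∈ productFiltration μ Δ (k + l)
    change (μ (x * g * x⁻¹) - 1) * (μ x * r * μ x⁻¹) ∈ _ at h
    convert h using 1
    simp only [map_mul, sub_mul, mul_sub, mul_assoc, one_mul]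
    rw [← mul_assoc (μ x⁻¹) (μ x), hinv, one_mul]

/-- Conjugation by an element of `Δ_w` is the identity up to terms of weight larger by `w`. -/
theorem conj_sub_mem (hΔ : Antitone Δ) {w : ℕ} (hx : ∀ k, ∀ g ∈ Δ k, x * g * x⁻¹ ∈ Δ k)
    (hxw : ∀ k, ∀ g ∈ Δ k, x * g * x⁻¹ * g⁻¹ ∈ Δ (k + w)) {n : ℕ} {r : A}
    (hr : r ∈ productFiltration (p := p) μ Δ n) :
    μ x * r * μ x⁻¹ - r ∈ productFiltration (p := p) μ Δ (n + w) := by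
  have hinv : μ x⁻¹ * μ x = 1 := by rw [← map_mul, inv_mul_cancel, map_one]
  refine (le_of_stable (V := fun m => productFiltration (p := p) μ Δ m ⊓
    (productFiltration (p := p) μ Δ (m + w)).comap
    (LinearMap.mulRight (ZMod p) (μ x⁻¹) ∘ₗ LinearMap.mulLeft (ZMod p) (μ x) - LinearMap.id))
    (fun a b hab => inf_le_inf (antitone hab)
      (Submodule.comap_mono (antitone (Nat.add_le_add_right hab w)))) ⟨one_mem, ?_⟩ ?_ n hr).2
  · change μ x * 1 * μ x⁻¹ - 1 ∈ productFiltration μ Δ (0 + w)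
    rw [mul_one, ← map_mul, mul_inv_cancel, map_one, sub_self]
    exact zero_mem _
  · intro k l g r hg hr
    refine ⟨sub_one_mul_mem hg hr.1, ?_⟩
    have h1 := sub_one_mul_mem (p := p) (μ := μ) (hx k g hg) hr.2
    have h2 := sub_one_mul_mem (p := p) (μ := μ) (hxw k g hg)
      (mul_mem (group_mem (p := p) (μ := μ) (hΔ (Nat.zero_le k) hg)) hr.1)
    change (μ (x * g * x⁻¹) - 1) * (μ x * r * μ x⁻¹ - r) ∈ _ at h1
    change μ x * ((μ g - 1) * r) * μ x⁻¹ - (μ g - 1) * r ∈ productFiltration μ Δ (k + l + w)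
    rw [show k + (l + w) = k + l + w by omega] at h1
    rw [show k + w + (0 + l) = k + l + w by omega, ← mul_assoc, sub_mul, ← map_mul,
      inv_mul_cancel_right, one_mul] at h2
    convert add_mem h1 h2 using 1
    simp only [map_mul, sub_mul, mul_sub, mul_assoc, one_mul]
    rw [← mul_assoc (μ x⁻¹) (μ x), hinv, one_mul]
    abel

end productFiltration

end ProductFiltration

/-! ### Dimension subgroups of finite `p`-groups -/

section DimensionSubgroup

open MonoidAlgebra

variable {p : ℕ} [hp : Fact p.Prime] {G : Type*} [Group G]

/-- A function on `G` as a linear functional, or more generally a linear map, on the group ring. -/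
noncomputable def groupRingLift {M : Type*} [AddCommGroup M] [Module (ZMod p) M] (f : G → M) :
    MonoidAlgebra (ZMod p) G →ₗ[ZMod p] M :=
  (MonoidAlgebra.basis G (ZMod p)).constr (ZMod p) f

theorem groupRingLift_of {M : Type*} [AddCommGroup M] [Module (ZMod p) M] (f : G → M) (g : G) :
    groupRingLift (p := p) f (of (ZMod p) G g) = f g := by
  have := (MonoidAlgebra.basis G (ZMod p)).constr_basis (ZMod p) f g
  rwa [MonoidAlgebra.basis_apply] at this

/-- A descending series of subgroups satisfying the conditions on a `p`-central series, except that
its first term need not be the whole group. -/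
structure IsPSeries (p : ℕ) (Δ : ℕ → Subgroup G) : Prop where
  zero_eq : Δ 0 = Δ 1
  antitone : Antitone Δ
  commutator_mem {k l : ℕ} {g h : G} : g ∈ Δ k → h ∈ Δ l → g * h * g⁻¹ * h⁻¹ ∈ Δ (k + l)
  pow_mem {k : ℕ} {g : G} : g ∈ Δ k → g ^ p ∈ Δ (p * k)

namespace IsPSeries

variable {Δ : ℕ → Subgroup G}

theorem mem_span (hΔ : IsPSeries p Δ) {n : ℕ} {r : MonoidAlgebra (ZMod p) G}
    (hr : r ∈ productFiltration (p := p) (of (ZMod p) G) Δ n) :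
    r ∈ Submodule.span (ZMod p) (of (ZMod p) G '' (Δ 0 : Set G)) := by
  refine productFiltration.le_of_stable
    (V := fun _ => Submodule.span (ZMod p) (of (ZMod p) G '' (Δ 0 : Set G)))
    (fun _ _ _ => le_rfl) ?_ ?_ n hr
  · exact Submodule.subset_span ⟨1, one_mem _, map_one _⟩
  · intro k n g r hg hr
    rw [sub_mul, one_mul]
    refine sub_mem ?_ hr
    induction hr using Submodule.span_induction with
    | zero => rw [mul_zero]; exact zero_mem _
    | add r s _ _ hr hs => rw [mul_add]; exact add_mem hr hs
    | smul a r _ hr => rw [mul_smul_comm]; exact Submodule.smul_mem _ _ hr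
    | mem r hr =>
      obtain ⟨h, hh, rfl⟩ := hr
      exact Submodule.subset_span
        ⟨g * h, mul_mem (hΔ.antitone (Nat.zero_le k) hg) hh, map_mul _ _ _⟩

variable {χ : G → ZMod p}

/-- A homomorphism vanishing on `Δ_{w+1}` is the restriction of a linear functional on the group
ring that vanishes in weights greater than `w`. -/
theorem eq_zero_of_sub_one_mem (hΔ : IsPSeries p Δ)
    (hχ : ∀ g ∈ Δ 0, ∀ h ∈ Δ 0, χ (g * h) = χ g + χ h)
    {w : ℕ} (hχw : ∀ g ∈ Δ (w + 1), χ g = 0) {n : ℕ} (hn : w < n) {g : G}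
    (hg : of (ZMod p) G g - 1 ∈ productFiltration (p := p) (of (ZMod p) G) Δ n) : χ g = 0 := by
  have h1 : χ 1 = 0 := by
    have := hχ 1 (one_mem _) 1 (one_mem _)
    rwa [mul_one, left_eq_add] at this
  set ε : MonoidAlgebra (ZMod p) G →ₗ[ZMod p] ZMod p := groupRingLift fun _ => 1 with hε
  set D : MonoidAlgebra (ZMod p) G →ₗ[ZMod p] ZMod p := groupRingLift χ with hD
  have hεmul : ∀ (h : G) (r : MonoidAlgebra (ZMod p) G), ε (of (ZMod p) G h * r) = ε r :=
    fun h r => by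
      induction r using MonoidAlgebra.induction_on with
      | of m => rw [← map_mul, hε, groupRingLift_of, groupRingLift_of]
      | add r s hr hs => rw [mul_add, map_add, map_add, hr, hs]
      | smul a r hr => rw [mul_smul_comm, map_smul, map_smul, hr]
  have hDmul : ∀ h ∈ Δ 0, ∀ r ∈ Submodule.span (ZMod p) (of (ZMod p) G '' (Δ 0 : Set G)),
      D (of (ZMod p) G h * r) = χ h * ε r + D r := fun h hh r hr => by
    induction hr using Submodule.span_induction with
    | zero => simp
    | add r s _ _ hr hs => rw [mul_add, map_add, map_add, map_add, hr, hs]; ring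
    | smul a r _ hr =>
      rw [mul_smul_comm, map_smul, map_smul, map_smul, hr, smul_add, smul_eq_mul, smul_eq_mul,
        smul_eq_mul]
      ring
    | mem r hr =>
      obtain ⟨g, hg, rfl⟩ := hr
      rw [← map_mul, hD, hε, groupRingLift_of, groupRingLift_of, groupRingLift_of, hχ h hh g hg,
        mul_one]
  have key : ∀ n r, IsProduct (of (ZMod p) G) Δ n r → (1 ≤ n → ε r = 0) ∧ (w < n → D r = 0) := by
    intro n r hr
    induction hr with
    | one => exact ⟨fun h => absurd h (by omega), fun h => absurd h (by omega)⟩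
    | @cons k n h r hh hr ih =>
      have hspan := hΔ.mem_span (Submodule.subset_span ⟨n, le_rfl, hr⟩)
      refine ⟨fun _ => by rw [sub_mul, one_mul, map_sub, hεmul, sub_self], fun hw => ?_⟩
      rw [sub_mul, one_mul, map_sub, hDmul h (hΔ.antitone (Nat.zero_le k) hh) r hspan,
        add_sub_cancel_right]
      rcases Nat.eq_zero_or_pos n with rfl | hn
      · rw [hχw h (hΔ.antitone (by omega) hh), zero_mul]
      · rw [ih.1 hn, mul_zero]
  have : D (of (ZMod p) G g - 1) = 0 := by
    have hle : productFiltration (p := p) (of (ZMod p) G) Δ n ≤ LinearMap.ker D := by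
      refine Submodule.span_le.2 ?_
      rintro r ⟨n', hn', hr⟩
      exact (key n' r hr).2 (hn.trans_le hn')
    exact hle hg
  rwa [← map_one (of (ZMod p) G), map_sub, hD, groupRingLift_of, groupRingLift_of, h1,
    sub_zero] at this

/-- The inductive step in the comparison of a series with the dimension subgroups that it defines.
The group ring of `Δ_0` is free over that of the kernel of `χ`, with the basis of the powers
`(x - 1) ^ j` for `j < p`, to which the weights `j w` are assigned. -/
theorem mem_of_sub_one_mem_of_ker (hΔ : IsPSeries p Δ)
    (hχ : ∀ g ∈ Δ 0, ∀ h ∈ Δ 0, χ (g * h) = χ g + χ h)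
    {w : ℕ} (hw : Δ w = Δ 0) (hχw : ∀ g ∈ Δ (w + 1), χ g = 0) {x : G} (hx : x ∈ Δ 0)
    (hx1 : χ x = 1) {Δ' : ℕ → Subgroup G} (hΔ' : IsPSeries p Δ')
    (hker : ∀ k g, g ∈ Δ' k ↔ g ∈ Δ k ∧ χ g = 0)
    (ih : ∀ n, ∀ g ∈ Δ' 0, of (ZMod p) G g - 1 ∈ productFiltration (p := p) (of (ZMod p) G) Δ' n →
      g ∈ Δ' n) {n : ℕ} {g : G} (hg : g ∈ Δ 0)
    (h : of (ZMod p) G g - 1 ∈ productFiltration (p := p) (of (ZMod p) G) Δ n) : g ∈ Δ n := by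
  rcases Nat.lt_or_ge w n with hn | hn
  swap
  · exact hΔ.antitone hn (hw ▸ hg)
  have hχg : χ g = 0 := hΔ.eq_zero_of_sub_one_mem hχ hχw hn h
  have hχ1 : χ 1 = 0 := by
    have := hχ 1 (one_mem _) 1 (one_mem _)
    rwa [mul_one, left_eq_add] at this
  have hχx : ∀ i : ℕ, χ (x ^ i) = i := fun i => by
    induction i with
    | zero => rw [pow_zero, hχ1, Nat.cast_zero]
    | succ i ih => rw [pow_succ, hχ _ (Subgroup.pow_mem _ hx i) _ hx, ih, hx1, Nat.cast_succ]
  set μ := of (ZMod p) G with hμ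
  set E := productFiltration (p := p) μ Δ' with hE
  set V : ℕ → Submodule (ZMod p) (MonoidAlgebra (ZMod p) G) := fun n =>
    Submodule.span (ZMod p) {r | ∃ j a, j < p ∧ a ∈ E (n - j * w) ∧ r = a * (μ x - 1) ^ j} with hV
  have hmem : ∀ n j a, j < p → a ∈ E (n - j * w) → a * (μ x - 1) ^ j ∈ V n :=
    fun n j a hj ha => Submodule.subset_span ⟨j, a, hj, ha, rfl⟩
  have hVanti : Antitone V := fun m n hmn => Submodule.span_mono (by
    rintro r ⟨j, a, hj, ha, rfl⟩
    exact ⟨j, a, hj, productFiltration.antitone (Nat.sub_le_sub_right hmn _) ha, rfl⟩)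
  -- conjugation by `x` raises the weights by `w`
  have hxw : x ∈ Δ w := hw ▸ hx
  have hconj : ∀ k, ∀ g ∈ Δ' k, x * g * x⁻¹ * g⁻¹ ∈ Δ' (k + w) := fun k g hg => by
    rw [hker] at hg ⊢
    have h0 := hΔ.antitone (Nat.zero_le k) hg.1
    have h2 := hΔ.commutator_mem hxw hg.1
    refine ⟨by rwa [add_comm] at h2, ?_⟩
    have h3 := hχ _ (hΔ.antitone (Nat.zero_le _) h2) _ (mul_mem h0 hx)
    rw [← mul_assoc, inv_mul_cancel_right, inv_mul_cancel_right, hχ _ hx _ h0, hχ _ h0 _ hx] at h3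
    linear_combination -h3
  have hconj' : ∀ k, ∀ g ∈ Δ' k, x * g * x⁻¹ ∈ Δ' k := fun k g hg => by
    have := mul_mem (hΔ'.antitone (Nat.le_add_right k w) (hconj k g hg)) hg
    rwa [inv_mul_cancel_right] at this
  have hxinv : μ x⁻¹ * μ x = 1 := by rw [← map_mul, inv_mul_cancel, map_one]
  -- the filtration `V` is compatible with multiplication by the elements `g - 1`
  have hVker : ∀ k n g r, g ∈ Δ' k → r ∈ V n → (μ g - 1) * r ∈ V (n + k) := by
    intro k n g r hg hr
    induction hr using Submodule.span_induction with
    | zero => rw [mul_zero]; exact zero_mem _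
    | add r s _ _ hr hs => rw [mul_add]; exact add_mem hr hs
    | smul a r _ hr => rw [mul_smul_comm]; exact Submodule.smul_mem _ _ hr
    | mem r hr =>
      obtain ⟨j, a, hj, ha, rfl⟩ := hr
      rw [← mul_assoc]
      exact hmem _ _ _ hj (productFiltration.antitone (by omega)
        (productFiltration.sub_one_mul_mem hg ha))
  have hVx : ∀ n r, r ∈ V n → (μ x - 1) * r ∈ V (n + w) := by
    intro n r hr
    induction hr using Submodule.span_induction with
    | zero => rw [mul_zero]; exact zero_mem _
    | add r s _ _ hr hs => rw [mul_add]; exact add_mem hr hs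
    | smul a r _ hr => rw [mul_smul_comm]; exact Submodule.smul_mem _ _ hr
    | mem r hr =>
      obtain ⟨j, a, hj, ha, rfl⟩ := hr
      have h1 : (μ x - 1) * (a * (μ x - 1) ^ j) =
          (μ x * a * μ x⁻¹ - a) * (μ x - 1) ^ j + μ x * a * μ x⁻¹ * (μ x - 1) ^ (j + 1) := by
        have h2 : μ x * a = μ x * a * μ x⁻¹ * μ x := by rw [mul_assoc _ (μ x⁻¹), hxinv, mul_one]
        rw [pow_succ', ← mul_assoc, ← mul_assoc (μ x * a * μ x⁻¹), ← add_mul, mul_sub, ← h2]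
        congr 1
        rw [sub_mul, one_mul, mul_one]
        abel
      rw [h1]
      have hσ := productFiltration.conj_mem (p := p) (μ := μ) hconj' ha
      refine add_mem (hmem _ _ _ hj (productFiltration.antitone (by omega)
        (productFiltration.conj_sub_mem hΔ'.antitone hconj' hconj ha))) ?_
      rcases Nat.lt_or_ge (j + 1) p with hj1 | hj1
      · refine hmem _ _ _ hj1 ?_
        rwa [Nat.succ_mul, Nat.add_sub_add_right]
      · obtain rfl : j + 1 = p := by omega
        have hxp : x ^ (j + 1) ∈ Δ' ((j + 1) * w) := by
          rw [hker]
          refine ⟨hΔ.pow_mem hxw, ?_⟩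
          rw [hχx]
          exact ZMod.natCast_self _
        have h3 := productFiltration.mul_mem hσ
          (productFiltration.sub_one_mem (p := j + 1) (μ := μ) hxp)
        rw [map_pow] at h3
        have h4 := sub_pow_prime_of_commute (p := j + 1) (Commute.one_right (μ x))
        rw [one_pow] at h4
        rw [h4]
        have h5 := hmem (n + w) 0 _ hp.out.pos
          (productFiltration.antitone (a := n + w - 0 * w) (by rw [Nat.succ_mul]; omega) h3)
        rwa [pow_zero, mul_one] at h5
  have hVmul : ∀ a b : G, (∀ n r, r ∈ V n → (μ a - 1) * r ∈ V (n + w)) →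
      (∀ n r, r ∈ V n → (μ b - 1) * r ∈ V (n + w)) →
      ∀ n r, r ∈ V n → (μ (a * b) - 1) * r ∈ V (n + w) := by
    intro a b ha hb n r hr
    have h1 := hb n r hr
    have h2 := ha n _ (add_mem (hVanti (Nat.le_add_right n w) h1) hr)
    convert add_mem h2 h1 using 1
    rw [map_mul]
    noncomm_ring
  have hVG : ∀ g ∈ Δ 0, ∀ n r, r ∈ V n → (μ g - 1) * r ∈ V (n + w) := by
    intro g hg
    have hpow : ∀ i : ℕ, ∀ n r, r ∈ V n → (μ (x ^ i) - 1) * r ∈ V (n + w) := fun i => by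
      induction i with
      | zero =>
        intro n r _
        rw [pow_zero, map_one, sub_self, zero_mul]
        exact zero_mem _
      | succ i ih => rw [pow_succ]; exact hVmul _ _ ih hVx
    have hxi := Subgroup.pow_mem _ hx (χ g).val
    have hh : g * (x ^ (χ g).val)⁻¹ ∈ Δ 0 := mul_mem hg (inv_mem hxi)
    have h2 := hχ _ hh _ hxi
    rw [inv_mul_cancel_right, hχx, ZMod.natCast_zmod_val, right_eq_add] at h2
    have := hVmul _ _ (fun n r hr => hVker w n _ r ((hker _ _).2 ⟨hw ▸ hh, h2⟩) hr) (hpow (χ g).val)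
    rwa [inv_mul_cancel_right] at this
  have hle : ∀ n, productFiltration (p := p) μ Δ n ≤ V n := by
    refine productFiltration.le_of_stable hVanti ?_ ?_
    · have := hmem 0 0 1 hp.out.pos (by rw [Nat.zero_sub]; exact productFiltration.one_mem)
      rwa [pow_zero, mul_one] at this
    · intro k n g r hg hr
      rcases Nat.lt_or_ge w k with hk | hk
      · rw [add_comm]
        exact hVker k n g r ((hker _ _).2 ⟨hg, hχw g (hΔ.antitone hk hg)⟩) hr
      · exact hVanti (by omega) (hVG g (hΔ.antitone (Nat.zero_le k) hg) n r hr)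
  -- the projection to the first summand
  set P : MonoidAlgebra (ZMod p) G →ₗ[ZMod p] MonoidAlgebra (ZMod p) G :=
    groupRingLift fun g => μ (g * (x ^ (χ g).val)⁻¹) with hP
  have hPmul : ∀ a ∈ Submodule.span (ZMod p) (μ '' (Δ' 0 : Set G)),
      ∀ r ∈ Submodule.span (ZMod p) (μ '' (Δ 0 : Set G)), P (a * r) = a * P r := by
    intro a ha r hr
    induction ha using Submodule.span_induction with
    | zero => rw [zero_mul, zero_mul, map_zero]
    | add a b _ _ ha hb => rw [add_mul, map_add, ha, hb, add_mul]
    | smul c a _ ha => rw [smul_mul_assoc, map_smul, ha, smul_mul_assoc]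
    | mem a ha =>
      obtain ⟨h, hh, rfl⟩ := ha
      obtain ⟨hh, hχh⟩ := (hker _ _).1 hh
      induction hr using Submodule.span_induction with
      | zero => rw [mul_zero, map_zero, mul_zero]
      | add r s _ _ hr hs => rw [mul_add, map_add, hr, hs, map_add, mul_add]
      | smul c r _ hr => rw [mul_smul_comm, map_smul, hr, map_smul, mul_smul_comm]
      | mem r hr =>
        obtain ⟨g, hg, rfl⟩ := hr
        rw [← map_mul, hP, hμ, groupRingLift_of, groupRingLift_of, ← map_mul, hχ h hh g hg, hχh,
          zero_add, mul_assoc]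
  have hPpow : ∀ j, j < p → P ((μ x - 1) ^ j) = if j = 0 then 1 else 0 := by
    intro j hj
    have h1 : (μ x - 1) ^ j = ∑ i ∈ Finset.range (j + 1),
        ((-1) ^ (j - i) * (j.choose i : ZMod p)) • μ (x ^ i) := by
      rw [sub_eq_add_neg, (Commute.neg_one_right (μ x)).add_pow]
      refine Finset.sum_congr rfl fun i _ => ?_
      rw [map_pow, Algebra.smul_def, map_mul, map_pow, map_neg, map_one, map_natCast]
      rw [mul_assoc]
      exact (((Commute.neg_one_left _).pow_left _).mul_left (Nat.cast_commute _ _)).symm.eq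
    have h2 : ∀ i ∈ Finset.range (j + 1), P (μ (x ^ i)) = 1 := fun i hi => by
      rw [Finset.mem_range] at hi
      rw [hP, hμ, groupRingLift_of, hχx, ZMod.val_natCast_of_lt (by omega), mul_inv_cancel, map_one]
    have h3 : ∑ i ∈ Finset.range (j + 1), (-1 : ZMod p) ^ (j - i) * (j.choose i : ZMod p) =
        0 ^ j := by
      have := add_pow (1 : ZMod p) (-1) j
      simp only [one_pow, one_mul, add_neg_cancel] at this
      exact this.symm
    rw [h1, map_sum, Finset.sum_congr rfl fun i hi => by rw [map_smul, h2 i hi],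
      ← Finset.sum_smul, h3]
    split_ifs with hj0
    · rw [hj0, pow_zero, one_smul]
    · rw [zero_pow hj0, zero_smul]
  have hPV : V n ≤ (E n).comap P := by
    refine Submodule.span_le.2 ?_
    rintro r ⟨j, a, hj, ha, rfl⟩
    have hspan : (μ x - 1) ^ j ∈ Submodule.span (ZMod p) (μ '' (Δ 0 : Set G)) := by
      have h1 : (1 : MonoidAlgebra (ZMod p) G) ∈
        productFiltration (p := p) μ Δ 0 := productFiltration.one_mem
      have h2 : ∀ j : ℕ, (μ x - 1) ^ j ∈ productFiltration (p := p) μ Δ 0 := fun j => by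
        induction j with
        | zero => exact h1
        | succ j ih =>
          rw [pow_succ']
          exact productFiltration.sub_one_mul_mem (n := 0) hx ih
      exact hΔ.mem_span (h2 j)
    change P _ ∈ E n
    rw [hPmul a (hΔ'.mem_span ha) _ hspan, hPpow j hj]
    split_ifs with hj0
    · rw [mul_one]
      simpa [hj0] using ha
    · rw [mul_zero]
      exact zero_mem _
  have hfin := hPV (hle n h)
  have hPg : P (μ g - 1) = μ g - 1 := by
    rw [← map_one μ, map_sub, hP, hμ, groupRingLift_of, groupRingLift_of, hχg, hχ1, ZMod.val_zero,
      pow_zero, inv_one, mul_one, mul_one]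
  change P (μ g - 1) ∈ E n at hfin
  rw [hPg] at hfin
  exact ((hker _ _).1 (ih n g ((hker _ _).2 ⟨hg, hχg⟩) hfin)).1

theorem exists_addMonoidHom_eq_one {V : Type*} [AddCommGroup V] (hV : ∀ v : V, p • v = 0) {v : V}
    (hv : v ≠ 0) : ∃ φ : V →+ ZMod p, φ v = 1 := by
  have key : ∀ [inst : Module (ZMod p) V], ∃ φ : V →+ ZMod p, φ v = 1 := by
    intro _
    obtain ⟨φ, hφ⟩ : ∃ φ : Module.Dual (ZMod p) V, φ v ≠ 0 := by
      by_contra! h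
      exact hv ((Module.forall_dual_apply_eq_zero_iff (ZMod p) v).1 h)
    exact ⟨((φ v)⁻¹ • φ : Module.Dual (ZMod p) V).toAddMonoidHom, inv_mul_cancel₀ hφ⟩
  exact key (inst := AddCommGroup.zmodModule hV)

/-- A subgroup with elementary abelian quotient is contained in the kernel of a character. -/
theorem exists_character {H N : Subgroup G} (hcomm : ∀ g ∈ H, ∀ h ∈ H, g * h * g⁻¹ * h⁻¹ ∈ N)
    (hpow : ∀ g ∈ H, g ^ p ∈ N) {g : G} (hg : g ∈ H) (hgN : g ∉ N) :
    ∃ χ : G → ZMod p, (∀ g ∈ H, ∀ h ∈ H, χ (g * h) = χ g + χ h) ∧ (∀ g ∈ N, χ g = 0) ∧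
      ∃ x ∈ H, χ x = 1 := by
  classical
  have hnormal : (N.subgroupOf H).Normal := ⟨fun n hn g => by
    have := mul_mem (hcomm g g.2 n n.2) (Subgroup.mem_subgroupOf.1 hn)
    rw [inv_mul_cancel_right] at this
    exact this⟩
  let _ : CommGroup (H ⧸ N.subgroupOf H) :=
    { mul_comm := by
        rintro ⟨a⟩ ⟨b⟩
        refine QuotientGroup.eq.2 (Subgroup.mem_subgroupOf.2 ?_)
        have := hcomm _ (inv_mem b.2) _ (inv_mem a.2)
        simpa [mul_assoc] using this }
  let π : H → Additive (H ⧸ N.subgroupOf H) := fun h => Additive.ofMul (QuotientGroup.mk h)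
  have hπ : ∀ a b, π (a * b) = π a + π b := fun a b => rfl
  have hπN : ∀ a : H, (a : G) ∈ N ↔ π a = 0 := fun a =>
    (QuotientGroup.eq_one_iff (N := N.subgroupOf H) a).symm
  obtain ⟨φ, hφ⟩ := exists_addMonoidHom_eq_one (p := p) (V := Additive (H ⧸ N.subgroupOf H))
    (by
      rintro ⟨a⟩
      exact (QuotientGroup.eq_one_iff _).2 (Subgroup.mem_subgroupOf.2 (hpow a a.2)))
    (v := π ⟨g, hg⟩) (fun h => hgN ((hπN ⟨g, hg⟩).2 h))
  have hval : ∀ (h : G) (hh : h ∈ H), (if hh : h ∈ H then φ (π ⟨h, hh⟩) else 0) = φ (π ⟨h, hh⟩) :=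
    fun h hh => dif_pos hh
  refine ⟨fun h => if hh : h ∈ H then φ (π ⟨h, hh⟩) else 0, ?_, ?_, g, hg, ?_⟩
  · intro a ha b hb
    beta_reduce
    rw [hval _ ha, hval _ hb, hval _ (mul_mem ha hb), ← map_add, ← hπ]
    rfl
  · intro a ha
    beta_reduce
    split_ifs with hh
    · rw [(hπN ⟨a, hh⟩).1 ha, map_zero]
    · rfl
  · exact (hval _ hg).trans hφ

/-- For a finite `p`-group, the terms of a series are determined by the weights in the group ring.
As in `ι_injective_of_filtration`, a character of `Δ_0` vanishing on the first proper term splits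
off one generator. -/
theorem mem_of_sub_one_mem {c : ℕ} : ∀ {Δ : ℕ → Subgroup G}, IsPSeries p Δ → Finite (Δ 0) →
    Nat.card (Δ 0) = c → (∃ N, Δ N = ⊥) → ∀ n, ∀ g ∈ Δ 0,
    of (ZMod p) G g - 1 ∈ productFiltration (p := p) (of (ZMod p) G) Δ n → g ∈ Δ n := by
  induction c using Nat.strong_induction_on with
  | _ c ih =>
    intro Δ hΔ hfin hcard hbot n g hg h
    by_cases hne : ∀ k, Δ k = Δ 0
    · rw [hne n]
      exact hg
    push Not at hne
    classical
    obtain ⟨w, hw, hw1, hw2⟩ : ∃ w, Δ w = Δ 0 ∧ 1 ≤ w ∧ Δ (w + 1) ≠ Δ 0 := by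
      have h2 : 2 ≤ Nat.find hne := by
        by_contra hlt
        refine Nat.find_spec hne ?_
        obtain h0 | h1 : Nat.find hne = 0 ∨ Nat.find hne = 1 := by omega
        · rw [h0]
        · rw [h1, hΔ.zero_eq]
      refine ⟨Nat.find hne - 1, ?_, by omega, ?_⟩
      · by_contra h3
        exact Nat.find_min hne (m := Nat.find hne - 1) (by omega) h3
      · rw [Nat.sub_add_cancel (by omega)]
        exact Nat.find_spec hne
    obtain ⟨y, hy, hyw⟩ : ∃ y ∈ Δ 0, y ∉ Δ (w + 1) := by
      by_contra! h3
      exact hw2 (le_antisymm (hΔ.antitone (Nat.zero_le _)) h3)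
    obtain ⟨χ, hχ, hχw, x, hx, hx1⟩ := exists_character (p := p) (H := Δ 0) (N := Δ (w + 1))
      (fun a ha b hb => hΔ.antitone (by omega : w + 1 ≤ w + w)
        (hΔ.commutator_mem (hw ▸ ha) (hw ▸ hb)))
      (fun a ha => hΔ.antitone (by have := hp.out.two_le; nlinarith : w + 1 ≤ p * w)
        (hΔ.pow_mem (hw ▸ ha))) hy hyw
    have hχ1 : χ 1 = 0 := by
      have := hχ 1 (one_mem _) 1 (one_mem _)
      rwa [mul_one, left_eq_add] at this
    have hmem0 : ∀ {k a}, a ∈ Δ k → a ∈ Δ 0 := fun {k a} ha => hΔ.antitone (Nat.zero_le k) ha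
    have hχinv : ∀ a ∈ Δ 0, χ a⁻¹ = -χ a := fun a ha => by
      have := hχ _ (inv_mem ha) _ ha
      rw [inv_mul_cancel, hχ1] at this
      linear_combination -this
    have hχpow : ∀ a ∈ Δ 0, ∀ i : ℕ, χ (a ^ i) = i * χ a := fun a ha i => by
      induction i with
      | zero => rw [pow_zero, hχ1, Nat.cast_zero, zero_mul]
      | succ i ih => rw [pow_succ, hχ _ (Subgroup.pow_mem _ ha i) _ ha, ih, Nat.cast_succ]; ring
    let Δ' : ℕ → Subgroup G := fun k =>
      { carrier := {a | a ∈ Δ k ∧ χ a = 0}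
        one_mem' := ⟨one_mem _, hχ1⟩
        mul_mem' := fun {a b} ha hb => ⟨mul_mem ha.1 hb.1, by
          rw [hχ _ (hmem0 ha.1) _ (hmem0 hb.1), ha.2, hb.2, add_zero]⟩
        inv_mem' := fun {a} ha => ⟨inv_mem ha.1, by rw [hχinv _ (hmem0 ha.1), ha.2, neg_zero]⟩ }
    have hker : ∀ k a, a ∈ Δ' k ↔ a ∈ Δ k ∧ χ a = 0 := fun _ _ => Iff.rfl
    have hΔ' : IsPSeries p Δ' :=
      { zero_eq := by
          ext a
          rw [hker, hker, hΔ.zero_eq]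
        antitone := fun k l hkl a ha => ⟨hΔ.antitone hkl ha.1, ha.2⟩
        commutator_mem := fun {k l a b} ha hb => ⟨hΔ.commutator_mem ha.1 hb.1, by
          have ha0 := hmem0 ha.1
          have hb0 := hmem0 hb.1
          rw [hχ _ (mul_mem (mul_mem ha0 hb0) (inv_mem ha0)) _ (inv_mem hb0),
            hχ _ (mul_mem ha0 hb0) _ (inv_mem ha0), hχ _ ha0 _ hb0, hχinv _ ha0, hχinv _ hb0]
          ring⟩
        pow_mem := fun {k a} ha => ⟨hΔ.pow_mem ha.1, by
          rw [hχpow _ (hmem0 ha.1), ha.2, mul_zero]⟩ }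
    have hle : Δ' 0 < Δ 0 := by
      refine lt_of_le_of_ne (fun a ha => ha.1) fun heq => ?_
      have : x ∈ Δ' 0 := heq ▸ hx
      exact one_ne_zero (hx1.symm.trans this.2)
    have hfin' : Finite (Δ' 0) := Finite.of_injective _ (Subgroup.inclusion_injective hle.le)
    refine hΔ.mem_of_sub_one_mem_of_ker hχ hw hχw hx hx1 hΔ' hker ?_ hg h
    refine ih (Nat.card (Δ' 0)) ?_ hΔ' hfin' rfl ?_
    · rw [← hcard]
      exact Set.Finite.card_lt_card (Set.toFinite (Δ 0 : Set G)) hle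
    · obtain ⟨N, hN⟩ := hbot
      refine ⟨N, eq_bot_iff.2 fun a ha => ?_⟩
      rw [← hN]
      exact ha.1

end IsPSeries

end DimensionSubgroup

/-! ### Central series of finitely generated groups -/

section FinitelyGenerated

variable {p : ℕ} {G : Type*} [Group G] (Γ : PCentralSeries p G)

theorem _root_.PCentralSeries.isPSeries : IsPSeries p Γ.term where
  zero_eq := by rw [Γ.term_zero, Γ.term_one]
  antitone := Γ.term_anti
  commutator_mem {k l g h} hg hh :=
    Γ.commutator_le k l (Subgroup.commutator_mem_commutator hg hh)
  pow_mem {k g} hg := Γ.pow_mem k g hg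

variable [hp : Fact p.Prime]

/-- The successive quotients are finitely generated abelian groups of exponent `p`. -/
theorem _root_.PCentralSeries.finiteIndex_term [Group.FG G] (n : ℕ) : (Γ.term n).FiniteIndex := by
  induction n with
  | zero => rw [Γ.term_zero]; infer_instance
  | succ n ih =>
    have hfg : Group.FG (Γ.term n) := inferInstance
    rcases Nat.eq_zero_or_pos n with rfl | hn
    · rw [Γ.term_one]; infer_instance
    have htors : IsMulTorsion (Γ.QuotientGroupAt n) := by
      rintro ⟨g⟩
      refine isOfFinOrder_iff_pow_eq_one.2 ⟨p, hp.out.pos, ?_⟩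
      refine (QuotientGroup.eq_one_iff _).2 (Subgroup.mem_subgroupOf.2 ?_)
      exact Γ.term_anti (by have := hp.out.two_le; nlinarith) (Γ.pow_mem n g g.2)
    have hfin : Finite (Γ.QuotientGroupAt n) := CommGroup.finite_of_fg_isMulTorsion _ htors
    have h1 : (Γ.term (n + 1)).relIndex (Γ.term n) ≠ 0 :=
      Subgroup.index_ne_zero_of_finite (H := (Γ.term (n + 1)).subgroupOf (Γ.term n))
    refine ⟨?_⟩
    rw [← Subgroup.relIndex_mul_index (Γ.term_succ_le n)]
    exact mul_ne_zero h1 ih.index_ne_zero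

/-- For a finitely generated group, the terms of a `p`-central series are determined by the weights
in the group ring. -/
theorem _root_.PCentralSeries.mem_of_sub_one_mem [Group.FG G] {n : ℕ} {g : G}
    (h : MonoidAlgebra.of (ZMod p) G g - 1 ∈
      productFiltration (p := p) (MonoidAlgebra.of (ZMod p) G) Γ.term n) : g ∈ Γ.term n := by
  have hfi := Γ.finiteIndex_term n
  set π := QuotientGroup.mk' (Γ.term n) with hπ
  have hsurj : Function.Surjective π := QuotientGroup.mk'_surjective _
  have hΔ : IsPSeries p fun k => (Γ.term k).map π :=
    { zero_eq := by rw [Γ.term_zero, Γ.term_one]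
      antitone := fun k l hkl => Subgroup.map_mono (Γ.term_anti hkl)
      commutator_mem := by
        rintro k l _ _ ⟨a, ha, rfl⟩ ⟨b, hb, rfl⟩
        exact ⟨_, Γ.isPSeries.commutator_mem ha hb, by simp⟩
      pow_mem := by
        rintro k _ ⟨a, ha, rfl⟩
        exact ⟨_, Γ.pow_mem k a ha, map_pow _ _ _⟩ }
  have hbot : (Γ.term n).map π = ⊥ := by
    rw [Subgroup.map_eq_bot_iff, hπ, QuotientGroup.ker_mk']
  have hmap := productFiltration.map_mem (p := p) (ν := MonoidAlgebra.of (ZMod p) (G ⧸ Γ.term n))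
    (Δ' := fun k => (Γ.term k).map π) (MonoidAlgebra.mapDomainAlgHom (ZMod p) (ZMod p) π) π
    (fun g => by simp) (fun k g hg => ⟨g, hg, rfl⟩) h
  rw [map_sub, map_one] at hmap
  have h2 := IsPSeries.mem_of_sub_one_mem hΔ inferInstance rfl ⟨n, hbot⟩ n (π g)
    ⟨g, by rw [Γ.term_zero]; trivial, rfl⟩ (by simpa using hmap)
  rw [hbot, Subgroup.mem_bot] at h2
  exact (QuotientGroup.eq_one_iff g).1 h2

end FinitelyGenerated

/-! ### Multiplicative filtrations -/

section MulFiltration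

variable {p : ℕ} {A : Type*} [Ring A] [Algebra (ZMod p) A]

/-- A multiplicative descending filtration of an algebra. -/
structure IsMulFiltration (E : ℕ → Submodule (ZMod p) A) : Prop where
  antitone : Antitone E
  one_mem : 1 ∈ E 0
  mul_mem {k l : ℕ} {a b : A} : a ∈ E k → b ∈ E l → a * b ∈ E (k + l)

namespace IsMulFiltration

variable {E : ℕ → Submodule (ZMod p) A}

theorem pow_mem (hE : IsMulFiltration E) {k : ℕ} {a : A} (ha : a ∈ E k) (n : ℕ) :
    a ^ n ∈ E (n * k) := by
  induction n with
  | zero => simpa using hE.one_mem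
  | succ n ih =>
    rw [pow_succ, Nat.succ_mul]
    exact hE.mul_mem ih ha

theorem lie_mem (hE : IsMulFiltration E) {k l : ℕ} {a b : A} (ha : a ∈ E k) (hb : b ∈ E l) :
    ⁅a, b⁆ ∈ E (k + l) := by
  rw [Ring.lie_def]
  refine sub_mem (hE.mul_mem ha hb) ?_
  rw [add_comm]
  exact hE.mul_mem hb ha

end IsMulFiltration

end MulFiltration

/-! ### Homomorphisms from the associated graded Lie algebra -/

section GradedHom

variable {p : ℕ} [hp : Fact p.Prime] {G : Type*} [Group G] {Γ : PCentralSeries p G}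

/-- A homomorphism from the associated graded Lie algebra is given by additive maps on the terms of
the series that take commutators to brackets. -/
theorem _root_.PCentralSeries.Gr.exists_lift {Q : Type*} [LieRing Q] [LieAlgebra (ZMod p) Q]
    (q : ∀ k, Γ.term k → Q) (hmul : ∀ k (g h : Γ.term k), q k (g * h) = q k g + q k h)
    (h0 : ∀ k (g : Γ.term k), (g : G) ∈ Γ.term (k + 1) → q k g = 0)
    (hcomm : ∀ k l (g : Γ.term k) (h : Γ.term l), q (k + l) (Γ.commAt g h) = ⁅q k g, q l h⁆) :
    ∃ f : Γ.Gr →ₗ⁅ZMod p⁆ Q, ∀ k g, f (PCentralSeries.Gr.of Γ k g) = q k g := by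
  let φ : ∀ k, Γ.Piece k →+ Q := fun k => MonoidHom.toAdditiveLeft
    (QuotientGroup.lift _ (MonoidHom.mk' (fun g => Multiplicative.ofAdd (q k g)) fun g h =>
      congrArg Multiplicative.ofAdd (hmul k g h)) fun g hg => by
        exact congrArg Multiplicative.ofAdd (h0 k g (Subgroup.mem_subgroupOf.1 hg)))
  let F : Γ.Gr →+ Q := DirectSum.toAddMonoid φ
  have hF : ∀ k g, F (PCentralSeries.Gr.of Γ k g) = q k g := fun k g =>
    DirectSum.toAddMonoid_of φ k (Γ.cls k g)
  refine ⟨{ F.toZModLinearMap p with map_lie' := fun {x y} => ?_ }, hF⟩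
  change F ⁅x, y⁆ = ⁅F x, F y⁆
  induction x using PCentralSeries.Gr.induction with
  | zero => rw [zero_lie, map_zero, zero_lie]
  | add x x' hx hx' => rw [add_lie, map_add, map_add, add_lie, hx, hx']
  | of k g =>
    induction y using PCentralSeries.Gr.induction with
    | zero => rw [lie_zero, map_zero, lie_zero]
    | add y y' hy hy' => rw [lie_add, map_add, map_add, lie_add, hy, hy']
    | of l h => rw [PCentralSeries.Gr.lie_of, hF, hF, hF, hcomm]

variable {A : Type*} [Ring A] [Algebra (ZMod p) A] {E : ℕ → Submodule (ZMod p) A}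

/-- A group homomorphism into the units of a filtered algebra, compatible with the filtrations,
induces a homomorphism of Lie algebras on the associated graded objects, which respects the `p`-th
powers of homogeneous elements. Here a family of maps `q k` on the terms of the filtration stands
for the passage to the associated graded algebra. -/
theorem IsMulFiltration.exists_gradedHom (hE : IsMulFiltration E) {μ : G →* A}
    (hμ : ∀ k, ∀ g ∈ Γ.term k, μ g - 1 ∈ E k)
    {Q : Type*} [LieRing Q] [LieAlgebra (ZMod p) Q] [RestrictedLieAlgebra p Q]
    (q : ∀ k, E k →ₗ[ZMod p] Q) (hq0 : ∀ k (a : E k), (a : A) ∈ E (k + 1) → q k a = 0)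
    (hqlie : ∀ k l (a : E k) (b : E l),
      q (k + l) ⟨⁅(a : A), (b : A)⁆, hE.lie_mem a.2 b.2⟩ = ⁅q k a, q l b⁆)
    (hqpow : ∀ k (a : E k), q (p * k) ⟨(a : A) ^ p, hE.pow_mem a.2 p⟩ = pmap p (q k a)) :
    ∃ f : Γ.Gr →ₗ⁅ZMod p⁆ Q,
      (∀ k g, f (PCentralSeries.Gr.of Γ k g) = q k ⟨μ g - 1, hμ k g g.2⟩) ∧
      ∀ k (g : Γ.term k), f (PCentralSeries.Gr.of Γ (p * k) ⟨(g : G) ^ p, Γ.pow_mem k g g.2⟩) =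
        pmap p (f (PCentralSeries.Gr.of Γ k g)) := by
  have hμ1 : ∀ g, μ g - 1 ∈ E 1 := fun g => hμ 1 g (by rw [Γ.term_one]; trivial)
  have hcongr : ∀ k (a b c : E k), (a : A) = b + c → (c : A) ∈ E (k + 1) → q k a = q k b :=
    fun k a b c habc hc => by
      rw [show a = b + c from Subtype.ext habc, map_add, hq0 k c hc, add_zero]
  obtain ⟨f, hf⟩ := PCentralSeries.Gr.exists_lift (Γ := Γ)
    (fun k g => q k ⟨μ g - 1, hμ k g g.2⟩)
    (fun k g h => by
      have hmem := hE.mul_mem (hμ k g g.2) (hμ1 h)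
      rw [← map_add]
      refine hcongr k _ _ ⟨_, hE.antitone (Nat.le_succ k) hmem⟩ ?_ hmem
      change μ (g * h : G) - 1 = (μ g - 1 + (μ h - 1)) + (μ g - 1) * (μ h - 1)
      rw [map_mul]
      noncomm_ring)
    (fun k g hg => hq0 k _ (hμ (k + 1) g hg))
    (fun k l g h => by
      have hmem := hE.mul_mem (hμ1 ((g : G)⁻¹ * (h : G)⁻¹)) (hE.lie_mem (hμ k g g.2) (hμ l h h.2))
      rw [add_comm] at hmem
      rw [← hqlie]
      refine hcongr (k + l) _ _ ⟨_, hE.antitone (Nat.le_succ _) hmem⟩ ?_ hmem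
      change μ (PCentralSeries.comm (g : G) h) - 1 = ⁅μ g - 1, μ h - 1⁆ +
        (μ ((g : G)⁻¹ * (h : G)⁻¹) - 1) * ⁅μ g - 1, μ h - 1⁆
      have h1 : ⁅μ g - 1, μ h - 1⁆ = μ ((g : G) * h) - μ ((h : G) * g) := by
        rw [Ring.lie_def, map_mul, map_mul]
        noncomm_ring
      rw [h1, sub_one_mul, add_sub_cancel, mul_sub, ← map_mul, ← map_mul]
      have h2 : ((g : G)⁻¹ * (h : G)⁻¹ * ((h : G) * g)) = 1 := by group
      rw [h2, map_one, PCentralSeries.comm, mul_assoc _ (g : G)])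
  refine ⟨f, hf, fun k g => ?_⟩
  rw [hf, hf, ← hqpow]
  congr 1
  refine Subtype.ext ?_
  have := sub_pow_prime_of_commute (p := p) (Commute.one_right (μ g))
  rw [one_pow, ← map_pow] at this
  exact this.symm

end GradedHom

/-! ### The associated graded algebra of a filtration -/

section Rees

open Polynomial

variable {p : ℕ} [hp : Fact p.Prime] {A : Type*} [Ring A] [Algebra (ZMod p) A]
  {E : ℕ → Submodule (ZMod p) A}

/-- The Rees algebra of a filtration: the polynomials `∑ a_n t ^ n` with `a_n ∈ E_n`. -/
noncomputable def rees (hE : IsMulFiltration E) : Subalgebra (ZMod p) A[X] where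
  carrier := {r | ∀ n, r.coeff n ∈ E n}
  mul_mem' {r s} hr hs n := by
    rw [coeff_mul]
    refine sum_mem fun ij hij => ?_
    rw [← Finset.HasAntidiagonal.mem_antidiagonal.1 hij]
    exact hE.mul_mem (hr _) (hs _)
  add_mem' {r s} hr hs n := by
    rw [coeff_add]
    exact add_mem (hr n) (hs n)
  algebraMap_mem' c n := by
    rw [Algebra.algebraMap_eq_smul_one, coeff_smul, coeff_one]
    refine Submodule.smul_mem _ _ ?_
    split_ifs with h
    · exact h ▸ hE.one_mem
    · exact zero_mem _

/-- The ideal of the Rees algebra consisting of the polynomials `∑ a_n t ^ n` with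
`a_n ∈ E_{n+1}`; the quotient is the associated graded algebra. -/
noncomputable def reesIdeal (hE : IsMulFiltration E) : LieIdeal (ZMod p) (rees hE) where
  carrier := {r | ∀ n, r.1.coeff n ∈ E (n + 1)}
  zero_mem' n := by
    change (0 : A[X]).coeff n ∈ _
    rw [coeff_zero]
    exact zero_mem _
  add_mem' {r s} hr hs n := by
    change (r.1 + s.1).coeff n ∈ E (n + 1)
    rw [coeff_add]
    exact add_mem (hr n) (hs n)
  smul_mem' c r hr n := by
    change (c • r.1).coeff n ∈ E (n + 1)
    rw [coeff_smul]
    exact Submodule.smul_mem _ _ (hr n)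
  lie_mem {r s} hs n := by
    change (r.1 * s.1 - s.1 * r.1).coeff n ∈ E (n + 1)
    rw [coeff_sub, coeff_mul, coeff_mul]
    refine sub_mem (sum_mem fun ij hij => ?_) (sum_mem fun ij hij => ?_)
    · rw [← Finset.HasAntidiagonal.mem_antidiagonal.1 hij, add_assoc]
      exact hE.mul_mem (r.2 _) (hs _)
    · rw [← Finset.HasAntidiagonal.mem_antidiagonal.1 hij, add_right_comm]
      exact hE.mul_mem (hs _) (r.2 _)

theorem pmap_mem_reesIdeal (hE : IsMulFiltration E) (r : rees hE) (hr : r ∈ reesIdeal hE) :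
    pmap p r ∈ reesIdeal hE := by
  rw [pmap_associative, ← pow_sub_one_mul hp.out.ne_zero r]
  intro n
  change ((r ^ (p - 1)).1 * r.1).coeff n ∈ E (n + 1)
  rw [coeff_mul]
  refine sum_mem fun ij hij => ?_
  rw [← Finset.HasAntidiagonal.mem_antidiagonal.1 hij, add_assoc]
  exact hE.mul_mem ((r ^ (p - 1)).2 _) (hr _)

theorem monomial_mem_rees (hE : IsMulFiltration E) {k : ℕ} {a : A} (ha : a ∈ E k) :
    monomial k a ∈ rees hE := fun n => by
  rw [coeff_monomial]
  split_ifs with h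
  · exact h ▸ ha
  · exact zero_mem _

/-- The homogeneous elements of degree `k` of the Rees algebra. -/
noncomputable def reesMonomial (hE : IsMulFiltration E) (k : ℕ) : E k →ₗ[ZMod p] rees hE where
  toFun a := ⟨monomial k a.1, monomial_mem_rees hE a.2⟩
  map_add' a b := Subtype.ext (map_add (monomial k) a.1 b.1)
  map_smul' c a := Subtype.ext (smul_monomial c k a.1).symm

end Rees

/-! ### The `p`-power operation on the associated graded Lie algebra -/

section Induced

variable {p : ℕ} {G : Type*} [Group G]

theorem _root_.PCentralSeries.Gr.exists_eq_sum (Γ : PCentralSeries p G) (x : Γ.Gr) :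
    ∃ (s : Finset ℕ) (g : ∀ k, Γ.term k), x = ∑ k ∈ s, PCentralSeries.Gr.of Γ k (g k) := by
  classical
  have key : ∀ y : ⨁ k, Γ.Piece k, ∃ (s : Finset ℕ) (g : ∀ k, Γ.term k),
      y = ∑ k ∈ s, DirectSum.of Γ.Piece k (Γ.cls k (g k)) := fun y => by
    choose g hg using fun k => Γ.cls_surjective k (y k)
    refine ⟨y.support, g, (DirectSum.sum_support_of y).symm.trans ?_⟩
    exact Finset.sum_congr rfl fun k _ => by rw [hg]
  exact key x

variable [hp : Fact p.Prime]

/-- A Lie algebra embedded in a `p`-Lie algebra with image closed under the `p`-power operation is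
a `p`-Lie algebra. -/
theorem exists_restricted_of_injective {N Q : Type*} [LieRing N] [LieAlgebra (ZMod p) N]
    [LieRing Q] [LieAlgebra (ZMod p) Q] [RestrictedLieAlgebra p Q] (f : N →ₗ⁅ZMod p⁆ Q)
    (hf : Function.Injective f) (h : ∀ x, ∃ y, f y = pmap p (f x)) :
    ∃ P : RestrictedLieAlgebra p N, ∀ x, f (P.pmap x) = pmap p (f x) := by
  choose F hF using h
  refine ⟨{ pmap := F, lie_pmap := fun x y => hf ?_, smul_pmap := fun a x => hf ?_,
            pmap_add := fun x y => hf ?_ }, hF⟩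
  · have hit : ∀ n : ℕ, f ((fun z => ⁅z, y⁆)^[n] x) = (fun z => ⁅z, f y⁆)^[n] (f x) := fun n => by
      induction n with
      | zero => rfl
      | succ n ih => rw [Function.iterate_succ_apply', Function.iterate_succ_apply', ← ih,
          LieHom.map_lie]
    rw [LieHom.map_lie, hF, lie_pmap, hit]
  · rw [hF, map_smul, smul_pmap, map_smul, hF]
  · simp only [hF, map_add, map_sum, map_jacobson, pmap_add]

/-- Lazard's theorem: the associated graded Lie algebra of a `p`-central series of a finitely
generated group is a `p`-Lie algebra with the `p`-power operation induced by `p`-th powers. It is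
embedded in the associated graded algebra of the group ring, filtered by `productFiltration`. -/
theorem _root_.PCentralSeries.Gr.exists_isInduced [Group.FG G] (Γ : PCentralSeries p G) :
    ∃ P : RestrictedLieAlgebra p Γ.Gr, PCentralSeries.Gr.IsInduced Γ P := by
  set μ := MonoidAlgebra.of (ZMod p) G with hμ
  set E := productFiltration (p := p) μ Γ.term with hEdef
  have hE : IsMulFiltration E :=
    ⟨productFiltration.antitone, productFiltration.one_mem, productFiltration.mul_mem⟩
  have hI := restrictedSpan_coe (reesIdeal hE) (pmap_mem_reesIdeal hE)
  set π := quotientMk p (reesIdeal hE : Set (rees hE)) with hπ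
  have hπ0 : ∀ r, π r = 0 ↔ r ∈ reesIdeal hE := fun r => by rw [hπ, quotientMk_eq_zero, hI]
  obtain ⟨f, hf, hfp⟩ := hE.exists_gradedHom (Γ := Γ) (μ := μ)
    (fun k g hg => productFiltration.sub_one_mem hg)
    (fun k => (π : rees hE →ₗ[ZMod p] QuotientBy p (reesIdeal hE : Set (rees hE))) ∘ₗ
      reesMonomial hE k)
    (fun k a ha => (hπ0 _).2 fun n => by
      change (Polynomial.monomial k a.1).coeff n ∈ E (n + 1)
      rw [Polynomial.coeff_monomial]
      split_ifs with h
      · exact h ▸ ha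
      · exact zero_mem _)
    (fun k l a b => by
      change π _ = ⁅π _, π _⁆
      rw [← LieHom.map_lie]
      congr 1
      refine Subtype.ext ?_
      change Polynomial.monomial (k + l) (a.1 * b.1 - b.1 * a.1) =
        Polynomial.monomial k a.1 * Polynomial.monomial l b.1 -
          Polynomial.monomial l b.1 * Polynomial.monomial k a.1
      rw [Polynomial.monomial_mul_monomial, Polynomial.monomial_mul_monomial, add_comm l k,
        map_sub])
    (fun k a => by
      change π _ = pmap p (π _)
      rw [← quotientMk_pmap p _ (reesMonomial hE k a), pmap_associative]
      congr 1
      refine Subtype.ext ?_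
      change Polynomial.monomial (p * k) (a.1 ^ p) = Polynomial.monomial k a.1 ^ p
      rw [Polynomial.monomial_pow, mul_comm])
  have hinj : Function.Injective f := by
    rw [injective_iff_map_eq_zero]
    intro x hx
    obtain ⟨s, g, rfl⟩ := PCentralSeries.Gr.exists_eq_sum Γ x
    have h1 : π (∑ k ∈ s, reesMonomial hE k ⟨μ (g k) - 1, productFiltration.sub_one_mem (g k).2⟩) =
        0 := by
      rw [map_sum] at hx ⊢
      rw [← hx]
      exact Finset.sum_congr rfl fun k _ => (hf k (g k)).symm
    rw [hπ0] at h1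
    refine Finset.sum_eq_zero fun k hk => PCentralSeries.Gr.of_eq_zero Γ _ ?_
    refine Γ.mem_of_sub_one_mem ?_
    have h2 := h1 k
    have h3 : (∑ k ∈ s, reesMonomial hE k
        ⟨μ (g k) - 1, productFiltration.sub_one_mem (g k).2⟩ : rees hE).1.coeff k =
        μ (g k) - 1 := by
      rw [AddSubmonoidClass.coe_finsetSum, Polynomial.finsetSum_coeff,
        Finset.sum_eq_single k]
      · exact Polynomial.coeff_monomial_same k _
      · exact fun l _ hl => Polynomial.coeff_monomial_of_ne _ hl.symm
      · exact fun h => absurd hk h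
    rwa [h3] at h2
  obtain ⟨P, hP⟩ := exists_restricted_of_injective f hinj fun x => by
    induction x using PCentralSeries.Gr.induction with
    | zero => exact ⟨0, by rw [map_zero, pmap_zero]⟩
    | of k g => exact ⟨_, hfp k g⟩
    | add x y hx hy =>
      obtain ⟨x', hx'⟩ := hx
      obtain ⟨y', hy'⟩ := hy
      refine ⟨x' + y' + ∑ i ∈ Finset.Icc 1 (p - 1), jacobson p x y i, ?_⟩
      simp only [map_add, map_sum, map_jacobson, pmap_add, hx', hy']
  exact ⟨P, fun k g => hinj (by rw [hP, hfp])⟩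

end Induced

/-! ### The Magnus map of the graph product -/

section Magnus

variable {p : ℕ}

open Polynomial

/-- The filtration of a polynomial ring by the powers of the variable. -/
def polynomialFiltration (p : ℕ) (B : Type*) [Ring B] [Algebra (ZMod p) B] (n : ℕ) :
    Submodule (ZMod p) B[X] where
  carrier := {r | ∀ k < n, r.coeff k = 0}
  zero_mem' _ _ := coeff_zero _
  add_mem' {r s} hr hs k hk := by rw [coeff_add, hr k hk, hs k hk, add_zero]
  smul_mem' c r hr k hk := by rw [coeff_smul, hr k hk, smul_zero]

variable {B : Type*} [Ring B] [Algebra (ZMod p) B]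

theorem polynomialFiltration_isMulFiltration : IsMulFiltration (polynomialFiltration p B) where
  antitone _ _ hkl _ hr i hi := hr i (hi.trans_le hkl)
  one_mem k hk := absurd hk (Nat.not_lt_zero k)
  mul_mem {k l r s} hr hs n hn := by
    rw [coeff_mul]
    refine Finset.sum_eq_zero fun ij hij => ?_
    have hij' := Finset.HasAntidiagonal.mem_antidiagonal.1 hij
    rcases Nat.lt_or_ge ij.1 k with h | h
    · rw [hr _ h, zero_mul]
    · rw [hs _ (by omega), mul_zero]

theorem coeff_mul_of_mem {k l : ℕ} {r s : B[X]} (hr : r ∈ polynomialFiltration p B k)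
    (hs : s ∈ polynomialFiltration p B l) :
    (r * s).coeff (k + l) = r.coeff k * s.coeff l := by
  rw [coeff_mul, Finset.sum_eq_single (k, l)]
  · rintro ⟨i, j⟩ hij hne
    have hij' := Finset.HasAntidiagonal.mem_antidiagonal.1 hij
    rcases Nat.lt_trichotomy i k with h | h | h
    · rw [hr i h, zero_mul]
    · exact absurd (Prod.ext h (by simp only at hij'; omega)) hne
    · rw [hs j (by simp only at hij'; omega), mul_zero]
  · exact fun h => absurd
      (Finset.HasAntidiagonal.mem_antidiagonal.2 (show (k, l).1 + (k, l).2 = k + l from rfl)) h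

theorem coeff_pow_of_mem {k : ℕ} {r : B[X]} (hr : r ∈ polynomialFiltration p B k) (n : ℕ) :
    (r ^ n).coeff (n * k) = r.coeff k ^ n := by
  induction n with
  | zero => simp
  | succ n ih =>
    rw [pow_succ, pow_succ, Nat.succ_mul,
      coeff_mul_of_mem (polynomialFiltration_isMulFiltration.pow_mem hr n) hr, ih]

variable [hp : Fact p.Prime] {G : Type*} [Group G]

/-- A group homomorphism to the units of a filtered algebra defines a `p`-central series. -/
def IsMulFiltration.series {A : Type*} [Ring A] [Algebra (ZMod p) A]
    {E : ℕ → Submodule (ZMod p) A} (hE : IsMulFiltration E) (μ : G →* A)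
    (hμ : ∀ g, μ g - 1 ∈ E 1) : PCentralSeries p G :=
  have hμ0 : ∀ g, μ g ∈ E 0 := fun g => by
    have := add_mem (hE.antitone (Nat.zero_le 1) (hμ g)) hE.one_mem
    rwa [sub_add_cancel] at this
  { term := fun k =>
      { carrier := {g | μ g - 1 ∈ E k}
        one_mem' := by
          rw [Set.mem_ofPred_eq, map_one, sub_self]
          exact zero_mem _
        mul_mem' := fun {g h} hg hh => by
          rw [Set.mem_ofPred_eq] at hg hh ⊢
          have h1 := hE.mul_mem hg (hμ0 h)
          rw [add_zero] at h1
          convert add_mem h1 hh using 1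
          rw [map_mul]
          noncomm_ring
        inv_mem' := fun {g} hg => by
          rw [Set.mem_ofPred_eq] at hg ⊢
          have h1 := neg_mem (hE.mul_mem (hμ0 g⁻¹) hg)
          rw [zero_add] at h1
          convert h1 using 1
          rw [mul_sub, ← map_mul, inv_mul_cancel, map_one, mul_one, neg_sub] }
    term_zero := eq_top_iff.2 fun g _ => hE.antitone (Nat.zero_le 1) (hμ g)
    term_one := eq_top_iff.2 fun g _ => hμ g
    term_succ_le := fun k g hg => hE.antitone (Nat.le_succ k) hg
    commutator_le := fun k l => Subgroup.commutator_le.2 fun g hg h hh => by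
      have h1 := hE.mul_mem (hE.lie_mem hg hh) (hμ0 (g⁻¹ * h⁻¹))
      rw [add_zero] at h1
      change μ (g * h * g⁻¹ * h⁻¹) - 1 ∈ E (k + l)
      convert h1 using 1
      have h2 : ⁅μ g - 1, μ h - 1⁆ = μ (g * h) - μ (h * g) := by
        rw [Ring.lie_def, map_mul, map_mul]
        noncomm_ring
      rw [h2, sub_mul, ← map_mul, ← map_mul, mul_assoc (g * h)]
      have h3 : h * g * (g⁻¹ * h⁻¹) = 1 := by group
      rw [h3, map_one]
    pow_mem := fun k g hg => by
      have h1 := hE.pow_mem hg p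
      rw [sub_pow_prime_of_commute (p := p) (Commute.one_right (μ g)), one_pow, ← map_pow] at h1
      exact h1 }

variable {ι : Type*} [DecidableEq ι] {K : AbstractSimplicialComplex ι}

variable (p K) in
/-- The lower `p`-central series of the graph product. -/
abbrev graphSeries : PCentralSeries p (CyclicGraphProduct p K) :=
  PCentralSeries.lower p (CyclicGraphProduct p K)

/-- Elements of square-free type in an associative algebra define a Lie algebra homomorphism from
the associated graded Lie algebra of the graph product: the generator `a_i` is sent to the unit
`1 + v_i t`, and an element of the `k`-th term to its coefficient at `t ^ k`. -/
theorem exists_graphProductHom (v : ι → B) (hv : ∀ i, v i ^ p = 0)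
    (hK : ∀ i j, ({i, j} : Finset ι) ∈ K → v i * v j = v j * v i) :
    ∃ f : (graphSeries p K).Gr →ₗ⁅ZMod p⁆ B,
      (∀ (i : ι) (h : PresentedGroup.of i ∈ (graphSeries p K).term 1),
        f (PCentralSeries.Gr.of _ 1 ⟨PresentedGroup.of i, h⟩) = v i) ∧
      ∀ k (g : (graphSeries p K).term k),
        f (PCentralSeries.Gr.of _ (p * k) ⟨(g : CyclicGraphProduct p K) ^ p,
          (graphSeries p K).pow_mem k g g.2⟩) =
        f (PCentralSeries.Gr.of _ k g) ^ p := by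
  have hpow : ∀ i, (1 + C (v i) * X) ^ p = 1 := fun i => by
    rw [add_pow_prime_of_commute (p := p) (Commute.one_left _), one_pow,
      (commute_X (C (v i))).symm.mul_pow, ← C_pow, hv, C_0, zero_mul, add_zero]
  let unit : ι → (B[X])ˣ := fun i => Units.ofPowEqOne _ p (hpow i) hp.out.ne_zero
  have hunit : ∀ i, (unit i : B[X]) = 1 + C (v i) * X := fun i => rfl
  have hcomm : ∀ i j, ({i, j} : Finset ι) ∈ K → unit i * unit j = unit j * unit i :=
    fun i j hij => by
      ext1
      rw [Units.val_mul, Units.val_mul, hunit, hunit]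
      have h1 : ∀ a b : B, C a * X * (C b * X) = C (a * b) * X ^ 2 := fun a b => by
        rw [mul_assoc, ← mul_assoc X, X_mul_C, mul_assoc (C b), ← mul_assoc (C a), ← C_mul, pow_two]
      have h2 : Commute (C (v i) * X) (C (v j) * X) := by
        rw [commute_iff_eq, h1, h1, hK i j hij]
      exact ((Commute.one_left _).add_left ((Commute.one_right _).add_right h2)).eq
  have hrel : ∀ r ∈ ({r | ∃ i : ι, r = FreeGroup.of i ^ p} ∪
      {r | ∃ i j : ι, ({i, j} : Finset ι) ∈ K ∧
        r = FreeGroup.of i * FreeGroup.of j * (FreeGroup.of j * FreeGroup.of i)⁻¹} :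
      Set (FreeGroup ι)), FreeGroup.lift unit r = 1 := by
    rintro r (⟨i, rfl⟩ | ⟨i, j, hij, rfl⟩)
    · rw [map_pow, FreeGroup.lift_apply_of]
      exact Units.ext (hpow i)
    · simp only [map_mul, map_inv, FreeGroup.lift_apply_of]
      rw [hcomm i j hij, mul_inv_rev, mul_assoc, mul_inv_cancel_left, mul_inv_cancel]
  let μ : CyclicGraphProduct p K →* B[X] := (Units.coeHom B[X]).comp (PresentedGroup.toGroup hrel)
  have hμof : ∀ i, μ (PresentedGroup.of i) = 1 + C (v i) * X := fun i =>
    congrArg (Units.coeHom B[X]) (PresentedGroup.toGroup.of hrel)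
  have hE := polynomialFiltration_isMulFiltration (p := p) (B := B)
  have hμ1 : ∀ g, μ g - 1 ∈ polynomialFiltration p B 1 := by
    intro g k hk
    obtain rfl : k = 0 := by omega
    have h1 : (constantCoeff (R := B)).toMonoidHom.comp μ = 1 := by
      refine MonoidHom.eq_of_eqOn_dense (PresentedGroup.closure_range_of _) ?_
      rintro _ ⟨i, rfl⟩
      change (μ (PresentedGroup.of i)).coeff 0 = 1
      rw [hμof]
      simp
    have h2 : (μ g).coeff 0 = 1 := DFunLike.congr_fun h1 g
    rw [coeff_sub, h2, coeff_one_zero, sub_self]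
  have hμ : ∀ k, ∀ g ∈ (graphSeries p K).term k,
      μ g - 1 ∈ polynomialFiltration p B k := fun k g hg =>
    PCentralSeries.lower_le (hE.series μ hμ1) k hg
  obtain ⟨f, hf, hfp⟩ := hE.exists_gradedHom (p := p) (Γ := graphSeries p K) hμ (Q := B)
    (fun k =>
      { toFun := fun a => a.1.coeff k
        map_add' := fun a b => coeff_add _ _ _
        map_smul' := fun c a => coeff_smul _ _ _ })
    (fun k a ha => ha k (Nat.lt_succ_self k))
    (fun k l a b => by
      change (a.1 * b.1 - b.1 * a.1).coeff (k + l) =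
        a.1.coeff k * b.1.coeff l - b.1.coeff l * a.1.coeff k
      rw [coeff_sub, coeff_mul_of_mem a.2 b.2, add_comm k l, coeff_mul_of_mem b.2 a.2])
    (fun k a => coeff_pow_of_mem a.2 p)
  refine ⟨f, fun i h => ?_, hfp⟩
  rw [hf]
  change (μ (PresentedGroup.of i) - 1).coeff 1 = v i
  rw [hμof, add_sub_cancel_left, coeff_C_mul, coeff_X_one, mul_one]

end Magnus

/-! ### The isomorphism -/

section Isomorphism

variable {p : ℕ} [hp : Fact p.Prime] {ι : Type*} [DecidableEq ι]

open PCentralSeries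

/-- A Lie subalgebra `M` of the associated graded Lie algebra of the lower `p`-central series is
everything if it is closed under the `p`-th powers of homogeneous elements and contains the classes
in degree one of a generating set of the group. Indeed, the elements of the `k`-th terms whose class
is in `M` form a `p`-central series, and the lower one is the least. -/
theorem gr_lower_induction {G : Type*} [Group G] {S : Set G} (hS : Subgroup.closure S = ⊤)
    (M : LieSubalgebra (ZMod p) (lower p G).Gr)
    (hM : ∀ g ∈ S, ∀ h : g ∈ (lower p G).term 1, Gr.of (lower p G) 1 ⟨g, h⟩ ∈ M)
    (hpow : ∀ k (g : (lower p G).term k), Gr.of (lower p G) k g ∈ M →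
      Gr.of (lower p G) (p * k) ⟨(g : G) ^ p, (lower p G).pow_mem k g g.2⟩ ∈ M)
    (x : (lower p G).Gr) :
    x ∈ M := by
  let Γ : PCentralSeries p G :=
    { term := fun k =>
        { carrier := {g | ∃ h : g ∈ (lower p G).term k, Gr.of (lower p G) k ⟨g, h⟩ ∈ M}
          one_mem' := ⟨one_mem _, by
            rw [Gr.of_eq_zero _ _ (one_mem _)]
            exact zero_mem _⟩
          mul_mem' := fun {g h} ⟨hg, hgM⟩ ⟨hh, hhM⟩ => ⟨mul_mem hg hh, by
            have := add_mem hgM hhM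
            rwa [← Gr.of_mul] at this⟩
          inv_mem' := fun {g} ⟨hg, hgM⟩ => ⟨inv_mem hg, by
            have := neg_mem hgM
            rwa [← Gr.of_inv] at this⟩ }
      term_zero := eq_top_iff.2 fun g _ => by
        have h0 : g ∈ (lower p G).term 0 := by rw [(lower p G).term_zero]; trivial
        refine ⟨h0, ?_⟩
        rw [Gr.of_eq_zero _ _ (by rw [(lower p G).term_one]; trivial)]
        exact zero_mem _
      term_one := by
        rw [eq_top_iff, ← hS, Subgroup.closure_le]
        intro g hg
        have h1 : g ∈ (lower p G).term 1 := by rw [(lower p G).term_one]; trivial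
        exact ⟨h1, hM g hg h1⟩
      term_succ_le := fun k g ⟨hg, _⟩ => ⟨(lower p G).term_succ_le k hg, by
        rw [Gr.of_eq_zero _ _ hg]
        exact zero_mem _⟩
      commutator_le := fun k l => Subgroup.commutator_le.2 fun g hg h hh => by
        obtain ⟨hg', hgM⟩ := inv_mem hg
        obtain ⟨hh', hhM⟩ := inv_mem hh
        have h1 := M.lie_mem hgM hhM
        rw [Gr.lie_of] at h1
        have h2 : PCentralSeries.comm g⁻¹ h⁻¹ = g * h * g⁻¹ * h⁻¹ := by
          rw [PCentralSeries.comm, inv_inv, inv_inv]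
        have h3 := (lower p G).comm_mem hg' hh'
        rw [h2] at h3
        refine ⟨h3, ?_⟩
        convert h1 using 2
        exact Subtype.ext h2.symm
      pow_mem := fun k g ⟨hg, hgM⟩ => ⟨(lower p G).pow_mem k g hg, hpow k ⟨g, hg⟩ hgM⟩ }
  induction x using Gr.induction with
  | zero => exact zero_mem _
  | add x y hx hy => exact add_mem hx hy
  | of k g =>
    obtain ⟨_, h⟩ := lower_le Γ k g.2
    exact h

/-- For the induced `p`-power operation, the homomorphism from the graph algebra that sends `u_i` to
the class of `a_i` is an isomorphism. It is injective because followed by the Magnus map it is the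
canonical map to the restricted enveloping algebra. -/
theorem exists_gr_equiv [Finite ι] (K : AbstractSimplicialComplex ι)
    (P : RestrictedLieAlgebra p (graphSeries p K).Gr) (hP : Gr.IsInduced (graphSeries p K) P) :
    ∃ e : (graphSeries p K).Gr ≃ₗ⁅ZMod p⁆ GraphAlgebra p K,
      ∀ x, e (P.pmap x) = pmap p (e x) := by
  have htop : ∀ g, g ∈ (graphSeries p K).term 1 := fun g => by
    rw [(graphSeries p K).term_one]
    trivial
  obtain ⟨Φ, hΦ, hgen⟩ := GraphAlgebra.exists_lift (p := p) (K := K)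
    (fun i => Gr.of (graphSeries p K) 1 ⟨PresentedGroup.of i, htop _⟩)
    (fun i => by
      refine (hP 1 _).trans (Gr.of_eq_zero (graphSeries p K) _ ?_)
      have : (PresentedGroup.of i : CyclicGraphProduct p K) ^ p = 1 :=
        PresentedGroup.one_of_mem (Or.inl ⟨i, rfl⟩)
      rw [Subtype.coe_mk, this]
      exact one_mem _)
    (fun i j hij => by
      rw [Gr.lie_of]
      refine Gr.of_eq_zero (graphSeries p K) _ ?_
      have h1 : (PresentedGroup.of i : CyclicGraphProduct p K) * PresentedGroup.of j *
          (PresentedGroup.of j * PresentedGroup.of i)⁻¹ = 1 :=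
        PresentedGroup.one_of_mem (Or.inr ⟨i, j, hij, rfl⟩)
      have h2 : PCentralSeries.comm (PresentedGroup.of i : CyclicGraphProduct p K)
          (PresentedGroup.of j) = 1 := by
        rw [PCentralSeries.comm, mul_assoc, mul_inv_eq_one.1 h1]
        group
      change PCentralSeries.comm _ _ ∈ _
      rw [h2]
      exact one_mem _)
  obtain ⟨f, hf, hfp⟩ := exists_graphProductHom (p := p) (K := K)
    (fun i => Env.ι p _ (GraphAlgebra.gen p K i))
    (fun i => by
      have := Env.ι_isRestrictedHom p _ (GraphAlgebra.gen p K i)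
      rw [GraphAlgebra.pmap_gen, map_zero] at this
      exact this.symm)
    (fun i j hij => by
      have := LieHom.map_lie (Env.ι p _) (GraphAlgebra.gen p K i) (GraphAlgebra.gen p K j)
      rw [GraphAlgebra.lie_gen hij, map_zero, Ring.lie_def] at this
      exact sub_eq_zero.1 this.symm)
  have hfr : IsRestrictedHom p f := by
    refine isRestrictedHom_of_span f (S := {x | ∃ k g, x = Gr.of (graphSeries p K) k g}) ?_ ?_
    · refine eq_top_iff.2 fun x _ => ?_
      induction x using Gr.induction with
      | zero => exact zero_mem _
      | add x y hx hy => exact add_mem (hx trivial) (hy trivial)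
      | of k g => exact Submodule.subset_span ⟨k, g, rfl⟩
    · rintro _ ⟨k, g, rfl⟩
      rw [show pmap p (Gr.of (graphSeries p K) k g) = _ from hP k g]
      exact hfp k g
  have hcomp : f.comp Φ = Env.ι p (GraphAlgebra p K) := by
    refine quotient_free_hom_ext (fun x => ?_) (Env.ι_isRestrictedHom p _) fun i => ?_
    · rw [LieHom.comp_apply, hΦ, hfr]
      rfl
    · change f (Φ (GraphAlgebra.gen p K i)) = _
      rw [hgen]
      exact hf i _
  have hinj : Function.Injective Φ := fun x y hxy =>
    GraphAlgebra.ι_injective K (by rw [← hcomp, LieHom.comp_apply, LieHom.comp_apply, hxy])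
  have hsurj : Function.Surjective Φ := fun x => by
    refine (LieHom.mem_range Φ x).1 ?_
    refine gr_lower_induction (PresentedGroup.closure_range_of _) Φ.range ?_ ?_ x
    · rintro _ ⟨i, rfl⟩ h
      exact (LieHom.mem_range _ _).2 ⟨_, hgen i⟩
    · intro k g hg
      obtain ⟨y, hy⟩ := (LieHom.mem_range _ _).1 hg
      refine (LieHom.mem_range _ _).2 ⟨pmap p y, ?_⟩
      rw [hΦ, hy]
      exact hP k g
  have hbij : Function.Bijective Φ := ⟨hinj, hsurj⟩
  refine ⟨(LieEquiv.ofBijective Φ hbij).symm, fun x => ?_⟩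
  obtain ⟨y, rfl⟩ := hsurj x
  have hsymm : ∀ z, (LieEquiv.ofBijective Φ hbij).symm (Φ z) = z := fun z =>
    (LieEquiv.ofBijective Φ hbij).symm_apply_apply z
  rw [← hΦ, hsymm, hsymm]

end Isomorphism

/-! ### The graph product of `p`-Lie algebras -/

namespace OneGenerator

variable {p : ℕ}

theorem pmap_gen : pmap p (gen p) = 0 :=
  quotientMk_eq_zero.2 (subset_restrictedSpan p _ rfl)

variable [hp : Fact p.Prime]

/-- The trivial one-generator algebra is spanned by its generator. -/
theorem exists_eq_smul_gen (x : OneGenerator p) : ∃ a : ZMod p, x = a • gen p := by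
  induction x using quotient_free_induction with
  | of x => exact ⟨1, (one_smul _ _).symm⟩
  | zero => exact ⟨0, (zero_smul _ _).symm⟩
  | add x y hx hy =>
    obtain ⟨a, rfl⟩ := hx
    obtain ⟨b, rfl⟩ := hy
    exact ⟨a + b, (add_smul _ _ _).symm⟩
  | smul c x hx =>
    obtain ⟨a, rfl⟩ := hx
    exact ⟨c * a, (mul_smul _ _ _).symm⟩
  | lie x y hx hy =>
    obtain ⟨a, rfl⟩ := hx
    obtain ⟨b, rfl⟩ := hy
    exact ⟨0, by rw [smul_lie, lie_smul, lie_self, smul_zero, smul_zero, zero_smul]⟩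
  | pow x hx =>
    obtain ⟨a, rfl⟩ := hx
    exact ⟨0, by rw [smul_pmap, pmap_gen, smul_zero, zero_smul]⟩

theorem lie_eq_zero (x y : OneGenerator p) : ⁅x, y⁆ = 0 := by
  obtain ⟨a, rfl⟩ := exists_eq_smul_gen x
  obtain ⟨b, rfl⟩ := exists_eq_smul_gen y
  rw [smul_lie, lie_smul, lie_self, smul_zero, smul_zero]

theorem pmap_eq_zero (x : OneGenerator p) : pmap p x = 0 := by
  obtain ⟨a, rfl⟩ := exists_eq_smul_gen x
  rw [smul_pmap, pmap_gen, smul_zero]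

theorem exists_lift {M : Type*} [LieRing M] [LieAlgebra (ZMod p) M] [RestrictedLieAlgebra p M]
    (v : M) (hv : pmap p v = 0) :
    ∃ f : OneGenerator p →ₗ⁅ZMod p⁆ M, f (gen p) = v := by
  obtain ⟨g, ⟨hg, hgv⟩, -⟩ := FreeRestricted.existsUnique_lift (p := p) fun _ : Unit => v
  obtain ⟨f, -, hfg⟩ := exists_quotientLift (p := p) (S := {pmap p (FreeRestricted.of p ())}) g hg
    (pmap_zero p M) (by
      rintro x rfl
      rw [hg, hgv, hv])
  exact ⟨f, (hfg _).trans (hgv ())⟩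

end OneGenerator

section GraphProduct

variable {p : ℕ} [hp : Fact p.Prime]

theorem pmap_sum_of_lie_eq_zero {M : Type*} [LieRing M] [LieAlgebra (ZMod p) M]
    [RestrictedLieAlgebra p M] {α : Type*} (s : Finset α) (y : α → M)
    (h : ∀ i ∈ s, ∀ j ∈ s, ⁅y i, y j⁆ = 0) : pmap p (∑ i ∈ s, y i) = ∑ i ∈ s, pmap p (y i) := by
  classical
  induction s using Finset.induction_on with
  | empty => rw [Finset.sum_empty, Finset.sum_empty, pmap_zero]
  | insert a s ha ih =>
    rw [Finset.sum_insert ha, Finset.sum_insert ha, pmap_add, ← ih fun i hi j hj =>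
      h i (Finset.mem_insert_of_mem hi) j (Finset.mem_insert_of_mem hj)]
    have h0 : ⁅y a, ∑ i ∈ s, y i⁆ = 0 := by
      rw [lie_sum]
      exact Finset.sum_eq_zero fun i hi =>
        h a (Finset.mem_insert_self a s) i (Finset.mem_insert_of_mem hi)
    have h1 := jacobsonSum_of_lie_eq_zero (p := p) h0
    rw [jacobsonSum] at h1
    rw [h1, add_zero]

variable {ι : Type*} [DecidableEq ι] (K : AbstractSimplicialComplex ι)

theorem pair_mem_of_simplex (I : Simplex K) {i j : ι} (hi : i ∈ I.1) (hj : j ∈ I.1) :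
    ({i, j} : Finset ι) ∈ K := by
  rcases I.2 with h | h
  · rw [h] at hi
    exact absurd hi (Finset.notMem_empty i)
  · refine (K.isRelLowerSet_faces h).2 ?_ ⟨i, Finset.mem_insert_self _ _⟩
    intro k hk
    rcases Finset.mem_insert.1 hk with rfl | hk
    · exact hi
    · rwa [Finset.mem_singleton.1 hk]

theorem sum_extendByZero {A M : Type*} [Zero A] [AddCommMonoid M] (f : ι → A → M)
    (hf : ∀ i, f i 0 = 0) {I J : Finset ι} (hIJ : I ⊆ J) (x : I → A) :
    ∑ j : J, f j (extendByZero (A := fun _ => A) J x j) = ∑ i : I, f i (x i) := by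
  have h : ∀ J : Finset ι, ∑ j : J, f j (extendByZero (A := fun _ => A) J x j) =
      ∑ j ∈ J, f j (if h : j ∈ I then x ⟨j, h⟩ else 0) := fun J =>
    Finset.sum_coe_sort J fun j => f j (if h : j ∈ I then x ⟨j, h⟩ else 0)
  have h2 : ∑ i : I, f i (x i) = ∑ i : I, f i (extendByZero (A := fun _ => A) I x i) :=
    Finset.sum_congr rfl fun i _ => by rw [extendByZero, dif_pos i.2]
  rw [h2, h, h]
  refine (Finset.sum_subset hIJ fun j _ hj => ?_).symm
  rw [dif_neg hj, hf]

/-- The graph algebra is the graph product of trivial one-generator algebras: a homomorphism from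
it amounts to elements with vanishing `p`-powers, which commute along the edges of `K`. -/
theorem exists_isGraphProduct :
    ∃ φ : ∀ I : Simplex K, (∀ _ : I.1, OneGenerator p) →ₗ⁅ZMod p⁆ GraphAlgebra p K,
      (∀ i, φ (Simplex.vertex K i) (fun _ => OneGenerator.gen p) = GraphAlgebra.gen p K i) ∧
      IsGraphProduct.{w} p K (fun _ => OneGenerator p) φ := by
  choose f hf using fun i => OneGenerator.exists_lift (p := p) (GraphAlgebra.gen p K i)
    (GraphAlgebra.pmap_gen K i)
  have hflie : ∀ {i j : ι}, ({i, j} : Finset ι) ∈ K → ∀ x y, ⁅f i x, f j y⁆ = 0 := by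
    intro i j hij x y
    obtain ⟨a, rfl⟩ := OneGenerator.exists_eq_smul_gen x
    obtain ⟨b, rfl⟩ := OneGenerator.exists_eq_smul_gen y
    rw [map_smul, map_smul, hf, hf, smul_lie, lie_smul, GraphAlgebra.lie_gen hij, smul_zero,
      smul_zero]
  let φ : ∀ I : Simplex K, (∀ _ : I.1, OneGenerator p) →ₗ⁅ZMod p⁆ GraphAlgebra p K := fun I =>
    { toFun := fun x => ∑ i : I.1, f i (x i)
      map_add' := fun x y => by
        rw [← Finset.sum_add_distrib]
        exact Finset.sum_congr rfl fun i _ => map_add _ _ _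
      map_smul' := fun c x => by
        rw [RingHom.id_apply, Finset.smul_sum]
        exact Finset.sum_congr rfl fun i _ => map_smul (f i) c (x i)
      map_lie' := fun {x y} => by
        rw [sum_lie_sum]
        refine (Finset.sum_eq_zero fun i _ => ?_).trans (Finset.sum_eq_zero fun i _ =>
          Finset.sum_eq_zero fun j _ => hflie (pair_mem_of_simplex K I i.2 j.2) _ _).symm
        exact (congrArg (f i) (OneGenerator.lie_eq_zero (x i) (y i))).trans (map_zero (f i)) }
  have hφ : ∀ I x, φ I x = ∑ i : I.1, f i (x i) := fun _ _ => rfl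
  have hvertex : ∀ i x, φ (Simplex.vertex K i) x = f i (x ⟨i, Finset.mem_singleton_self i⟩) :=
    fun i x => Fintype.sum_eq_single (⟨i, Finset.mem_singleton_self i⟩ : ({i} : Finset ι))
      fun j hj => absurd (Subtype.ext (Finset.mem_singleton.1 j.2)) hj
  refine ⟨φ, fun i => ?_, ⟨?_, ?_⟩, ?_⟩
  · rw [hvertex, hf]
  · intro I x
    have h1 : pmap p x = 0 := funext fun i => OneGenerator.pmap_eq_zero (x i)
    rw [h1, map_zero, hφ, pmap_sum_of_lie_eq_zero _ _ fun i _ j _ =>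
      hflie (pair_mem_of_simplex K I i.2 j.2) _ _]
    refine (Finset.sum_eq_zero fun i _ => ?_).symm
    obtain ⟨a, ha⟩ := OneGenerator.exists_eq_smul_gen (x i)
    rw [ha, map_smul, hf, smul_pmap, GraphAlgebra.pmap_gen, smul_zero]
  · exact fun I J hIJ x => sum_extendByZero (fun i => f i) (fun i => map_zero _) hIJ x
  · intro M _ _ _ ψ hψ
    let v : ι → M := fun i => ψ (Simplex.vertex K i) fun _ => OneGenerator.gen p
    obtain ⟨F, hF, hFv⟩ := GraphAlgebra.exists_lift (p := p) (K := K) v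
      (fun i => by
        rw [← hψ.isRestrictedHom]
        exact (congrArg _ (funext fun _ => OneGenerator.pmap_gen)).trans (map_zero (ψ _)))
      (fun i j hij => by
        have hi : (Simplex.vertex K i).1 ⊆ ({i, j} : Finset ι) := by
          simp [Simplex.vertex]
        have hj : (Simplex.vertex K j).1 ⊆ ({i, j} : Finset ι) := by
          simp [Simplex.vertex]
        change ⁅ψ _ _, ψ _ _⁆ = 0
        rw [← hψ.compatible (Simplex.vertex K i) ⟨{i, j}, Or.inr hij⟩ hi,
          ← hψ.compatible (Simplex.vertex K j) ⟨{i, j}, Or.inr hij⟩ hj, ← LieHom.map_lie]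
        exact (congrArg _ (funext fun _ => OneGenerator.lie_eq_zero _ _)).trans (map_zero (ψ _)))
    have hFf : ∀ i y, F (f i y) = ψ (Simplex.vertex K i) fun _ => y := fun i y => by
      obtain ⟨a, rfl⟩ := OneGenerator.exists_eq_smul_gen y
      rw [map_smul, map_smul, hf, hFv]
      exact (map_smul (ψ (Simplex.vertex K i)) a fun _ => OneGenerator.gen p).symm
    refine ⟨F, ⟨hF, fun I x => ?_⟩, fun F' hF' => ?_⟩
    · have hx : x = ∑ i : I.1, extendByZero (I := {(i : ι)}) (A := fun _ => OneGenerator p) I.1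
          fun _ => x i := by
        funext j
        rw [Finset.sum_apply, Finset.sum_eq_single j]
        · rw [extendByZero, dif_pos (Finset.mem_singleton_self _)]
        · intro i _ hi
          rw [extendByZero, dif_neg]
          exact fun h => hi (Subtype.ext (Finset.mem_singleton.1 h).symm)
        · exact fun h => absurd (Finset.mem_univ j) h
      rw [hφ, map_sum]
      conv_rhs => rw [hx, map_sum]
      refine Finset.sum_congr rfl fun i _ => ?_
      rw [hFf]
      exact (hψ.compatible (Simplex.vertex K i) I (Finset.singleton_subset_iff.2 i.2) _).symm
    · refine quotient_free_hom_ext hF'.1 hF fun i => ?_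
      change F' (GraphAlgebra.gen p K i) = F (GraphAlgebra.gen p K i)
      have h1 : F' (φ _ _) = _ := hF'.2 (Simplex.vertex K i) fun _ => OneGenerator.gen p
      rw [hvertex, hf] at h1
      rw [hFv, h1]

end GraphProduct

end RestrictedLie

theorem theorem5p1 {m : ℕ} (K : AbstractSimplicialComplex (Fin m)) (p : ℕ) [Fact p.Prime] :
    (∃ P : RestrictedLieAlgebra p (PCentralSeries.lower p (CyclicGraphProduct p K)).Gr,
      PCentralSeries.Gr.IsInduced (PCentralSeries.lower p (CyclicGraphProduct p K)) P ∧
      ∃ e : (PCentralSeries.lower p (CyclicGraphProduct p K)).Gr ≃ₗ⁅ZMod p⁆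
          RestrictedLie.GraphAlgebra p K,
        ∀ x, e (P.pmap x) = RestrictedLieAlgebra.pmap p (e x)) ∧
    (∃ φ : ∀ I : RestrictedLie.Simplex K,
        (∀ _ : I.1, RestrictedLie.OneGenerator p) →ₗ⁅ZMod p⁆ RestrictedLie.GraphAlgebra p K,
      (∀ i : Fin m, φ (RestrictedLie.Simplex.vertex K i)
        (fun _ => RestrictedLie.OneGenerator.gen p) = RestrictedLie.GraphAlgebra.gen p K i) ∧
      RestrictedLie.IsGraphProduct.{w} p K (fun _ => RestrictedLie.OneGenerator p) φ) := by
  have hfg : Group.FG (CyclicGraphProduct p K) := QuotientGroup.fg _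
  obtain ⟨P, hP⟩ := PCentralSeries.Gr.exists_isInduced
    (PCentralSeries.lower p (CyclicGraphProduct p K))
  exact ⟨⟨P, hP, RestrictedLie.exists_gr_equiv K P hP⟩, RestrictedLie.exists_isGraphProduct K⟩
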